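/- Setting. Let $\mathbb T=\mathbb R/2\pi\mathbb Z$, let $s\ge 1$ be real, let $\psi_{\mathrm{in}}\in H^s(\mathbb T)$ (complex-valued), let $v_0\in H^s(\mathbb T)$ and $v_j\in H^s(\mathbb T)\cap W^{1,\infty}(\mathbb T)$, $j\ge 1$, be real-valued, let $\lambda_1\ge\lambda_2\ge\dots>0$, and let $G$ be a bounded linear functional on $H^1(\mathbb T)$. Put $b_j=\lambda_j\|v_j\|_{W^{1,\infty}(\mathbb T)}$ with $\|v\|_{W^{1,\infty}}=\max\{\|v\|_{L^\infty},\|v'\|_{L^\infty}\}$, and assume $\sum_j\lambda_j\|v_j\|_{H^s(\mathbb T)}<\infty$ and $\sum_j b_j^p<\infty$ for some $p\in(0,1]$. For $\xi\in\mathbb R^m$ let $V_m(\xi,x)=v_0(x)+\sum_{j=1}^m\lambda_j\xi_jv_j(x)$ and, for a time step $\tau>0$, define the Lie--Trotter approximations by $\psi_m^0=\psi_{\mathrm{in}}$, $\psi_m^{n+1}=\mathrm e^{\mathrm i\tau\partial_x^2/2}\mathrm e^{-\mathrm i\tau V_m}\psi_m^n$. Expectations $\mathbb E$ are taken with $\xi\in\mathbb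 R^m$ standard Gaussian. Let $\Phi$ be the standard normal distribution function. For $F$ on $\mathbb R^m$, $N\ge 1$, a generating vector $\boldsymbol z\in\mathbb N^m$ and a shift $\boldsymbol\Delta$ uniform on $[0,1]^m$, the randomly shifted lattice rule is $$Q_{m,N}(F;\boldsymbol\Delta)=\frac1N\sum_{k=1}^N F\Big(\boldsymbol\Phi_m^{-1}\big(\mathrm{frac}(k\boldsymbol z/N+\boldsymbol\Delta)\big)\Big).$$ Parameters. Fix $T>0$, $C_T=\max\{1,T\}$ and $\delta\in(0,1/2]$. Let $\lambda^*=\frac1{2-2\delta}$ if $0<p\le\frac23$ and $\lambda^*=\frac p{2-p}$ if $\frac23<p\le1$; let $$\theta_j=\tfrac12\Big(b_j+\sqrt{b_j^2+1-\tfrac1{2\lambda^*}}\Big),\qquad \varrho(\lambda,\theta)=2\left(\frac{\sqrt{2\pi}\exp(\theta^2/\eta_*)}{\pi^{2-2\eta_*}(1-\eta_*)\eta_*}\right)^{\lambda}\zeta\big(\lambda+\tfrac12\big),\quad \eta_*=\frac{2\lambda-1}{4\lambda},$$ and, for finite sets $u\subset\{1,2,\dots\}$, $$\gamma_u=\Big(((|u|+1)!)^2(4C_T)^{2|u|}\prod_{j\in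 u}\frac{b_j^2}{(\theta_j-b_j)\,\varrho(\lambda^*,\theta_j)}\Big)^{1/(1+\lambda^*)}.$$ If $p=1$, assume in addition that there is a constant $\theta_{\max}$ with $\theta_j<\theta_{\max}$ for all $j$ and $$\sum_{j=1}^\infty b_j<\frac{\big(\inf_j(\theta_j-b_j)\big)^{1/2}}{4C_T\,\varrho(1,\theta_{\max})^{1/2}}.$$ CBC construction. For the weights $\gamma_u$ and the weight functions $w_j(t)=\mathrm e^{-\theta_j|t|}$, the shift averaged worst case error is given by $$e^{\mathrm{sh}}_{d,N}(z_1,\dots,z_d)^2=\frac1N\sum_{k=1}^N\ \sum_{\emptyset\ne u\subseteq\{1,\dots,d\}}\gamma_u\prod_{j\in u}\vartheta_j\big(\mathrm{frac}(kz_j/N)\big),$$ $$\vartheta_j(f)=\int_{\mathbb R}\frac{\max\{\Phi(t)-f,0\}+\max\{\Phi(t)-1+f,0\}-\Phi(t)^2}{w_j(t)^2}\,\mathrm dt .$$ A vector $\boldsymbol z$ is constructed by the CBC algorithm if $z_1=1$ and, for $d=2,\dots,m$, $z_d$ minimizes $e^{\mathrm{sh}}_{d,N}(z_1,\dots,z_{d-1},\cdot)$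 over $\{z:1\le z\le N-1,\ \gcd(z,N)=1\}$ (over $\{1\}$ if $N=1$). Claim. Let $\kappa=1-\delta$ if $0<p\le\frac23$ and $\kappa=\frac1p-\frac12$ if $\frac23<p\le1$. There is a constant $C>0$, independent of $m$, $\tau$, $n$ and $N$, such that for all $m,N\ge1$ a vector $\boldsymbol z$ constructed by the CBC algorithm exists, and for every such $\boldsymbol z$, all $\tau>0$ and all integers $n\ge0$ with $n\tau\le T$: $|\psi_m^n(\xi)|^2\in H^1(\mathbb T)$ for every $\xi\in\mathbb R^m$, $G(|\psi_m^n|^2)$ is integrable, the quadrature error is square integrable in $\boldsymbol\Delta$, and $$\sqrt{\mathbb E^{\boldsymbol\Delta}\Big[\big|\mathbb E[G(|\psi_m^n|^2)]-Q_{m,N}(G(|\psi_m^n|^2);\boldsymbol\Delta)\big|^2\Big]}\le C\,\varphi_{\mathrm{tot}}(N)^{-\kappa},$$ where $\varphi_{\mathrm{tot}}$ is Euler's totient function; moreover, if $N\le10^{30}$, the left-hand side is at most $C\,N^{-\kappa}$. -/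

import Mathlib

open MeasureTheory ProbabilityTheory Real AddCircle
open scoped ENNReal ContDiff

noncomputable section

namespace QMCTS

/-! ## Function spaces on the one-dimensional torus -/

instance torusPeriodPos : Fact (0 < 2 * π) := ⟨Real.two_pi_pos⟩

/-- The one-dimensional torus `ℝ / 2πℤ`. -/
abbrev Torus : Type := AddCircle (2 * π)

/-- The normalized (total mass one) Lebesgue measure on the torus. -/
abbrev torusMeasure : Measure Torus := haarAddCircle

/-- The complex Hilbert space `L²(𝕋)`. -/
abbrev L2T : Type := Lp ℂ 2 torusMeasure

/-- `f ∈ H^s(𝕋)`: `f` is square integrable and `∑ₙ (1 + n²)^s |f̂(n)|² < ∞`. -/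
def MemSobolev (s : ℝ) (f : Torus → ℂ) : Prop :=
  MemLp f 2 torusMeasure ∧
    Summable fun n : ℤ => (1 + (n : ℝ) ^ 2) ^ s * ‖fourierCoeff f n‖ ^ 2

/-- The norm of `H^s(𝕋)`. -/
def sobolevNorm (s : ℝ) (f : Torus → ℂ) : ℝ :=
  √(∑' n : ℤ, (1 + (n : ℝ) ^ 2) ^ s * ‖fourierCoeff f n‖ ^ 2)

/-- The complex vector space `H^s(𝕋)`, as a subspace of `L²(𝕋)`. -/
def sobolev (s : ℝ) : Submodule ℂ L2T where
  carrier := {f | MemSobolev s f}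
  zero_mem' := by
    refine ⟨Lp.memLp _, ?_⟩
    have h : ∀ n : ℤ, fourierCoeff ((0 : L2T) : Torus → ℂ) n = 0 := fun n => by
      rw [fourierCoeff_congr_ae (Lp.coeFn_zero ℂ 2 torusMeasure)]
      simp [fourierCoeff]
    simp only [h]
    simp
  add_mem' := by
    rintro f g ⟨_, hf⟩ ⟨_, hg⟩
    refine ⟨Lp.memLp _, ?_⟩
    have h : ∀ n : ℤ, fourierCoeff ((f + g : L2T) : Torus → ℂ) n
        = fourierCoeff f n + fourierCoeff g n := fun n => by
      simp only [← fourierBasis_repr, map_add]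
      rfl
    refine Summable.of_nonneg_of_le (fun n => by positivity) (fun n => ?_)
      ((hf.add hg).mul_left 2)
    have hw : (0 : ℝ) ≤ (1 + (n : ℝ) ^ 2) ^ s := by positivity
    refine le_of_le_of_eq (b := (1 + (n : ℝ) ^ 2) ^ s
      * (2 * (‖fourierCoeff f n‖ ^ 2 + ‖fourierCoeff g n‖ ^ 2))) ?_ (by ring)
    rw [h n]
    refine mul_le_mul_of_nonneg_left ?_ hw
    have h1 := norm_add_le (fourierCoeff f n) (fourierCoeff g n)
    nlinarith [sq_nonneg (‖fourierCoeff f n‖ - ‖fourierCoeff g n‖),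
      norm_nonneg (fourierCoeff f n + fourierCoeff g n)]
  smul_mem' := by
    rintro c f ⟨_, hf⟩
    refine ⟨Lp.memLp _, ?_⟩
    have h : ∀ n : ℤ, fourierCoeff ((c • f : L2T) : Torus → ℂ) n
        = c * fourierCoeff f n := fun n => by
      simp only [← fourierBasis_repr, map_smul]
      rfl
    refine (hf.mul_left (‖c‖ ^ 2)).congr (fun n => ?_)
    rw [h n, norm_mul]
    ring

theorem toLp_mem_sobolev {s : ℝ} {f : Torus → ℂ} (hf : MemSobolev s f) :
    hf.1.toLp f ∈ sobolev s := by
  refine ⟨Lp.memLp _, ?_⟩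
  rw [fourierCoeff_congr_ae hf.1.coeFn_toLp]
  exact hf.2

/-- `g` is the weak derivative of `f` on the torus, tested against smooth periodic functions. -/
def IsWeakDeriv (f g : Torus → ℝ) : Prop :=
  Integrable f torusMeasure ∧ Integrable g torusMeasure ∧
    ∀ φ : ℝ → ℝ, ContDiff ℝ ∞ φ → Function.Periodic φ (2 * π) →
      ∫ x in (0 : ℝ)..(2 * π), f (x : Torus) * deriv φ x
        = -∫ x in (0 : ℝ)..(2 * π), g (x : Torus) * φ x

/-- The norm `max (‖f‖_{L^∞}) (‖f'‖_{L^∞})` of `W^{1,∞}(𝕋)`. The infimum runs over the weak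
derivatives of `f`, which agree almost everywhere; it is `∞` if there is none. -/
def w1infNorm (f : Torus → ℝ) : ℝ≥0∞ :=
  max (eLpNorm f ⊤ torusMeasure)
    (⨅ (g : Torus → ℝ) (_ : IsWeakDeriv f g), eLpNorm g ⊤ torusMeasure)

/-- `f ∈ W^{1,∞}(𝕋)`. -/
def MemW1inf (f : Torus → ℝ) : Prop :=
  AEStronglyMeasurable f torusMeasure ∧ w1infNorm f < ⊤

/-! ## The random potential and the Lie-Trotter splitting

Sequences that are usually indexed by `1, 2, …` are indexed by `0, 1, …` here. -/

/-- The truncated potential `V_m(ξ, x) = v₀(x) + ∑_{j ≤ m} λ_j ξ_j v_j(x)`. -/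
def potential (v₀ : Torus → ℝ) (v : ℕ → Torus → ℝ) (lam : ℕ → ℝ) {m : ℕ} (ξ : Fin m → ℝ)
    (x : Torus) : ℝ :=
  v₀ x + ∑ j : Fin m, lam j * ξ j * v j x

/-- The potential subflow: multiplication by `exp(-iτV)`. -/
def potentialFlow (τ : ℝ) (V : Torus → ℝ) (f : Torus → ℂ) (x : Torus) : ℂ :=
  Complex.exp (-(Complex.I * τ * V x)) * f x

/-- The kinetic subflow `exp(iτ∂ₓ²/2)`: the Fourier multiplier `exp(-iτn²/2)` on `L²(𝕋)`, as a
series that converges in `L²(𝕋)`. -/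
def kineticFlow (τ : ℝ) (f : Torus → ℂ) : L2T :=
  ∑' n : ℤ, (Complex.exp (-(Complex.I * τ * (n : ℂ) ^ 2 / 2)) * fourierCoeff f n) •
    fourierLp 2 n

/-- The Lie-Trotter approximation `ψⁿ` with step size `τ` for the potential `V`. -/
def lieTrotter (ψin : L2T) (V : Torus → ℝ) (τ : ℝ) : ℕ → L2T
  | 0 => ψin
  | n + 1 => kineticFlow τ (potentialFlow τ V (lieTrotter ψin V τ n))

/-- The Lie-Trotter approximation `ψ_m^n` as a function of `ξ ∈ ℝ^m`. -/
def semiDiscrete (ψin : L2T) (v₀ : Torus → ℝ) (v : ℕ → Torus → ℝ) (lam : ℕ → ℝ) (τ : ℝ) (n : ℕ)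
    {m : ℕ} (ξ : Fin m → ℝ) : L2T :=
  lieTrotter ψin (potential v₀ v lam ξ) τ n

/-- The position density `|ψ|²`. -/
def density (ψ : L2T) (x : Torus) : ℂ := ((‖ψ x‖ ^ 2 : ℝ) : ℂ)

open Classical in
/-- The value at `f` of a linear functional `G` on `H¹(𝕋)` (zero if `f` is not in `H¹(𝕋)`). -/
def observable (G : sobolev 1 →ₗ[ℂ] ℂ) (f : Torus → ℂ) : ℂ :=
  if hf : MemSobolev 1 f then G ⟨hf.1.toLp f, toLp_mem_sobolev hf⟩ else 0

/-- The random quantity of interest `ξ ↦ G(|ψ_m^n(ξ)|²)` on `ℝ^m`. -/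
def quantity (G : sobolev 1 →ₗ[ℂ] ℂ) (ψin : L2T) (v₀ : Torus → ℝ) (v : ℕ → Torus → ℝ)
    (lam : ℕ → ℝ) (τ : ℝ) (n m : ℕ) (ξ : Fin m → ℝ) : ℂ :=
  observable G (density (semiDiscrete ψin v₀ v lam τ n ξ))

/-! ## Gaussian measure and randomly shifted lattice rules -/

/-- The standard normal distribution function. -/
def gaussCdf (y : ℝ) : ℝ := cdf (gaussianReal 0 1) y

/-- The inverse of the standard normal distribution function on `(0, 1)`. -/
def gaussInv (y : ℝ) : ℝ := sInf {x : ℝ | y ≤ gaussCdf x}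

/-- The standard Gaussian measure on `ℝ^m`. -/
def gaussMeasure (m : ℕ) : Measure (Fin m → ℝ) := Measure.pi fun _ => gaussianReal 0 1

/-- The uniform distribution on `[0, 1]^m`. -/
def uniformCube (m : ℕ) : Measure (Fin m → ℝ) := volume.restrict (Set.Icc 0 1)

/-- The `k`-th point of the lattice rule with generating vector `(z 0, …, z (m - 1))` and
shift `Δ`, mapped to `ℝ^m`. -/
def latticePoint {m : ℕ} (N : ℕ) (z : ℕ → ℕ) (Δ : Fin m → ℝ) (k : ℕ) : Fin m → ℝ :=
  fun j => gaussInv (Int.fract ((k : ℝ) * z j / N + Δ j))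

/-- The randomly shifted lattice rule. -/
def qmc {m : ℕ} (N : ℕ) (z : ℕ → ℕ) (F : (Fin m → ℝ) → ℂ) (Δ : Fin m → ℝ) : ℂ :=
  (1 / (N : ℂ)) * ∑ k ∈ Finset.Icc 1 N, F (latticePoint N z Δ k)

/-- The error of the randomly shifted lattice rule for the shift `Δ`. -/
def qmcError {m : ℕ} (N : ℕ) (z : ℕ → ℕ) (F : (Fin m → ℝ) → ℂ) (Δ : Fin m → ℝ) : ℂ :=
  (∫ ξ, F ξ ∂gaussMeasure m) - qmc N z F Δ

/-- The root mean square error of the randomly shifted lattice rule for a uniform shift. -/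
def rmsError {m : ℕ} (N : ℕ) (z : ℕ → ℕ) (F : (Fin m → ℝ) → ℂ) : ℝ :=
  √(∫ Δ, ‖qmcError N z F Δ‖ ^ 2 ∂uniformCube m)

/-! ## Weighted space, shift averaged worst case error and the CBC algorithm -/

/-- The weight function `w(t) = exp(-θ|t|)`. -/
def weightFun (θ t : ℝ) : ℝ := Real.exp (-(θ * |t|))

/-- The univariate shift-invariant kernel
`∫ ((Φ(t) - f)₊ + (Φ(t) - 1 + f)₊ - Φ(t)²) / w(t)² dt`, `f ∈ [0, 1)`. It is the average over the
shift `Δ ∈ [0, 1]` of `η(Φ⁻¹(Δ), Φ⁻¹(frac(Δ + f)))`, where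
`η(x, y) = ∫ (Φ(t) - 1_{t > x}) (Φ(t) - 1_{t > y}) / w(t)² dt` is the reproducing kernel of the
functions of Gaussian mean zero with the norm `(∫ |F'|² w²)^{1/2}`. -/
def shiftKernel (θ f : ℝ) : ℝ :=
  ∫ t : ℝ, (max (gaussCdf t - f) 0 + max (gaussCdf t - 1 + f) 0 - gaussCdf t ^ 2)
    / weightFun θ t ^ 2

/-- The shift averaged worst case error `e^sh_{d,N}(z_1, …, z_d)`, over the unit ball of the
weighted unanchored Sobolev space with weights `γ` and weight functions `exp(-θ_j|·|)`, of the
lattice rule with generating vector `(z 0, …, z (d - 1))`, by its explicit expression. -/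
def shiftAvgError (γ : Finset ℕ → ℝ) (θ : ℕ → ℝ) (N d : ℕ) (z : ℕ → ℕ) : ℝ :=
  √((1 / (N : ℝ)) * ∑ k ∈ Finset.Icc 1 N,
    ∑ u ∈ (Finset.range d).powerset with u.Nonempty,
      γ u * ∏ j ∈ u, shiftKernel (θ j) (Int.fract ((k : ℝ) * z j / N)))

/-- The admissible components of a generating vector: `1 ≤ c ≤ N - 1` with `gcd(c, N) = 1` if
`N ≥ 2`, and `c = 1` if `N = 1`. -/
def IsAdmissible (N c : ℕ) : Prop := 1 ≤ c ∧ c ≤ N ∧ Nat.gcd c N = 1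

/-- `(z 0, …, z (m - 1))` is a possible output of the component-by-component algorithm: the first
component is `1`, and each further component minimizes the shift averaged worst case error of the
rule built so far, the previous components being kept. -/
def IsCBC (γ : Finset ℕ → ℝ) (θ : ℕ → ℝ) (N m : ℕ) (z : ℕ → ℕ) : Prop :=
  (0 < m → z 0 = 1) ∧
    ∀ k, 1 ≤ k → k < m → IsAdmissible N (z k) ∧
      ∀ c, IsAdmissible N c →
        shiftAvgError γ θ N (k + 1) z ≤ shiftAvgError γ θ N (k + 1) (Function.update z k c)

/-! ## The choice of the parameters -/

/-- `b_j = λ_j ‖v_j‖_{W^{1,∞}}`. -/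
def bSeq (v : ℕ → Torus → ℝ) (lam : ℕ → ℝ) (j : ℕ) : ℝ := lam j * (w1infNorm (v j)).toReal

/-- `λ*`. -/
def lamStar (p δ : ℝ) : ℝ := if p ≤ 2 / 3 then 1 / (2 - 2 * δ) else p / (2 - p)

/-- The convergence rate. -/
def rate (p δ : ℝ) : ℝ := if p ≤ 2 / 3 then 1 - δ else 1 / p - 1 / 2

/-- `η_* = (2λ - 1) / (4λ)`. -/
def etaStar (l : ℝ) : ℝ := (2 * l - 1) / (4 * l)

/-- `ϱ(λ) = 2 (√(2π) exp(θ²/η_*) / (π^{2-2η_*} (1-η_*) η_*))^λ ζ(λ + 1/2)`. -/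
def rho (l θ : ℝ) : ℝ :=
  2 * (√(2 * π) * Real.exp (θ ^ 2 / etaStar l)
      / (π ^ (2 - 2 * etaStar l) * (1 - etaStar l) * etaStar l)) ^ l
    * (riemannZeta ((l + 1 / 2 : ℝ) : ℂ)).re

/-- `θ_j = (b_j + √(b_j² + 1 - 1/(2λ*))) / 2`. -/
def thetaSeq (b : ℕ → ℝ) (l : ℝ) (j : ℕ) : ℝ :=
  1 / 2 * (b j + √(b j ^ 2 + 1 - 1 / (2 * l)))

/-- `C_T = max {1, T}`. -/
def cT (T : ℝ) : ℝ := max 1 T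

/-- `C_k = ((k + 1)!)² (4 C_T)^{2k}`. -/
def orderConst (T : ℝ) (k : ℕ) : ℝ := ((k + 1).factorial : ℝ) ^ 2 * (4 * cT T) ^ (2 * k)

/-- The POD weight parameters
`γ_u = (C_{|u|} ∏_{j ∈ u} b_j² / ((θ_j - b_j) ϱ_j(λ*)))^{1/(1+λ*)}`. -/
def podWeight (T : ℝ) (b : ℕ → ℝ) (l : ℝ) (u : Finset ℕ) : ℝ :=
  (orderConst T u.card *
    ∏ j ∈ u, b j ^ 2 / ((thetaSeq b l j - b j) * rho l (thetaSeq b l j))) ^ (1 / (1 + l))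

end QMCTS

end

/-!
The error bound combines parametric regularity of the splitting scheme, an integral representation
of the quadrature error, the greedy estimate for the component-by-component construction, and
weights that balance the resulting two factors.

*Regularity.* `H1` is the Banach algebra `H¹(𝕋)`, realized as the closed algebra of pairs `(f, f')`
in the square-zero extension of `C(𝕋)` by `L²(𝕋)`. A Lie-Trotter step is the kinetic flow applied
to the product with `exp(-iτV)`, so that all mixed first derivatives in `ξ` exist and are given by
the Leibniz rule (`evolution`). Both flows preserve the `L²` norm, and differentiating one potential
step in the coordinates of `w` costs `∏_{j ∈ w} τ b_j`; as `∑_{w ⊆ u} n^{|u \ w|} = (n + 1)^{|u|}`,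
after `n` steps the factor is `∏_{j ∈ u} n τ b_j`, which depends on `n τ ≤ T` only
(`evolution_bounds`). The `H¹` norm grows linearly in `∑ⱼ bⱼ|ξⱼ|`. For the quantity of interest `F`
this gives, uniformly in `m`, `τ` and `n` (`exists_quantity_family`),
`|∂^u F(ξ)| ≤ C (|u| + 1)! (4 C_T)^{|u|} ∏_{j ∈ u} b_j exp(∑ⱼ bⱼ|ξⱼ|)`.

*Representation of the error.* With the kernel `Φ(t) - 1_{t > x}`, a function on `ℝ^m` is a sum over
`u` of integrals of `∂^u F` (`eq_sum_integral_repKernel`); the term of `u = ∅` is the expectation, so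
the quadrature error is the sum over `u ≠ ∅`. By the Cauchy-Schwarz inequality with the weights
`γ_u` and `w_j`, and by averaging over the shift, the mean square error is at most the squared
weighted norm of `F` times the squared shift averaged worst case error (`rmsError_sq_le`).

*Component-by-component construction.* The shift-invariant kernel `ϑ_j` has nonnegative Fourier
coefficients, which decay like `|h|^{-(2 - 2η)}` (`hasSum_shiftKernel`, `shiftCoeff_le`). Adding a
coordinate raises the squared worst case error by an amount which is a nonnegative combination of
discrete Fourier coefficients. The minimum over the admissible components is at most the mean, and
the mean is estimated after raising to a power `λ ∈ (1/2, 1]`, since `x ↦ x^λ` is subadditive; the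
exponent `η_*` is the one with `(2 - 2η_*) λ = λ + 1/2 > 1`, which makes `∑_h |h|^{-(2 - 2η_*)λ}`
the value of the zeta function in `ϱ`. Induction on the dimension gives the bound
`(φ(N)⁻¹ ∑_u γ_u^λ ∏_{j ∈ u} ϱ(λ, θ_j))^{1/λ}` (`sum_units_zmodCoeff_rpow_le`, `latSq_le`).

*Weights.* For the given `γ_u`, the terms of the squared weighted norm are multiples of the same
numbers `γ_u^λ ∏_{j ∈ u} ϱ(λ, θ_j)` (`podWeight_mul`). These are `((|u| + 1)!)^r` times a product of
factors of size `b_j^r`, where `r = 2λ/(1 + λ) ≥ p`; raised to the power `p / r ≤ 1`, they are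
summable over all finite `u`, because the elementary symmetric polynomial of order `k` gains a factor
`1 / k!`. For `p < 1` this beats `((k + 1)!)^p`, and for `p = 1` the smallness assumption makes the
series geometric (`exists_sum_podWeight_le`). The rate is `κ = 1 / (2λ*)`. Finally, a number
`N ≤ 10^30` has at most `27` prime factors, whence `N ≤ 28 φ(N)` (`le_mul_totient`).
-/

noncomputable section

namespace QMCTS

/-! ### Pairs of a continuous and a square integrable function -/

/-- Multiplication of an `L²` function by a continuous function. -/
def contMul (c : C(Torus, ℂ)) (f : L2T) : L2T :=
  ((Lp.memLp f).smul (p := ⊤) (q := 2) (r := 2)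
    (MemLp.of_bound c.continuous.aestronglyMeasurable ‖c‖ (.of_forall c.norm_coe_le_norm))).toLp _

theorem coeFn_contMul (c : C(Torus, ℂ)) (f : L2T) :
    contMul c f =ᵐ[torusMeasure] fun x => c x * f x := MemLp.coeFn_toLp _

instance : Module C(Torus, ℂ) L2T where
  smul := contMul
  one_smul f := Lp.ext (by
    filter_upwards [coeFn_contMul 1 f] with x h using h.trans (by simp))
  mul_smul a b f := Lp.ext (by
    filter_upwards [coeFn_contMul (a * b) f, coeFn_contMul a (contMul b f),
      coeFn_contMul b f] with x h h1 h2
    exact h.trans (by rw [ContinuousMap.mul_apply, mul_assoc, ← h2]; exact h1.symm))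
  smul_zero a := Lp.ext (by
    filter_upwards [coeFn_contMul a 0] with x h
    exact h.trans (by simp))
  smul_add a f g := Lp.ext (by
    filter_upwards [coeFn_contMul a (f + g), coeFn_contMul a f, coeFn_contMul a g,
      Lp.coeFn_add f g, Lp.coeFn_add (contMul a f) (contMul a g)] with x h h1 h2 h3 h4
    refine h.trans (Eq.trans ?_ h4.symm)
    rw [h3]; simp only [Pi.add_apply]; rw [h1, h2]; ring)
  add_smul a b f := Lp.ext (by
    filter_upwards [coeFn_contMul (a + b) f, coeFn_contMul a f, coeFn_contMul b f,
      Lp.coeFn_add (contMul a f) (contMul b f)] with x h h1 h2 h4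
    refine h.trans (Eq.trans ?_ h4.symm)
    simp only [Pi.add_apply]; rw [h1, h2, ContinuousMap.add_apply]; ring)
  zero_smul f := Lp.ext (by
    filter_upwards [coeFn_contMul 0 f] with x h
    exact h.trans (by simp))

theorem coeFn_smul_L2 (c : C(Torus, ℂ)) (f : L2T) :
    (c • f : L2T) =ᵐ[torusMeasure] fun x => c x * f x := coeFn_contMul c f

theorem norm_contMul_le (c : C(Torus, ℂ)) (f : L2T) : ‖c • f‖ ≤ ‖c‖ * ‖f‖ := by
  refine Lp.norm_le_mul_norm_of_ae_le_mul ?_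
  filter_upwards [coeFn_smul_L2 c f] with x h
  rw [h, norm_mul]
  exact mul_le_mul_of_nonneg_right (c.norm_coe_le_norm x) (norm_nonneg _)

/-- The right action, which the multiplication of a square-zero extension also refers to. -/
instance : Module (C(Torus, ℂ))ᵐᵒᵖ L2T := Module.compHom L2T
  ((RingHom.id C(Torus, ℂ)).fromOpposite fun _ _ => mul_comm _ _)

instance : IsCentralScalar C(Torus, ℂ) L2T := ⟨fun _ _ => rfl⟩

instance : IsBoundedSMul C(Torus, ℂ) L2T := IsBoundedSMul.of_norm_smul_le norm_contMul_le

instance : IsBoundedSMul (C(Torus, ℂ))ᵐᵒᵖ L2T :=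
  IsBoundedSMul.of_norm_smul_le fun c f => norm_contMul_le c.unop f

instance : IsScalarTower ℂ C(Torus, ℂ) L2T := ⟨fun z c f => Lp.ext (by
  filter_upwards [coeFn_smul_L2 (z • c) f, coeFn_smul_L2 c f,
    Lp.coeFn_smul z (c • f)] with x h h1 h2
  rw [h, h2]; simp only [Pi.smul_apply, h1, ContinuousMap.smul_apply, smul_eq_mul]; ring)⟩

instance : IsScalarTower ℂ (C(Torus, ℂ))ᵐᵒᵖ L2T := ⟨fun z c f => smul_assoc z c.unop f⟩

instance : SMulCommClass C(Torus, ℂ) (C(Torus, ℂ))ᵐᵒᵖ L2T :=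
  ⟨fun a b f => smul_comm a b.unop f⟩

/-- Pairs `(f, g)` of a continuous and a square integrable function, with the product rule
`(f₁, g₁) (f₂, g₂) = (f₁ f₂, f₁ g₂ + f₂ g₁)`: the ambient algebra of `H¹(𝕋)`. -/
abbrev PairAlg : Type := TrivSqZeroExt C(Torus, ℂ) L2T


/-! ### Fourier coefficients -/

/-- The class in `L²(𝕋)` of a continuous function. -/
abbrev toL2 : C(Torus, ℂ) →L[ℂ] L2T := ContinuousMap.toLp 2 torusMeasure ℂ

theorem coeFn_toL2 (c : C(Torus, ℂ)) : toL2 c =ᵐ[torusMeasure] c :=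
  ContinuousMap.coeFn_toLp torusMeasure c

theorem fourierCoeff_eq_inner (f : L2T) (n : ℤ) :
    fourierCoeff f n = inner ℂ (fourierLp 2 n : L2T) f := by
  rw [← fourierBasis_repr, HilbertBasis.repr_apply_apply, coe_fourierBasis]

/-- The `n`-th Fourier coefficient as a continuous linear functional on `L²(𝕋)`. -/
def coeffL2 (n : ℤ) : L2T →L[ℂ] ℂ := innerSL ℂ (fourierLp 2 n : L2T)

theorem coeffL2_apply (n : ℤ) (f : L2T) : coeffL2 n f = fourierCoeff f n :=
  (fourierCoeff_eq_inner f n).symm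

theorem coeffL2_toL2 (n : ℤ) (c : C(Torus, ℂ)) : coeffL2 n (toL2 c) = fourierCoeff c n := by
  rw [coeffL2_apply]; rw [fourierCoeff_congr_ae (coeFn_toL2 c)]

theorem L2_ext_coeff {f g : L2T} (h : ∀ n, coeffL2 n f = coeffL2 n g) : f = g := by
  refine fourierBasis.repr.injective (lp.ext (funext fun n => ?_))
  rw [fourierBasis_repr, fourierBasis_repr, ← coeffL2_apply, h, coeffL2_apply]

theorem hasSum_sq_coeffL2 (f : L2T) : HasSum (fun n => ‖coeffL2 n f‖ ^ 2) (‖f‖ ^ 2) := by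
  have h := HilbertBasis.hasSum_inner_mul_inner (fourierBasis (T := 2 * π)) f f
  rw [inner_self_eq_norm_sq_to_K] at h
  rw [← Complex.hasSum_ofReal]
  refine HasSum.congr_fun (by push_cast; exact h) fun n => ?_
  rw [coe_fourierBasis, ← inner_conj_symm f, ← fourierCoeff_eq_inner, ← coeffL2_apply,
    RCLike.conj_mul]
  push_cast; rfl

/-- The Fourier coefficients of a product are the convolution of the Fourier coefficients. -/
theorem hasSum_coeffL2_mul (f g : L2T) (n : ℤ) :
    HasSum (fun k => coeffL2 (n - k) f * coeffL2 k g)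
      (fourierCoeff (fun x => f x * g x) n) := by
  have key := HilbertBasis.hasSum_inner_mul_inner (fourierBasis (T := 2 * π))
    ((fourier n : C(Torus, ℂ)) • (star f : L2T)) g
  refine HasSum.congr_fun (Eq.subst (motive := fun z => HasSum _ z) ?_ key) fun k => ?_
  rotate_left
  · rw [coe_fourierBasis, coeffL2_apply, coeffL2_apply, fourierCoeff_eq_inner g]
    congr 1
    rw [L2.inner_def, fourierCoeff]
    refine integral_congr_ae ?_
    filter_upwards [coeFn_smul_L2 (fourier n) (star f), Lp.coeFn_star f,
      coeFn_fourierLp 2 k] with x h1 h2 h3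
    rw [h1, h3, h2]
    simp only [Pi.star_apply, RCLike.inner_apply, map_mul, RCLike.star_def, Complex.conj_conj,
      smul_eq_mul, neg_sub, sub_eq_add_neg k n, fourier_add, fourier_neg]
    ring
  · rw [L2.inner_def, fourierCoeff]
    symm
    refine integral_congr_ae ?_
    filter_upwards [coeFn_smul_L2 (fourier n) (star f), Lp.coeFn_star f] with x h1 h2
    rw [h1, h2]
    simp only [Pi.star_apply, RCLike.inner_apply, map_mul, RCLike.star_def, Complex.conj_conj,
      smul_eq_mul, fourier_neg]
    ring

theorem hasSum_coeffL2_smul (c : C(Torus, ℂ)) (g : L2T) (n : ℤ) :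
    HasSum (fun k => coeffL2 (n - k) (toL2 c) * coeffL2 k g) (coeffL2 n (c • g)) := by
  have h := hasSum_coeffL2_mul (toL2 c) g n
  have e : fourierCoeff (fun x => toL2 c x * g x) n = coeffL2 n (c • g) := by
    rw [coeffL2_apply]
    refine congrFun (fourierCoeff_congr_ae ?_) n
    filter_upwards [coeFn_smul_L2 c g, coeFn_toL2 c] with x h1 h2
    rw [h1, h2]
  rwa [e] at h

theorem smul_toL2 (c d : C(Torus, ℂ)) : c • toL2 d = toL2 (c * d) := Lp.ext (by
  filter_upwards [coeFn_smul_L2 c (toL2 d), coeFn_toL2 d, coeFn_toL2 (c * d)] with x h1 h2 h3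
  rw [h1, h2, h3, ContinuousMap.mul_apply])

/-- The algebra `H¹(𝕋)`: pairs of a continuous function and its derivative, the latter being
characterized by its Fourier coefficients. The norm is `‖f‖_∞ + ‖f'‖₂`. -/
def h1Alg : Subalgebra ℂ PairAlg where
  carrier := {x | ∀ n : ℤ, coeffL2 n x.snd = Complex.I * n * coeffL2 n (toL2 x.fst)}
  mul_mem' := by
    intro x y hx hy n
    have h1 := hasSum_coeffL2_smul x.fst y.snd n
    have h2 := hasSum_coeffL2_smul y.fst x.snd n
    have h2' : HasSum (fun k => coeffL2 k (toL2 y.fst) * coeffL2 (n - k) x.snd)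
        (coeffL2 n (y.fst • x.snd)) := by
      rw [← (Equiv.subLeft n).hasSum_iff] at h2
      simpa [Function.comp_def] using h2
    have h3 := (hasSum_coeffL2_smul x.fst (toL2 y.fst) n).mul_left (Complex.I * n)
    rw [smul_toL2] at h3
    have h4 := h1.add h2'
    rw [TrivSqZeroExt.snd_mul, TrivSqZeroExt.fst_mul, map_add, op_smul_eq_smul]
    -- the product rule is `i n = i (n - k) + i k`
    refine h4.unique (h3.congr_fun fun k => ?_)
    rw [hx, hy]; push_cast; ring
  add_mem' := by
    intro x y hx hy n
    simp only [TrivSqZeroExt.snd_add, TrivSqZeroExt.fst_add, map_add, hx n, hy n]; ring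
  algebraMap_mem' := by
    intro r n
    have h1 : (algebraMap ℂ PairAlg r) = TrivSqZeroExt.inl (algebraMap ℂ C(Torus, ℂ) r) := rfl
    have h2 : (algebraMap ℂ C(Torus, ℂ) r) = r • (fourier 0 : C(Torus, ℂ)) := by
      ext x; simp
    have h3 : coeffL2 n (toL2 (fourier 0)) = if n = 0 then 1 else 0 := by
      rw [coeffL2_toL2, fourierCoeff_fourier]; simp [Pi.single_apply]
    rw [h1, TrivSqZeroExt.snd_inl, TrivSqZeroExt.fst_inl, h2, map_smul, map_smul, h3]
    by_cases hn : n = 0 <;> simp [hn]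

theorem mem_h1Alg {x : PairAlg} :
    x ∈ h1Alg ↔ ∀ n : ℤ, coeffL2 n x.snd = Complex.I * n * coeffL2 n (toL2 x.fst) := Iff.rfl

theorem isClosed_h1Alg : IsClosed (h1Alg : Set PairAlg) := by
  have : (h1Alg : Set PairAlg) = ⋂ n : ℤ,
      {x | coeffL2 n x.snd = Complex.I * n * coeffL2 n (toL2 x.fst)} := by
    ext x; simp [mem_h1Alg]
  rw [this]
  refine isClosed_iInter fun n => isClosed_eq ?_ ?_
  · exact (coeffL2 n).continuous.comp TrivSqZeroExt.continuous_snd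
  · exact continuous_const.mul
      ((coeffL2 n).continuous.comp (toL2.continuous.comp TrivSqZeroExt.continuous_fst))

/-- The Banach algebra `H¹(𝕋)`. -/
def H1 : Type := h1Alg

instance : NormedCommRing H1 := inferInstanceAs (NormedCommRing h1Alg)

instance : NormedAlgebra ℂ H1 := inferInstanceAs (NormedAlgebra ℂ h1Alg)

instance : CompleteSpace H1 := isClosed_h1Alg.completeSpace_coe

/-! ### The Banach algebra `H¹(𝕋)` -/

theorem toL2_injective : Function.Injective toL2 :=
  ContinuousMap.toLp_injective torusMeasure

theorem norm_toL2_le (c : C(Torus, ℂ)) : ‖toL2 c‖ ≤ ‖c‖ := by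
  refine Lp.norm_le_of_ae_bound (p := 2) (norm_nonneg c) (f := toL2 c) ?_ |>.trans ?_
  · filter_upwards [coeFn_toL2 c] with x h
    rw [h]; exact c.norm_coe_le_norm x
  · simp [measureUnivNNReal]

/-- The value of an element of `H¹(𝕋)`, as a continuous function. -/
def val (x : H1) : C(Torus, ℂ) := x.1.fst

/-- The derivative of an element of `H¹(𝕋)`. -/
def der (x : H1) : L2T := x.1.snd

theorem coeff_der (x : H1) (n : ℤ) :
    coeffL2 n (der x) = Complex.I * n * coeffL2 n (toL2 (val x)) := x.2 n

theorem norm_H1_eq (x : H1) : ‖x‖ = ‖val x‖ + ‖der x‖ := TrivSqZeroExt.norm_def _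

@[simp] theorem val_add (x y : H1) : val (x + y) = val x + val y := rfl
@[simp] theorem der_add (x y : H1) : der (x + y) = der x + der y := rfl
@[simp] theorem val_mul (x y : H1) : val (x * y) = val x * val y := rfl
theorem der_mul (x y : H1) : der (x * y) = val x • der y + val y • der x := rfl
@[simp] theorem val_smul (c : ℂ) (x : H1) : val (c • x) = c • val x := rfl
@[simp] theorem der_smul (c : ℂ) (x : H1) : der (c • x) = c • der x := rfl
@[simp] theorem val_zero : val 0 = 0 := rfl
@[simp] theorem der_zero : der 0 = 0 := rfl

theorem val_sum {ι : Type*} (s : Finset ι) (f : ι → H1) :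
    val (∑ i ∈ s, f i) = ∑ i ∈ s, val (f i) := by
  classical
  induction s using Finset.induction_on with
  | empty => simp
  | insert i s hi ih => rw [Finset.sum_insert hi, Finset.sum_insert hi, val_add, ih]

theorem der_sum {ι : Type*} (s : Finset ι) (f : ι → H1) :
    der (∑ i ∈ s, f i) = ∑ i ∈ s, der (f i) := by
  classical
  induction s using Finset.induction_on with
  | empty => simp
  | insert i s hi ih => rw [Finset.sum_insert hi, Finset.sum_insert hi, der_add, ih]

theorem H1_ext {x y : H1} (h : toL2 (val x) = toL2 (val y)) : x = y := by
  have h2 : der x = der y := L2_ext_coeff fun n => by rw [coeff_der, coeff_der, h]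
  exact Subtype.ext (TrivSqZeroExt.ext (toL2_injective h) h2)

/-- A bound for the norm of the embedding of `H¹(𝕋)` into `C(𝕋)`: by the Cauchy-Schwarz inequality,
`∑ₙ |f̂(n)|` is at most this constant times the norm of `H¹(𝕋)`. -/
def embConst : ℝ := √(∑' n : ℤ, 1 / (1 + (n : ℝ) ^ 2))

theorem embConst_nonneg : 0 ≤ embConst := Real.sqrt_nonneg _

theorem summable_one_div_one_add_sq : Summable fun n : ℤ => 1 / (1 + (n : ℝ) ^ 2) := by
  have h : Summable fun n : ℤ => 1 / (n : ℝ) ^ 2 := Real.summable_one_div_int_pow.2 (by norm_num)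
  refine Summable.of_norm_bounded_eventually h ?_
  filter_upwards [(Set.finite_singleton (0 : ℤ)).compl_mem_cofinite] with n hn
  have hn : n ≠ 0 := hn
  rw [Real.norm_of_nonneg (by positivity)]
  have : (0 : ℝ) < (n : ℝ) ^ 2 := by positivity
  exact one_div_le_one_div_of_le this (by linarith)

/-- A pair of square integrable functions whose Fourier coefficients are related as those of a
function and its derivative is given by an element of `H¹(𝕋)`. -/
theorem exists_H1_of_coeff (f g : L2T)
    (h : ∀ n : ℤ, coeffL2 n g = Complex.I * n * coeffL2 n f) :
    ∃ x : H1, toL2 (val x) = f ∧ der x = g ∧ ‖val x‖ ≤ embConst * (‖f‖ + ‖g‖) := by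
  have hw : HasSum (fun n : ℤ => (1 + (n : ℝ) ^ 2) * ‖coeffL2 n f‖ ^ 2)
      (‖f‖ ^ 2 + ‖g‖ ^ 2) := by
    refine ((hasSum_sq_coeffL2 f).add (hasSum_sq_coeffL2 g)).congr_fun fun n => ?_
    rw [h, norm_mul, norm_mul, Complex.norm_I, Complex.norm_intCast, one_mul, mul_pow, sq_abs]
    ring
  have hcs := Real.summable_and_inner_le_Lp_mul_Lq_tsum_of_nonneg (p := 2) (q := 2)
    (f := fun n : ℤ => √(1 / (1 + (n : ℝ) ^ 2)))
    (g := fun n : ℤ => √(1 + (n : ℝ) ^ 2) * ‖coeffL2 n f‖)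
    Real.HolderConjugate.two_two (fun n => by positivity) (fun n => by positivity)
    (by
      refine summable_one_div_one_add_sq.congr fun n => ?_
      rw [Real.rpow_two, Real.sq_sqrt (by positivity)])
    (by
      refine hw.summable.congr fun n => ?_
      rw [Real.rpow_two, mul_pow, Real.sq_sqrt (by positivity)])
  have e1 : ∀ n : ℤ, √(1 / (1 + (n : ℝ) ^ 2)) * (√(1 + (n : ℝ) ^ 2) * ‖coeffL2 n f‖)
      = ‖coeffL2 n f‖ := fun n => by
    rw [← mul_assoc, ← Real.sqrt_mul (by positivity), one_div_mul_cancel (by positivity),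
      Real.sqrt_one, one_mul]
  have e2 : ∀ n : ℤ, √(1 / (1 + (n : ℝ) ^ 2)) ^ (2 : ℝ) = 1 / (1 + (n : ℝ) ^ 2) := fun n => by
    rw [Real.rpow_two, Real.sq_sqrt (by positivity)]
  have e3 : ∀ n : ℤ, (√(1 + (n : ℝ) ^ 2) * ‖coeffL2 n f‖) ^ (2 : ℝ)
      = (1 + (n : ℝ) ^ 2) * ‖coeffL2 n f‖ ^ 2 := fun n => by
    rw [Real.rpow_two, mul_pow, Real.sq_sqrt (by positivity)]
  simp only [e1, e2, e3, hw.tsum_eq, ← Real.sqrt_eq_rpow] at hcs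
  obtain ⟨hs, hle⟩ := hcs
  have hs' : Summable fun n : ℤ => coeffL2 n f • (fourier n : C(Torus, ℂ)) := by
    refine Summable.of_norm (hs.congr fun n => ?_)
    rw [norm_smul, fourier_norm, mul_one]
  set F : C(Torus, ℂ) := ∑' n : ℤ, coeffL2 n f • (fourier n : C(Torus, ℂ)) with hF
  have hFf : toL2 F = f := by
    have h1 := hs'.hasSum.mapL toL2
    have h2 := hasSum_fourier_series_L2 f
    refine h1.unique (h2.congr_fun fun n => ?_)
    rw [map_smul, coeffL2_apply]
  have hmem : (TrivSqZeroExt.inl F + TrivSqZeroExt.inr g : PairAlg) ∈ h1Alg := by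
    intro n
    simp [hFf, h]
  refine ⟨⟨_, hmem⟩, ?_, ?_, ?_⟩
  · simpa [val] using hFf
  · simp [der]
  · have : ‖F‖ ≤ ∑' n : ℤ, ‖coeffL2 n f‖ := by
      refine (norm_tsum_le_tsum_norm (hs.congr fun n => ?_)).trans_eq (tsum_congr fun n => ?_)
      all_goals rw [norm_smul, fourier_norm, mul_one]
    have h3 : √(‖f‖ ^ 2 + ‖g‖ ^ 2) ≤ ‖f‖ + ‖g‖ := by
      rw [Real.sqrt_le_left (by positivity)]
      nlinarith [norm_nonneg f, norm_nonneg g]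
    simp only [val, TrivSqZeroExt.fst_add, TrivSqZeroExt.fst_inl, TrivSqZeroExt.fst_inr, add_zero]
    exact (this.trans hle).trans (mul_le_mul_of_nonneg_left h3 embConst_nonneg)

/-- The Sobolev embedding of `H¹(𝕋)` into `C(𝕋)`. -/
theorem norm_val_le (x : H1) : ‖val x‖ ≤ embConst * (‖toL2 (val x)‖ + ‖der x‖) := by
  obtain ⟨y, h1, -, h3⟩ := exists_H1_of_coeff (toL2 (val x)) (der x) (coeff_der x)
  rwa [H1_ext h1] at h3

/-- `H¹(𝕋)` as a set of functions and as a Banach algebra agree. -/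
theorem exists_H1_of_memSobolev {f : Torus → ℂ} (hf : MemSobolev 1 f) :
    ∃ x : H1, val x =ᵐ[torusMeasure] f := by
  obtain ⟨hf2, hs⟩ := hf
  have hc : ∀ n, coeffL2 n (hf2.toLp f) = fourierCoeff f n := fun n => by
    rw [coeffL2_apply, fourierCoeff_congr_ae hf2.coeFn_toLp]
  have hmem : Memℓp (fun n : ℤ => Complex.I * n * fourierCoeff f n) 2 := by
    refine memℓp_gen (hs.of_nonneg_of_le (fun n => by positivity) fun n => ?_)
    simp only [ENNReal.toReal_ofNat, Real.rpow_two, Real.rpow_one, norm_mul, Complex.norm_I,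
      Complex.norm_intCast, one_mul, mul_pow, sq_abs]
    nlinarith [sq_nonneg ‖fourierCoeff f n‖]
  let g : L2T := fourierBasis.repr.symm ⟨_, hmem⟩
  have hg : ∀ n, coeffL2 n g = Complex.I * n * fourierCoeff f n := fun n => by
    rw [coeffL2_apply, ← fourierBasis_repr, LinearIsometryEquiv.apply_symm_apply]
  obtain ⟨x, hx, -, -⟩ := exists_H1_of_coeff (hf2.toLp f) g fun n => by rw [hg, hc]
  refine ⟨x, (coeFn_toL2 (val x)).symm.trans ?_⟩
  rw [hx]; exact hf2.coeFn_toLp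

theorem memSobolev_val (x : H1) : MemSobolev 1 (val x) ∧
    sobolevNorm 1 (val x) ≤ ‖toL2 (val x)‖ + ‖der x‖ := by
  have hw : HasSum (fun n : ℤ => (1 + (n : ℝ) ^ 2) ^ (1 : ℝ) * ‖fourierCoeff (val x) n‖ ^ 2)
      (‖toL2 (val x)‖ ^ 2 + ‖der x‖ ^ 2) := by
    refine ((hasSum_sq_coeffL2 (toL2 (val x))).add (hasSum_sq_coeffL2 (der x))).congr_fun
      fun n => ?_
    rw [coeff_der, norm_mul, norm_mul, Complex.norm_I, Complex.norm_intCast, one_mul, mul_pow,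
      sq_abs, coeffL2_toL2, Real.rpow_one]
    ring
  refine ⟨⟨MemLp.of_bound (val x).continuous.aestronglyMeasurable ‖val x‖
    (.of_forall (val x).norm_coe_le_norm), hw.summable⟩, ?_⟩
  rw [sobolevNorm, hw.tsum_eq, Real.sqrt_le_left (by positivity)]
  nlinarith [norm_nonneg (toL2 (val x)), norm_nonneg (der x)]

theorem memSobolev_congr_ae {s : ℝ} {f g : Torus → ℂ} (h : f =ᵐ[torusMeasure] g)
    (hf : MemSobolev s f) : MemSobolev s g :=
  ⟨hf.1.ae_eq h, by rw [← fourierCoeff_congr_ae h]; exact hf.2⟩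

theorem MemSobolev.mono {s t : ℝ} (hst : s ≤ t) {f : Torus → ℂ} (hf : MemSobolev t f) :
    MemSobolev s f := by
  refine ⟨hf.1, hf.2.of_nonneg_of_le (fun n => by positivity) fun n => ?_⟩
  have : (1 : ℝ) ≤ 1 + (n : ℝ) ^ 2 := by nlinarith [sq_nonneg (n : ℝ)]
  gcongr

/-! ### The exponential and complex conjugation -/

/-- A bounded algebra homomorphism commutes with the exponential. -/
theorem map_exp_of_continuous {A B : Type*} [NormedRing A] [NormedAlgebra ℂ A] [CompleteSpace A]
    [NormedRing B] [NormedAlgebra ℂ B] [CompleteSpace B] (φ : A →ₐ[ℂ] B) (hφ : Continuous φ)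
    (x : A) : φ (NormedSpace.exp x) = NormedSpace.exp (φ x) := by
  have h1 := (NormedSpace.exp_series_hasSum_exp' (𝕂 := ℂ) x).map φ hφ
  have h2 := NormedSpace.exp_series_hasSum_exp' (𝕂 := ℂ) (φ x)
  refine h1.unique (h2.congr_fun fun n => ?_)
  simp [map_pow]

theorem val_exp_apply (x : H1) (p : Torus) : val (NormedSpace.exp x) p = Complex.exp (val x p) := by
  let φ : H1 →ₐ[ℂ] ℂ :=
    { toFun := fun x => val x p
      map_one' := rfl
      map_mul' := fun _ _ => rfl
      map_zero' := rfl
      map_add' := fun _ _ => rfl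
      commutes' := fun _ => rfl }
  have hφ : Continuous φ := by
    have : Continuous fun x : H1 => x.1.fst p :=
      (continuous_eval_const p).comp
        (TrivSqZeroExt.continuous_fst.comp continuous_subtype_val)
    exact this
  rw [Complex.exp_eq_exp_ℂ]
  exact map_exp_of_continuous φ hφ x

theorem der_exp (x : H1) : der (NormedSpace.exp x) = val (NormedSpace.exp x) • der x := by
  have h : (NormedSpace.exp x).1 = NormedSpace.exp x.1 :=
    map_exp_of_continuous (A := H1) h1Alg.val continuous_subtype_val x
  rw [der, val, h, TrivSqZeroExt.snd_exp, TrivSqZeroExt.fst_exp]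
  rfl

theorem coeffL2_star (f : L2T) (n : ℤ) : coeffL2 n (star f) = star (coeffL2 (-n) f) := by
  rw [coeffL2_apply, coeffL2_apply, fourierCoeff, fourierCoeff, RCLike.star_def, ← integral_conj]
  refine integral_congr_ae ?_
  filter_upwards [Lp.coeFn_star f] with x h
  rw [h]
  simp

theorem norm_star_L2 (f : L2T) : ‖star f‖ = ‖f‖ := by
  refine le_antisymm (Lp.norm_le_norm_of_ae_le ?_) (Lp.norm_le_norm_of_ae_le ?_)
  all_goals
    filter_upwards [Lp.coeFn_star f] with x h
    rw [h, Pi.star_apply, norm_star]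

theorem toL2_star (c : C(Torus, ℂ)) : toL2 (star c) = star (toL2 c) := Lp.ext (by
  filter_upwards [coeFn_toL2 (star c), Lp.coeFn_star (toL2 c), coeFn_toL2 c] with x h h1 h2
  rw [h, h1, Pi.star_apply, h2]; rfl)

theorem coeff_conj (x : H1) : (TrivSqZeroExt.inl (star (val x))
    + TrivSqZeroExt.inr (star (der x)) : PairAlg) ∈ h1Alg := by
  intro n
  have := coeff_der x (-n)
  simp [coeffL2_star, toL2_star, this]

/-- Complex conjugation on `H¹(𝕋)`, as a map. -/
def conjFun (x : H1) : H1 := ⟨_, coeff_conj x⟩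

theorem val_conjFun (x : H1) : val (conjFun x) = star (val x) := by
  simp [conjFun, val]

theorem der_conjFun (x : H1) : der (conjFun x) = star (der x) := by
  simp [conjFun, der]

/-- Complex conjugation on `H¹(𝕋)`. -/
def conjH1 : H1 →L[ℝ] H1 :=
  LinearMap.mkContinuous
    { toFun := conjFun
      map_add' := fun x y => by
        refine H1_ext ?_
        rw [val_add, val_conjFun, val_conjFun, val_conjFun, val_add, star_add]
      map_smul' := fun c x => by
        refine H1_ext ?_
        rw [RingHom.id_apply, ← Complex.coe_smul, ← Complex.coe_smul, val_smul, val_conjFun,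
          val_conjFun, val_smul, star_smul]
        simp } 1 fun x => by
    rw [one_mul, norm_H1_eq, norm_H1_eq]
    exact (congrArg₂ (· + ·) (by simp [val_conjFun])
      (by rw [← norm_star_L2 (der x), ← der_conjFun]; rfl)).le

@[simp] theorem val_conjH1 (x : H1) : val (conjH1 x) = star (val x) := val_conjFun x

@[simp] theorem der_conjH1 (x : H1) : der (conjH1 x) = star (der x) := der_conjFun x

/-! ### The kinetic flow on `H¹(𝕋)` -/

/-- The defining series of the kinetic flow converges in `L²(𝕋)`, the multipliers having modulus one;
otherwise `kineticFlow` would be the junk value `0`. -/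
theorem coeffL2_kineticFlow (τ : ℝ) (f : L2T) (n : ℤ) :
    coeffL2 n (kineticFlow τ f)
      = Complex.exp (-(Complex.I * τ * (n : ℂ) ^ 2 / 2)) * coeffL2 n f := by
  have hnorm : ∀ k : ℤ, ‖Complex.exp (-(Complex.I * τ * (k : ℂ) ^ 2 / 2))‖ = 1 := fun k => by
    rw [show -(Complex.I * τ * (k : ℂ) ^ 2 / 2) = ((-(τ * k ^ 2 / 2) : ℝ) : ℂ) * Complex.I by
      push_cast; ring, Complex.norm_exp_ofReal_mul_I]
  have hmem : Memℓp (fun k : ℤ => Complex.exp (-(Complex.I * τ * (k : ℂ) ^ 2 / 2))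
      * fourierCoeff f k) 2 := by
    refine memℓp_gen ((hasSum_sq_coeffL2 f).summable.congr fun k => ?_)
    simp only [ENNReal.toReal_ofNat, Real.rpow_two, norm_mul, hnorm, one_mul, coeffL2_apply]
  let g : L2T := fourierBasis.repr.symm ⟨_, hmem⟩
  have hg : ∀ k, fourierCoeff g k = Complex.exp (-(Complex.I * τ * (k : ℂ) ^ 2 / 2))
      * fourierCoeff f k := fun k => by
    rw [← fourierBasis_repr, LinearIsometryEquiv.apply_symm_apply]
  have h := hasSum_fourier_series_L2 g
  simp only [hg] at h
  have : kineticFlow τ f = g := h.tsum_eq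
  rw [this, coeffL2_apply, hg, coeffL2_apply]

theorem norm_kineticFlow (τ : ℝ) (f : L2T) : ‖kineticFlow τ f‖ = ‖f‖ := by
  have h1 := hasSum_sq_coeffL2 (kineticFlow τ f)
  have h2 := hasSum_sq_coeffL2 f
  have : ‖kineticFlow τ f‖ ^ 2 = ‖f‖ ^ 2 := by
    refine h1.unique (h2.congr_fun fun n => ?_)
    rw [coeffL2_kineticFlow, norm_mul,
      show -(Complex.I * τ * (n : ℂ) ^ 2 / 2) = ((-(τ * n ^ 2 / 2) : ℝ) : ℂ) * Complex.I by
        push_cast; ring, Complex.norm_exp_ofReal_mul_I, one_mul]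
  exact (pow_left_inj₀ (norm_nonneg _) (norm_nonneg _) two_ne_zero).1 this

/-- The kinetic flow commutes with differentiation and hence preserves `H¹(𝕋)`. -/
theorem exists_kinetic (τ : ℝ) (x : H1) :
    ∃ y : H1, toL2 (val y) = kineticFlow τ (toL2 (val x)) ∧ der y = kineticFlow τ (der x) ∧
      ‖val y‖ ≤ embConst * (‖kineticFlow τ (toL2 (val x))‖ + ‖kineticFlow τ (der x)‖) :=
  exists_H1_of_coeff _ _ fun n => by
    rw [coeffL2_kineticFlow, coeffL2_kineticFlow, coeff_der]; ring

/-- The kinetic flow on `H¹(𝕋)`, as a map. -/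
def kinFun (τ : ℝ) (x : H1) : H1 := (exists_kinetic τ x).choose

theorem toL2_val_kinFun (τ : ℝ) (x : H1) :
    toL2 (val (kinFun τ x)) = kineticFlow τ (toL2 (val x)) :=
  (exists_kinetic τ x).choose_spec.1

theorem der_kinFun (τ : ℝ) (x : H1) : der (kinFun τ x) = kineticFlow τ (der x) :=
  (exists_kinetic τ x).choose_spec.2.1

/-- The kinetic flow on `H¹(𝕋)`. -/
def kinH1 (τ : ℝ) : H1 →L[ℂ] H1 :=
  LinearMap.mkContinuous
    { toFun := kinFun τ
      map_add' := fun x y => H1_ext <| L2_ext_coeff fun n => by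
        rw [val_add, map_add, map_add]
        simp only [toL2_val_kinFun, coeffL2_kineticFlow]
        rw [val_add, map_add, map_add, mul_add]
      map_smul' := fun c x => H1_ext <| L2_ext_coeff fun n => by
        rw [RingHom.id_apply, val_smul, map_smul, map_smul]
        simp only [toL2_val_kinFun, coeffL2_kineticFlow]
        rw [val_smul, map_smul, map_smul, smul_eq_mul, smul_eq_mul]
        ring } (embConst + 1) fun x => by
    have h3 := (exists_kinetic τ x).choose_spec.2.2
    change ‖val (kinFun τ x)‖ ≤ _ at h3
    simp only [norm_kineticFlow] at h3
    have h4 := norm_toL2_le (val x)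
    have h5 : embConst * (‖toL2 (val x)‖ + ‖der x‖) ≤ embConst * (‖val x‖ + ‖der x‖) :=
      mul_le_mul_of_nonneg_left (by linarith) embConst_nonneg
    change ‖kinFun τ x‖ ≤ _
    rw [norm_H1_eq, norm_H1_eq, der_kinFun, norm_kineticFlow]
    nlinarith [norm_nonneg (val x)]

theorem toL2_val_kinH1 (τ : ℝ) (x : H1) :
    toL2 (val (kinH1 τ x)) = kineticFlow τ (toL2 (val x)) := toL2_val_kinFun τ x

theorem der_kinH1 (τ : ℝ) (x : H1) : der (kinH1 τ x) = kineticFlow τ (der x) := der_kinFun τ x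

/-! ### Families of mixed first order partial derivatives -/

section MixedFamily

variable {E F : Type*} [NormedAddCommGroup E] [NormedSpace ℝ E] [NormedAddCommGroup F]
  [NormedSpace ℝ F] {m : ℕ}

/-- `A u`, for `u` a set of coordinates, is the mixed partial derivative, of order one in each
coordinate of `u`, of the function `A ∅` on `ℝ^m`, and all these derivatives are continuous. -/
def IsMixedFamily (A : Finset (Fin m) → (Fin m → ℝ) → E) : Prop :=
  (∀ u, Continuous (A u)) ∧ ∀ u, ∀ j ∉ u, ∀ ξ : Fin m → ℝ,
    HasDerivAt (fun t => A u (Function.update ξ j t)) (A (insert j u) ξ) (ξ j)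

/-- The Leibniz rule for mixed partial derivatives. -/
def leibniz {R : Type*} [NonUnitalNonAssocSemiring R] (A B : Finset (Fin m) → (Fin m → ℝ) → R)
    (u : Finset (Fin m)) (ξ : Fin m → ℝ) : R :=
  ∑ w ∈ u.powerset, A w ξ * B (u \ w) ξ

theorem IsMixedFamily.map {A : Finset (Fin m) → (Fin m → ℝ) → E} (hA : IsMixedFamily A)
    (L : E →L[ℝ] F) : IsMixedFamily fun u ξ => L (A u ξ) :=
  ⟨fun u => L.continuous.comp (hA.1 u), fun u j hj ξ => by
    have := L.hasFDerivAt.comp_hasDerivAt (ξ j) (hA.2 u j hj ξ)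
    exact this⟩

theorem IsMixedFamily.mul {A B : Finset (Fin m) → (Fin m → ℝ) → H1} (hA : IsMixedFamily A)
    (hB : IsMixedFamily B) : IsMixedFamily (leibniz A B) := by
  refine ⟨fun u => continuous_finsetSum _ fun w _ => (hA.1 _).mul (hB.1 _),
    fun u j hj ξ => ?_⟩
  have h : HasDerivAt (fun t => ∑ w ∈ u.powerset, A w (Function.update ξ j t)
      * B (u \ w) (Function.update ξ j t))
      (∑ w ∈ u.powerset, (A (insert j w) ξ * B (u \ w) ξ + A w ξ * B (insert j (u \ w)) ξ))
      (ξ j) := by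
    refine HasDerivAt.fun_sum fun w hw => ?_
    have hw := Finset.mem_powerset.1 hw
    have := (hA.2 w j (fun h => hj (hw h)) ξ).fun_mul
      (hB.2 (u \ w) j (fun h => hj (Finset.mem_sdiff.1 h).1) ξ)
    simpa only [Function.update_eq_self] using this
  have e : leibniz A B (insert j u) ξ
      = ∑ w ∈ u.powerset, (A (insert j w) ξ * B (u \ w) ξ + A w ξ * B (insert j (u \ w)) ξ) := by
    rw [leibniz, Finset.sum_powerset_insert hj, Finset.sum_add_distrib, add_comm]
    congr 1
    · refine Finset.sum_congr rfl fun w hw => ?_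
      rw [Finset.insert_sdiff_insert]
      congr 2
      ext i
      simp only [Finset.mem_sdiff, Finset.mem_insert]
      exact ⟨fun h => ⟨h.1, fun h' => h.2 (Or.inr h')⟩, fun h => ⟨h.1, fun h' => h'.elim
        (fun h'' => hj (h'' ▸ h.1)) h.2⟩⟩
    · refine Finset.sum_congr rfl fun w hw => ?_
      rw [Finset.insert_sdiff_of_notMem _ fun h => hj (Finset.mem_powerset.1 hw h)]
  rw [e]
  exact h

/-- The mixed partial derivatives of a constant function. -/
def constFamily (x : H1) (u : Finset (Fin m)) (_ : Fin m → ℝ) : H1 := if u = ∅ then x else 0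

theorem isMixedFamily_const (x : H1) : IsMixedFamily (constFamily (m := m) x) :=
  ⟨fun _ => continuous_const, fun u j _ ξ => by
    rw [constFamily, if_neg (Finset.insert_ne_empty j u)]
    exact hasDerivAt_const _ _⟩

/-- The mixed partial derivatives of `exp(a₀ + ∑ⱼ ξⱼ aⱼ)`. -/
def expFamily (a₀ : H1) (a : Fin m → H1) (u : Finset (Fin m)) (ξ : Fin m → ℝ) : H1 :=
  (∏ j ∈ u, a j) * NormedSpace.exp (a₀ + ∑ j, ξ j • a j)

theorem isMixedFamily_exp (a₀ : H1) (a : Fin m → H1) : IsMixedFamily (expFamily a₀ a) := by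
  refine ⟨fun u => ?_, fun u j hj ξ => ?_⟩
  · refine continuous_const.mul (Continuous.comp (continuous_iff_continuousAt.2 fun x =>
      (hasFDerivAt_exp (𝕂 := ℂ) (x := x)).continuousAt) ?_)
    fun_prop
  · have h1 : HasDerivAt (fun t : ℝ => a₀ + ∑ i, Function.update ξ j t i • a i) (a j) (ξ j) := by
      have : ∀ t : ℝ, a₀ + ∑ i, Function.update ξ j t i • a i
          = t • a j + (a₀ + ∑ i ∈ Finset.univ.erase j, ξ i • a i) := fun t => by
        rw [← Finset.add_sum_erase _ _ (Finset.mem_univ j), Function.update_self]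
        rw [Finset.sum_congr rfl fun i hi => by
          rw [Function.update_of_ne (Finset.ne_of_mem_erase hi)]]
        abel
      simp only [this]
      simpa using ((hasDerivAt_id (ξ j)).smul_const (a j)).add_const
        (a₀ + ∑ i ∈ Finset.univ.erase j, ξ i • a i)
    have h2 := (hasFDerivAt_exp (𝕂 := ℝ) (x := a₀ + ∑ i, Function.update ξ j (ξ j) i • a i)).comp_hasDerivAt
      (ξ j) h1
    have h3 := h2.const_mul (∏ i ∈ u, a i)
    rw [Function.update_eq_self] at h3
    refine h3.congr_deriv ?_
    simp only [expFamily, Finset.prod_insert hj, smul_apply, one_apply_eq_self, smul_eq_mul]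
    ring

end MixedFamily

/-! ### Bounds for the mixed derivatives of the splitting scheme -/

theorem norm_smul_le_of_norm_le {c : C(Torus, ℂ)} {β : ℝ} (hc : ∀ p, ‖c p‖ ≤ β) (f : L2T) :
    ‖c • f‖ ≤ β * ‖f‖ := by
  refine Lp.norm_le_mul_norm_of_ae_le_mul ?_
  filter_upwards [coeFn_smul_L2 c f] with x h
  rw [h, norm_mul]
  exact mul_le_mul_of_nonneg_right (hc x) (norm_nonneg _)

theorem norm_smul_le_of_ae_norm_le (c : C(Torus, ℂ)) {f : L2T} {β : ℝ}
    (hf : ∀ᵐ p ∂torusMeasure, ‖f p‖ ≤ β) : ‖c • f‖ ≤ β * ‖toL2 c‖ := by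
  refine Lp.norm_le_mul_norm_of_ae_le_mul ?_
  filter_upwards [coeFn_smul_L2 c f, coeFn_toL2 c, hf] with x h h1 h2
  rw [h, norm_mul, h1, mul_comm]
  exact mul_le_mul_of_nonneg_right h2 (norm_nonneg _)

/-- The `L²` norm of an element of `H¹(𝕋)`. -/
def normVal (x : H1) : ℝ := ‖toL2 (val x)‖

theorem normVal_nonneg (x : H1) : 0 ≤ normVal x := norm_nonneg _

theorem normVal_mul_le {a : H1} {β : ℝ} (ha : ∀ p, ‖val a p‖ ≤ β) (y : H1) :
    normVal (a * y) ≤ β * normVal y := by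
  rw [normVal, val_mul, ← smul_toL2]
  exact norm_smul_le_of_norm_le ha _

theorem norm_der_mul_le {a : H1} {β : ℝ} (ha : ∀ p, ‖val a p‖ ≤ β)
    (ha' : ∀ᵐ p ∂torusMeasure, ‖der a p‖ ≤ β) (y : H1) :
    ‖der (a * y)‖ ≤ β * (‖der y‖ + normVal y) := by
  rw [der_mul, mul_add]
  exact (norm_add_le _ _).trans
    (add_le_add (norm_smul_le_of_norm_le ha _) (norm_smul_le_of_ae_norm_le _ ha'))

theorem norm_val_exp {w : H1} (hw : ∀ p, (val w p).re = 0) (p : Torus) :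
    ‖val (NormedSpace.exp w) p‖ = 1 := by
  rw [val_exp_apply, Complex.norm_exp, hw, Real.exp_zero]

theorem normVal_exp_mul_le {w : H1} (hw : ∀ p, (val w p).re = 0) (y : H1) :
    normVal (NormedSpace.exp w * y) ≤ normVal y := by
  simpa using normVal_mul_le (β := 1) (fun p => (norm_val_exp hw p).le) y

/-- The inequality is sharper than the product estimate in `H¹(𝕋)`: the factor of modulus one drops out
of both terms, so that no power of a constant is collected over the time steps. -/
theorem norm_der_exp_mul_le {w : H1} (hw : ∀ p, (val w p).re = 0) (y : H1) :
    ‖der (NormedSpace.exp w * y)‖ ≤ ‖der y‖ + ‖val y • der w‖ := by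
  have h : der (NormedSpace.exp w * y) = val (NormedSpace.exp w) • (der y + val y • der w) := by
    rw [der_mul, der_exp, smul_add, smul_comm]
  rw [h]
  refine (norm_smul_le_of_norm_le (β := 1) (fun p => (norm_val_exp hw p).le) _).trans ?_
  rw [one_mul]
  exact norm_add_le _ _

theorem val_real_smul (c : ℝ) (x : H1) : val (c • x) = (c : ℂ) • val x := by
  rw [← Complex.coe_smul, val_smul]

theorem der_real_smul (c : ℝ) (x : H1) : der (c • x) = (c : ℂ) • der x := by
  rw [← Complex.coe_smul, der_smul]

section Evolution

variable {m : ℕ} {a₀ : H1} {a : Fin m → H1} {β : Fin m → ℝ}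

theorem val_exponent_re (h₀ : ∀ p, (val a₀ p).re = 0) (h : ∀ j p, (val (a j) p).re = 0)
    (ξ : Fin m → ℝ) (p : Torus) : (val (a₀ + ∑ j, ξ j • a j) p).re = 0 := by
  rw [val_add, val_sum, ContinuousMap.add_apply, ContinuousMap.sum_apply, Complex.add_re,
    Complex.re_sum, h₀, zero_add]
  refine Finset.sum_eq_zero fun j _ => ?_
  rw [val_real_smul, ContinuousMap.smul_apply, smul_eq_mul, Complex.re_ofReal_mul, h, mul_zero]

/-- The derivative of the potential. The part that depends on `ξ` is bounded pointwise and leaves the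
`L²` norm of `y`, which both flows conserve, while the derivative of `a₀` is only square integrable. -/
theorem norm_val_smul_der_exponent_le (hβ : ∀ j, ∀ᵐ p ∂torusMeasure, ‖der (a j) p‖ ≤ β j)
    (ξ : Fin m → ℝ) (y : H1) :
    ‖val y • der (a₀ + ∑ j, ξ j • a j)‖
      ≤ embConst * ‖der a₀‖ * (normVal y + ‖der y‖) + (∑ j, β j * |ξ j|) * normVal y := by
  rw [der_add, der_sum, smul_add, Finset.smul_sum]
  refine (norm_add_le _ _).trans (add_le_add ?_ ?_)
  · refine (norm_contMul_le _ _).trans ?_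
    have := mul_le_mul_of_nonneg_right (norm_val_le y) (norm_nonneg (der a₀))
    rw [← normVal] at this
    linarith
  · rw [Finset.sum_mul]
    refine (norm_sum_le _ _).trans (Finset.sum_le_sum fun j _ => ?_)
    refine norm_smul_le_of_ae_norm_le _ ?_
    filter_upwards [hβ j, Lp.coeFn_smul (ξ j : ℂ) (der (a j))] with p h1 h2
    rw [der_real_smul, h2, Pi.smul_apply, norm_smul, Complex.norm_real, Real.norm_eq_abs, mul_comm]
    exact mul_le_mul_of_nonneg_right h1 (abs_nonneg _)

theorem prod_mul_bounds (hβ0 : ∀ j, 0 ≤ β j) (hβ : ∀ j p, ‖val (a j) p‖ ≤ β j)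
    (hβ' : ∀ j, ∀ᵐ p ∂torusMeasure, ‖der (a j) p‖ ≤ β j) (w : Finset (Fin m)) (y : H1) :
    normVal ((∏ j ∈ w, a j) * y) ≤ (∏ j ∈ w, β j) * normVal y ∧
      ‖der ((∏ j ∈ w, a j) * y)‖ ≤ (∏ j ∈ w, β j) * (‖der y‖ + w.card * normVal y) := by
  induction w using Finset.induction_on with
  | empty => simp
  | insert j w hj ih =>
    rw [Finset.prod_insert hj, Finset.prod_insert hj, mul_assoc, mul_assoc, mul_assoc,
      Finset.card_insert_of_notMem hj]
    refine ⟨(normVal_mul_le (hβ j) _).trans (mul_le_mul_of_nonneg_left ih.1 (hβ0 j)),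
      (norm_der_mul_le (hβ j) (hβ' j) _).trans (mul_le_mul_of_nonneg_left ?_ (hβ0 j))⟩
    push_cast
    linarith [ih.1, ih.2]

/-- One potential step, differentiated in the coordinates of `w`. -/
theorem expFamily_mul_bounds (h₀ : ∀ p, (val a₀ p).re = 0) (h : ∀ j p, (val (a j) p).re = 0)
    (hβ0 : ∀ j, 0 ≤ β j) (hβ : ∀ j p, ‖val (a j) p‖ ≤ β j)
    (hβ' : ∀ j, ∀ᵐ p ∂torusMeasure, ‖der (a j) p‖ ≤ β j) (w : Finset (Fin m)) (ξ : Fin m → ℝ)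
    (y : H1) :
    normVal (expFamily a₀ a w ξ * y) ≤ (∏ j ∈ w, β j) * normVal y ∧
      ‖der (expFamily a₀ a w ξ * y)‖ ≤ (∏ j ∈ w, β j) * ((1 + embConst * ‖der a₀‖) * ‖der y‖ +
        (w.card + (∑ j, β j * |ξ j| + embConst * ‖der a₀‖)) * normVal y) := by
  rw [expFamily, mul_assoc]
  have hre := val_exponent_re h₀ h ξ
  have h1 := normVal_exp_mul_le hre y
  have h2 := (norm_der_exp_mul_le hre y).trans
    (add_le_add_right (norm_val_smul_der_exponent_le hβ' ξ y) _)
  have hP : 0 ≤ ∏ j ∈ w, β j := Finset.prod_nonneg fun j _ => hβ0 j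
  obtain ⟨h3, h4⟩ := prod_mul_bounds hβ0 hβ hβ' w (NormedSpace.exp (a₀ + ∑ j, ξ j • a j) * y)
  refine ⟨h3.trans (mul_le_mul_of_nonneg_left h1 hP), h4.trans (mul_le_mul_of_nonneg_left ?_ hP)⟩
  have h5 := mul_le_mul_of_nonneg_left h1 (Nat.cast_nonneg (α := ℝ) w.card)
  linarith

/-- The mixed derivatives of the Lie-Trotter approximations, for a potential flow of the form
`exp(a₀ + ∑ⱼ ξⱼ aⱼ)`. -/
def evolution (τ : ℝ) (x₀ a₀ : H1) (a : Fin m → H1) :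
    ℕ → Finset (Fin m) → (Fin m → ℝ) → H1
  | 0 => constFamily x₀
  | n + 1 => fun u ξ => kinH1 τ (leibniz (expFamily a₀ a) (evolution τ x₀ a₀ a n) u ξ)

theorem isMixedFamily_evolution (τ : ℝ) (x₀ a₀ : H1) (a : Fin m → H1) (n : ℕ) :
    IsMixedFamily (evolution τ x₀ a₀ a n) := by
  induction n with
  | zero => exact isMixedFamily_const x₀
  | succ n ih => exact ((isMixedFamily_exp a₀ a).mul ih).map ((kinH1 τ).restrictScalars ℝ)

theorem normVal_sum_le {ι : Type*} (s : Finset ι) (f : ι → H1) :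
    normVal (∑ i ∈ s, f i) ≤ ∑ i ∈ s, normVal (f i) := by
  rw [normVal, val_sum, map_sum]
  exact norm_sum_le _ _

theorem norm_der_sum_le {ι : Type*} (s : Finset ι) (f : ι → H1) :
    ‖der (∑ i ∈ s, f i)‖ ≤ ∑ i ∈ s, ‖der (f i)‖ := by
  rw [der_sum]
  exact norm_sum_le _ _

theorem sum_powerset_pow_card_sdiff (n : ℕ) (u : Finset (Fin m)) :
    ∑ w ∈ u.powerset, (n : ℝ) ^ (u \ w).card = ((n : ℝ) + 1) ^ u.card := by
  have := Finset.sum_pow_mul_eq_add_pow (1 : ℝ) (n : ℝ) u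
  rw [add_comm (n : ℝ) 1, ← this]
  refine Finset.sum_congr rfl fun w hw => ?_
  rw [one_pow, one_mul, Finset.card_sdiff_of_subset (Finset.mem_powerset.1 hw)]

/-- Bounds for the mixed derivatives after `n` steps. The factors `β j` are proportional to the time
step, so that `n ^ |u| ∏ β j` and `n β j` remain bounded as the step size decreases. -/
theorem evolution_bounds (h₀ : ∀ p, (val a₀ p).re = 0) (h : ∀ j p, (val (a j) p).re = 0)
    (hβ0 : ∀ j, 0 ≤ β j) (hβ : ∀ j p, ‖val (a j) p‖ ≤ β j)
    (hβ' : ∀ j, ∀ᵐ p ∂torusMeasure, ‖der (a j) p‖ ≤ β j) (τ : ℝ) (x₀ : H1) (ξ : Fin m → ℝ)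
    (n : ℕ) (u : Finset (Fin m)) :
    normVal (evolution τ x₀ a₀ a n u ξ) ≤ (n : ℝ) ^ u.card * (∏ j ∈ u, β j) * normVal x₀ ∧
      ‖der (evolution τ x₀ a₀ a n u ξ)‖ ≤ (n : ℝ) ^ u.card * (∏ j ∈ u, β j) *
        (Real.exp (n * (embConst * ‖der a₀‖)) * (‖der x₀‖ +
          (u.card + n * (∑ j, β j * |ξ j| + embConst * ‖der a₀‖)) * normVal x₀)) := by
  set c : ℝ := embConst * ‖der a₀‖ with hc
  have hc0 : 0 ≤ c := mul_nonneg embConst_nonneg (norm_nonneg _)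
  set B : ℝ := ∑ j, β j * |ξ j| with hB
  have hB0 : 0 ≤ B := Finset.sum_nonneg fun j _ => mul_nonneg (hβ0 j) (abs_nonneg _)
  have hp0 := normVal_nonneg x₀
  have hprod : ∀ s : Finset (Fin m), 0 ≤ ∏ j ∈ s, β j := fun s =>
    Finset.prod_nonneg fun j _ => hβ0 j
  induction n generalizing u with
  | zero =>
    by_cases hu : u = ∅
    · subst hu; simp [evolution, constFamily]
    · simp [evolution, constFamily, hu, normVal]
  | succ n ih =>
    have hpq : ∀ w ∈ u.powerset, (∏ j ∈ w, β j) * ∏ j ∈ u \ w, β j = ∏ j ∈ u, β j :=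
      fun w hw => by rw [mul_comm, Finset.prod_sdiff (Finset.mem_powerset.1 hw)]
    have step : ∀ w, _ := fun w => expFamily_mul_bounds h₀ h hβ0 hβ hβ' w ξ
      (evolution τ x₀ a₀ a n (u \ w) ξ)
    push_cast
    constructor
    · rw [evolution, normVal, toL2_val_kinH1, norm_kineticFlow, ← normVal, leibniz]
      refine (normVal_sum_le _ _).trans ?_
      rw [← sum_powerset_pow_card_sdiff, Finset.sum_mul, Finset.sum_mul]
      refine Finset.sum_le_sum fun w hw => (step w).1.trans ?_
      refine (mul_le_mul_of_nonneg_left (ih (u \ w)).1 (hprod w)).trans_eq ?_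
      rw [← hpq w hw]; ring
    · rw [evolution, der_kinH1, norm_kineticFlow, leibniz]
      refine (norm_der_sum_le _ _).trans ?_
      rw [← sum_powerset_pow_card_sdiff, Finset.sum_mul, Finset.sum_mul]
      refine Finset.sum_le_sum fun w hw => (step w).2.trans ?_
      have hcard : (w.card : ℝ) + (u \ w).card = u.card := by
        rw [← Nat.cast_add, add_comm, Finset.card_sdiff_add_card_eq_card (Finset.mem_powerset.1 hw)]
      -- the part of the growth that comes from `a₀`, by `1 + c ≤ exp c`
      have hE : (1 + c) * Real.exp (n * c) ≤ Real.exp ((n + 1) * c) := by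
        rw [show ((n : ℝ) + 1) * c = c + n * c by ring, Real.exp_add]
        exact mul_le_mul_of_nonneg_right (by linarith [Real.add_one_le_exp c]) (Real.exp_nonneg _)
      have hE1 : 1 ≤ Real.exp ((n + 1) * c) := Real.one_le_exp (by positivity)
      obtain ⟨i1, i2⟩ := ih (u \ w)
      set P := (n : ℝ) ^ (u \ w).card * ∏ j ∈ u \ w, β j with hP
      have hP0 : 0 ≤ P := mul_nonneg (by positivity) (hprod _)
      rw [← hcard]
      set k : ℝ := ((u \ w).card : ℝ)
      set q : ℝ := ‖der x₀‖ + (k + n * (B + c)) * normVal x₀ with hq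
      have hq0 : 0 ≤ q := by positivity
      have key : (1 + c) * ‖der (evolution τ x₀ a₀ a n (u \ w) ξ)‖
          + (w.card + (B + c)) * normVal (evolution τ x₀ a₀ a n (u \ w) ξ)
          ≤ P * (Real.exp ((n + 1) * c) * (‖der x₀‖ +
            (w.card + k + (n + 1) * (B + c)) * normVal x₀)) := by
        have a1 := mul_le_mul_of_nonneg_left i2 (show 0 ≤ 1 + c by positivity)
        have a2 := mul_le_mul_of_nonneg_left i1 (show 0 ≤ w.card + (B + c) by positivity)
        have a3 := mul_le_mul_of_nonneg_right hE (mul_nonneg hP0 hq0)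
        have a4 := mul_le_mul_of_nonneg_right hE1
          (show 0 ≤ P * ((w.card + (B + c)) * normVal x₀) by positivity)
        have e : P * (Real.exp ((n + 1) * c) * (‖der x₀‖ +
            (w.card + k + (n + 1) * (B + c)) * normVal x₀))
            = Real.exp ((n + 1) * c) * (P * q)
              + Real.exp ((n + 1) * c) * (P * ((w.card + (B + c)) * normVal x₀)) := by
          rw [hq]; ring
        rw [e]
        linarith
      refine (mul_le_mul_of_nonneg_left key (hprod w)).trans_eq ?_
      rw [← hpq w hw, hP]; ring

end Evolution

/-! ### Weak derivatives and the potential -/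

/-- A closed condition on the values of a continuous function holds everywhere if it holds almost
everywhere, as Haar measure charges open sets. -/
theorem val_mem_of_ae {x : H1} {S : Set ℂ} (hS : IsClosed S)
    (h : ∀ᵐ p ∂torusMeasure, val x p ∈ S) (p : Torus) : val x p ∈ S := by
  have ho : IsOpen (val x ⁻¹' S)ᶜ := (hS.preimage (val x).continuous).isOpen_compl
  have : (val x ⁻¹' S)ᶜ = ∅ := (ho.measure_eq_zero_iff torusMeasure).1 h
  by_contra hp
  exact Set.notMem_empty p (this ▸ hp)

/-- The relation is the definition of the weak derivative with the test functions `cos (n x)` and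
`sin (n x)`. -/
theorem IsWeakDeriv.fourierCoeff_eq {f g : Torus → ℝ} (h : IsWeakDeriv f g) (n : ℤ) :
    fourierCoeff (fun x => (g x : ℂ)) n
      = Complex.I * n * fourierCoeff (fun x => (f x : ℂ)) n := by
  obtain ⟨hf, hg, hfg⟩ := h
  have hexp : ∀ x : ℝ, (fourier (-n) (x : Torus) : ℂ)
      = (Real.cos (n * x) : ℂ) - (Real.sin (n * x) : ℂ) * Complex.I := fun x => by
    rw [fourier_coe_apply, show 2 * π * Complex.I * ((-n : ℤ) : ℂ) * x / ((2 * π : ℝ) : ℂ)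
      = ((-(n * x) : ℝ) : ℂ) * Complex.I by
        have : (π : ℂ) ≠ 0 := by exact_mod_cast Real.pi_ne_zero
        push_cast; field_simp, Complex.exp_mul_I, ← Complex.ofReal_cos, ← Complex.ofReal_sin,
      Real.cos_neg, Real.sin_neg]
    push_cast; ring
  have hint : ∀ {k : Torus → ℝ}, Integrable k torusMeasure →
      IntervalIntegrable (fun x : ℝ => k (x : Torus)) volume 0 (2 * π) := fun {k} hk => by
    have h1 : Integrable k (volume : Measure Torus) := by
      rw [volume_eq_smul_haarAddCircle]
      exact hk.smul_measure ENNReal.ofReal_ne_top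
    rw [intervalIntegrable_iff_integrableOn_Ioc_of_le Real.two_pi_pos.le]
    have := (AddCircle.measurePreserving_mk (2 * π) 0).integrable_comp_of_integrable h1
    rw [zero_add] at this
    exact this
  have hofReal : ∀ {k : ℝ → ℝ}, IntervalIntegrable k volume 0 (2 * π) →
      IntervalIntegrable (fun x => (k x : ℂ)) volume 0 (2 * π) := fun hk =>
    ⟨hk.1.ofReal, hk.2.ofReal⟩
  have hsplit : ∀ {k : Torus → ℝ}, Integrable k torusMeasure →
      fourierCoeff (fun x => (k x : ℂ)) n = ((1 / (2 * π) : ℝ) : ℂ) *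
        (((∫ x in (0 : ℝ)..(2 * π), k (x : Torus) * Real.cos (n * x) : ℝ) : ℂ)
          - ((∫ x in (0 : ℝ)..(2 * π), k (x : Torus) * Real.sin (n * x) : ℝ) : ℂ)
            * Complex.I) := fun {k} hk => by
    rw [fourierCoeff_eq_intervalIntegral _ n 0, zero_add, Complex.real_smul]
    congr 1
    rw [← intervalIntegral.integral_ofReal, ← intervalIntegral.integral_ofReal,
      ← intervalIntegral.integral_mul_const, ← intervalIntegral.integral_sub]
    · refine intervalIntegral.integral_congr fun x _ => ?_
      simp only [hexp, smul_eq_mul, Complex.ofReal_mul]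
      ring
    · exact hofReal ((hint hk).mul_continuousOn (Continuous.continuousOn (by fun_prop)))
    · exact (hofReal ((hint hk).mul_continuousOn (Continuous.continuousOn (by fun_prop)))).mul_const _
  have hper : ∀ x : ℝ, (n : ℝ) * (x + 2 * π) = n * x + n * (2 * π) := fun x => by ring
  have hc := hfg (fun x => Real.cos (n * x)) (by fun_prop)
    (fun x => by simp only [hper, Real.cos_add_int_mul_two_pi])
  have hs := hfg (fun x => Real.sin (n * x)) (by fun_prop)
    (fun x => by simp only [hper, Real.sin_add_int_mul_two_pi])
  have dc : ∀ x : ℝ, deriv (fun x : ℝ => Real.cos (n * x)) x = -(n * Real.sin (n * x)) := fun x => by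
    have := ((hasDerivAt_id x).const_mul (n : ℝ)).cos
    simp only [id, mul_one] at this
    rw [this.deriv]; ring
  have ds : ∀ x : ℝ, deriv (fun x : ℝ => Real.sin (n * x)) x = n * Real.cos (n * x) := fun x => by
    have := ((hasDerivAt_id x).const_mul (n : ℝ)).sin
    simp only [id, mul_one] at this
    rw [this.deriv]; ring
  simp only [dc, ds, mul_neg, mul_left_comm _ (n : ℝ), intervalIntegral.integral_neg,
    intervalIntegral.integral_const_mul] at hc hs
  rw [hsplit hf, hsplit hg, ← neg_eq_iff_eq_neg.2 hs, ← neg_injective hc]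
  push_cast
  linear_combination (1 / (2 * (π : ℂ)) * n *
    ((∫ x in (0 : ℝ)..(2 * π), f (x : Torus) * Real.sin (n * x) : ℝ) : ℂ)) * Complex.I_sq

/-- A function in `H¹(𝕋) ∩ W^{1,∞}(𝕋)` as an element of the algebra `H¹(𝕋)`. -/
theorem exists_H1_of_memW1inf {f : Torus → ℝ} (hf : MemSobolev 1 fun x => (f x : ℂ))
    (hw : MemW1inf f) : ∃ x : H1, (val x =ᵐ[torusMeasure] fun p => (f p : ℂ)) ∧
      (∀ p, (val x p).im = 0) ∧ (∀ p, ‖val x p‖ ≤ (w1infNorm f).toReal) ∧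
      ∀ᵐ p ∂torusMeasure, ‖der x p‖ ≤ (w1infNorm f).toReal := by
  obtain ⟨x, hx⟩ := exists_H1_of_memSobolev hf
  have hb : ∀ {E : Type} [NormedAddCommGroup E] {g : Torus → E},
      eLpNorm g ⊤ torusMeasure ≤ w1infNorm f →
      ∀ᵐ p ∂torusMeasure, ‖g p‖ ≤ (w1infNorm f).toReal := fun {E} _ {g} hg => by
    filter_upwards [ae_le_eLpNormEssSup (f := g) (μ := torusMeasure)] with p hp
    rw [← eLpNorm_exponent_top] at hp
    have := ENNReal.toReal_mono hw.2.ne (hp.trans hg)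
    simpa using this
  -- every weak derivative with finite norm agrees with `der x` almost everywhere
  have hder : eLpNorm (der x) ⊤ torusMeasure ≤ w1infNorm f := by
    refine le_trans ?_ (le_max_right _ _)
    refine le_iInf₂ fun g hg => ?_
    by_cases hg' : eLpNorm g ⊤ torusMeasure = ⊤
    · rw [hg']; exact le_top
    have hgm : MemLp (fun p => (g p : ℂ)) 2 torusMeasure :=
      (MemLp.mono_exponent (p := 2) (q := ⊤) ⟨hg.2.1.1, lt_top_iff_ne_top.2 hg'⟩ le_top).ofReal
    have : der x = hgm.toLp _ := L2_ext_coeff fun n => by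
      rw [coeff_der, coeffL2_toL2, coeffL2_apply, fourierCoeff_congr_ae hgm.coeFn_toLp,
        hg.fourierCoeff_eq, fourierCoeff_congr_ae hx]
    rw [this, eLpNorm_congr_ae hgm.coeFn_toLp]
    refine (eLpNorm_mono fun p => ?_)
    rw [Complex.norm_real]
  refine ⟨x, hx, fun p => ?_, fun p => ?_, hb hder⟩
  · refine val_mem_of_ae (S := {z : ℂ | z.im = 0})
      (isClosed_eq Complex.continuous_im continuous_const) ?_ p
    filter_upwards [hx] with p hp
    simp [hp]
  · refine val_mem_of_ae (S := {z : ℂ | ‖z‖ ≤ (w1infNorm f).toReal})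
      (isClosed_le continuous_norm continuous_const) ?_ p
    filter_upwards [hx, hb (le_max_left _ _)] with p hp h
    simpa [hp] using h

/-- A real-valued function in `H¹(𝕋)` as an element of the algebra `H¹(𝕋)`. -/
theorem exists_H1_of_real {f : Torus → ℝ} (hf : MemSobolev 1 fun x => (f x : ℂ)) :
    ∃ x : H1, (val x =ᵐ[torusMeasure] fun p => (f p : ℂ)) ∧ ∀ p, (val x p).im = 0 := by
  obtain ⟨x, hx⟩ := exists_H1_of_memSobolev hf
  refine ⟨x, hx, fun p => ?_⟩
  refine val_mem_of_ae (S := {z : ℂ | z.im = 0})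
    (isClosed_eq Complex.continuous_im continuous_const) ?_ p
  filter_upwards [hx] with p hp
  simp [hp]

theorem kineticFlow_congr_ae (τ : ℝ) {f g : Torus → ℂ} (h : f =ᵐ[torusMeasure] g) :
    kineticFlow τ f = kineticFlow τ g := by
  rw [kineticFlow, fourierCoeff_congr_ae h]; rfl

/-- The evolution in `H¹(𝕋)`, undifferentiated, is the Lie-Trotter splitting. -/
theorem toL2_val_evolution {m : ℕ} (τ : ℝ) {x₀ a₀ : H1} {a : Fin m → H1} {ψin : L2T}
    (hx₀ : toL2 (val x₀) = ψin) (ξ : Fin m → ℝ) {V : Torus → ℝ}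
    (hV : val (a₀ + ∑ j, ξ j • a j) =ᵐ[torusMeasure] fun p => -(Complex.I * τ * V p)) (n : ℕ) :
    toL2 (val (evolution τ x₀ a₀ a n ∅ ξ)) = lieTrotter ψin V τ n := by
  induction n with
  | zero => simpa [evolution, constFamily, lieTrotter] using hx₀
  | succ n ih =>
    rw [evolution, toL2_val_kinH1, lieTrotter, leibniz, Finset.powerset_empty,
      Finset.sum_singleton, Finset.sdiff_self]
    refine kineticFlow_congr_ae τ ?_
    filter_upwards [coeFn_toL2 (val (expFamily a₀ a ∅ ξ * evolution τ x₀ a₀ a n ∅ ξ)), hV,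
      coeFn_toL2 (val (evolution τ x₀ a₀ a n ∅ ξ))] with p h1 h2 h3
    rw [h1, val_mul, ContinuousMap.mul_apply, expFamily, Finset.prod_empty, one_mul, val_exp_apply,
      h2, potentialFlow, ← ih, h3]

theorem toL2_val_mem_sobolev (x : H1) : toL2 (val x) ∈ sobolev 1 :=
  memSobolev_congr_ae (coeFn_toL2 (val x)).symm (memSobolev_val x).1

theorem sobolevNorm_congr_ae {s : ℝ} {f g : Torus → ℂ} (h : f =ᵐ[torusMeasure] g) :
    sobolevNorm s f = sobolevNorm s g := by
  rw [sobolevNorm, fourierCoeff_congr_ae h]; rfl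

/-- A bounded linear functional on `H¹(𝕋)`, on the algebra `H¹(𝕋)`. -/
theorem exists_functional (G : sobolev 1 →ₗ[ℂ] ℂ)
    (hG : ∃ K : ℝ, ∀ f : sobolev 1, ‖G f‖ ≤ K * sobolevNorm 1 ((f : L2T) : Torus → ℂ)) :
    ∃ (L : H1 →L[ℂ] ℂ) (K : ℝ), 0 ≤ K ∧ (∀ x, ‖L x‖ ≤ K * (normVal x + ‖der x‖)) ∧
      ∀ (x : H1) (f : Torus → ℂ), val x =ᵐ[torusMeasure] f →
        MemSobolev 1 f ∧ observable G f = L x := by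
  obtain ⟨K, hK⟩ := hG
  have hb : ∀ x : H1, ‖G ⟨toL2 (val x), toL2_val_mem_sobolev x⟩‖
      ≤ |K| * (normVal x + ‖der x‖) := fun x => by
    refine (hK _).trans ?_
    rw [sobolevNorm_congr_ae (coeFn_toL2 (val x))]
    exact mul_le_mul (le_abs_self K) (memSobolev_val x).2 (Real.sqrt_nonneg _) (abs_nonneg K)
  refine ⟨LinearMap.mkContinuous
    { toFun := fun x => G ⟨toL2 (val x), toL2_val_mem_sobolev x⟩
      map_add' := fun x y => by
        rw [← map_add]; congr 1
      map_smul' := fun c x => by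
        rw [← map_smul]; congr 1 } |K| fun x => (hb x).trans ?_,
    |K|, abs_nonneg K, fun x => hb x, fun x f hx => ?_⟩
  · rw [norm_H1_eq]
    exact mul_le_mul_of_nonneg_left (by linarith [norm_toL2_le (val x), normVal.eq_1 x])
      (abs_nonneg K)
  · have hf := memSobolev_congr_ae hx (memSobolev_val x).1
    refine ⟨hf, ?_⟩
    rw [observable, dif_pos hf]
    change _ = G _
    congr 2
    exact Lp.ext (hf.1.coeFn_toLp.trans (hx.symm.trans (coeFn_toL2 (val x)).symm))

/-! ### Parametric regularity of the quantity of interest -/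

/-- The Sobolev norm `‖f‖₂ + ‖f'‖₂`, as opposed to the algebra norm `‖f‖_∞ + ‖f'‖₂`. -/
def h1Norm (x : H1) : ℝ := normVal x + ‖der x‖

theorem h1Norm_nonneg (x : H1) : 0 ≤ h1Norm x := add_nonneg (normVal_nonneg x) (norm_nonneg _)

theorem h1Norm_mul_le (x y : H1) : h1Norm (x * y) ≤ 2 * embConst * (h1Norm x * h1Norm y) := by
  have hx := norm_val_le x
  have hy := norm_val_le y
  have h1 : normVal (x * y) ≤ ‖val x‖ * normVal y :=
    normVal_mul_le (val x).norm_coe_le_norm y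
  have h2 : ‖der (x * y)‖ ≤ ‖val x‖ * ‖der y‖ + ‖val y‖ * ‖der x‖ := by
    rw [der_mul]
    exact (norm_add_le _ _).trans (add_le_add (norm_contMul_le _ _) (norm_contMul_le _ _))
  have h3 : ‖val x‖ * h1Norm y ≤ embConst * h1Norm x * h1Norm y :=
    mul_le_mul_of_nonneg_right hx (h1Norm_nonneg y)
  have h4 : ‖val y‖ * ‖der x‖ ≤ embConst * h1Norm y * h1Norm x :=
    mul_le_mul hy (le_add_of_nonneg_left (normVal_nonneg x)) (norm_nonneg _)
      (mul_nonneg embConst_nonneg (h1Norm_nonneg y))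
  simp only [h1Norm] at *
  linarith

theorem h1Norm_conj (x : H1) : h1Norm (conjH1 x) = h1Norm x := by
  rw [h1Norm, h1Norm, normVal, normVal, val_conjH1, der_conjH1, toL2_star, norm_star_L2,
    norm_star_L2]

theorem h1Norm_sum_le {ι : Type*} (s : Finset ι) (f : ι → H1) :
    h1Norm (∑ i ∈ s, f i) ≤ ∑ i ∈ s, h1Norm (f i) := by
  simp only [h1Norm]
  rw [Finset.sum_add_distrib]
  exact add_le_add (normVal_sum_le s f) (norm_der_sum_le s f)

/-- The mixed derivatives of `|ψ|² = ψ ψ̄`; the factor `2 ^ |u|` counts the terms of the Leibniz rule. -/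
theorem h1Norm_leibniz_conj_le {m : ℕ} {ψ : Finset (Fin m) → (Fin m → ℝ) → H1} {t : Fin m → ℝ}
    (ht : ∀ j, 0 ≤ t j) {A : ℝ} (hA : 0 ≤ A) (ξ : Fin m → ℝ)
    (hψ : ∀ u, h1Norm (ψ u ξ) ≤ (∏ j ∈ u, t j) * (A * (1 + u.card))) (u : Finset (Fin m)) :
    h1Norm (leibniz ψ (fun w ξ => conjH1 (ψ w ξ)) u ξ)
      ≤ 2 * embConst * A ^ 2 * ((∏ j ∈ u, t j) * (2 ^ u.card * (1 + u.card) ^ 2)) := by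
  have hprod : ∀ s : Finset (Fin m), 0 ≤ ∏ j ∈ s, t j := fun s =>
    Finset.prod_nonneg fun j _ => ht j
  have hterm : ∀ w ∈ u.powerset, h1Norm (ψ w ξ * conjH1 (ψ (u \ w) ξ))
      ≤ 2 * embConst * A ^ 2 * ((∏ j ∈ u, t j) * (1 + u.card) ^ 2) := fun w hw => by
    have hw := Finset.mem_powerset.1 hw
    have h1 := (h1Norm_mul_le (ψ w ξ) (conjH1 (ψ (u \ w) ξ)))
    rw [h1Norm_conj] at h1
    have c1 : (w.card : ℝ) ≤ u.card := by exact_mod_cast Finset.card_le_card hw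
    have c2 : ((u \ w).card : ℝ) ≤ u.card := by exact_mod_cast Finset.card_le_card Finset.sdiff_subset
    have e1 : h1Norm (ψ w ξ) ≤ (∏ j ∈ w, t j) * (A * (1 + u.card)) :=
      (hψ w).trans (mul_le_mul_of_nonneg_left (by gcongr) (hprod w))
    have e2 : h1Norm (ψ (u \ w) ξ) ≤ (∏ j ∈ u \ w, t j) * (A * (1 + u.card)) :=
      (hψ _).trans (mul_le_mul_of_nonneg_left (by gcongr) (hprod _))
    have e3 := mul_le_mul e1 e2 (h1Norm_nonneg _)
      (mul_nonneg (hprod w) (by positivity))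
    refine h1.trans ((mul_le_mul_of_nonneg_left e3
      (mul_nonneg zero_le_two embConst_nonneg)).trans_eq ?_)
    rw [← Finset.prod_sdiff hw]; ring
  refine (h1Norm_sum_le _ _).trans ((Finset.sum_le_sum hterm).trans_eq ?_)
  rw [Finset.sum_const, Finset.card_powerset, nsmul_eq_mul]
  push_cast; ring

/-- The order dependence of the derivatives of the density, in the form that occurs in the weights. -/
theorem two_pow_mul_sq_le (k : ℕ) :
    (2 : ℝ) ^ k * (1 + k) ^ 2 ≤ ((k + 1).factorial : ℝ) * 4 ^ k := by
  have h1 : (1 + k : ℝ) ≤ 2 ^ k := by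
    have : k + 1 ≤ 2 ^ k := Nat.lt_two_pow_self
    rw [add_comm]; exact_mod_cast this
  have h2 : (1 + k : ℝ) ≤ ((k + 1).factorial : ℝ) := by
    rw [add_comm]; exact_mod_cast Nat.self_le_factorial (k + 1)
  calc (2 : ℝ) ^ k * (1 + k) ^ 2 = 2 ^ k * ((1 + k) * (1 + k)) := by ring
    _ ≤ 2 ^ k * (((k + 1).factorial : ℝ) * 2 ^ k) := by gcongr
    _ = ((k + 1).factorial : ℝ) * (2 * 2) ^ k := by rw [mul_pow]; ring
    _ = _ := by norm_num

/-- Polynomial growth is traded for the factor `exp B`, with `(1 + B)² ≤ 2 exp B`. -/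
theorem sq_one_add_le {T B : ℝ} (hB : 0 ≤ B) (hT : 0 ≤ T) :
    (1 + T * B) ^ 2 ≤ 2 * cT T ^ 2 * Real.exp B := by
  have h1 : 1 ≤ cT T := le_max_left _ _
  have h2 : T ≤ cT T := le_max_right _ _
  have h3 : 1 + T * B ≤ cT T * (1 + B) := by nlinarith
  have h4 := Real.quadratic_le_exp_of_nonneg hB
  calc (1 + T * B) ^ 2 ≤ (cT T * (1 + B)) ^ 2 := by gcongr
    _ = cT T ^ 2 * (1 + B) ^ 2 := by ring
    _ ≤ cT T ^ 2 * (2 * Real.exp B) := by gcongr; nlinarith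
    _ = _ := by ring

set_option maxHeartbeats 1000000 in
/-- The quantity of interest has mixed first derivatives whose size is controlled uniformly in
the number of parameters and in the discretization. The factor `exp(∑ⱼ bⱼ|ξⱼ|)` comes from the
linear growth in `ξ` of the `H¹` norm of the approximations. -/
theorem exists_quantity_family {s : ℝ} (hs : 1 ≤ s) {ψin : L2T} (hψin : MemSobolev s ψin)
    {v₀ : Torus → ℝ} (hv₀ : MemSobolev s (fun x => (v₀ x : ℂ)))
    {v : ℕ → Torus → ℝ} (hvs : ∀ j, MemSobolev s (fun x => (v j x : ℂ)))
    (hvw : ∀ j, MemW1inf (v j)) {lam : ℕ → ℝ} (hlam : ∀ j, 0 < lam j)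
    {G : sobolev 1 →ₗ[ℂ] ℂ}
    (hG : ∃ K : ℝ, ∀ f : sobolev 1, ‖G f‖ ≤ K * sobolevNorm 1 ((f : L2T) : Torus → ℂ))
    {T : ℝ} (hT : 0 < T) :
    ∃ C : ℝ, 0 ≤ C ∧ ∀ (m : ℕ) (τ : ℝ) (n : ℕ), 0 < τ → n * τ ≤ T →
      (∀ ξ : Fin m → ℝ, MemSobolev 1 (density (semiDiscrete ψin v₀ v lam τ n ξ))) ∧
      ∃ F : Finset (Fin m) → (Fin m → ℝ) → ℂ, IsMixedFamily F ∧
        F ∅ = quantity G ψin v₀ v lam τ n m ∧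
        ∀ u ξ, ‖F u ξ‖ ≤ C * (((u.card + 1).factorial : ℝ) * (4 * cT T) ^ u.card *
          ∏ j ∈ u, bSeq v lam j) * Real.exp (∑ j : Fin m, bSeq v lam j * |ξ j|) := by
  obtain ⟨L, K, hK, hLK, hL⟩ := exists_functional G hG
  obtain ⟨x₀, hx₀⟩ := exists_H1_of_memSobolev (hψin.mono hs)
  have hx₀' : toL2 (val x₀) = ψin := Lp.ext ((coeFn_toL2 _).trans hx₀)
  obtain ⟨y₀, hy₀, hy₀im⟩ := exists_H1_of_real (hv₀.mono hs)
  choose y hy hyim hyb hyb' using fun j => exists_H1_of_memW1inf ((hvs j).mono hs) (hvw j)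
  have hb0 : ∀ j, 0 ≤ bSeq v lam j := fun j => mul_nonneg (hlam j).le ENNReal.toReal_nonneg
  have hcT : 1 ≤ cT T := le_max_left _ _
  set c : ℝ := embConst * ‖der y₀‖ with hc
  have hc0 : 0 ≤ c := mul_nonneg embConst_nonneg (norm_nonneg _)
  set A : ℝ := normVal x₀ + Real.exp (T * c) * (‖der x₀‖ + (1 + T * c) * normVal x₀) with hA
  have hx₀n := normVal_nonneg x₀
  have hA0 : 0 ≤ A := by positivity
  refine ⟨K * (2 * embConst * A ^ 2 * (2 * cT T ^ 2)),
    mul_nonneg hK (mul_nonneg (mul_nonneg (mul_nonneg zero_le_two embConst_nonneg)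
      (sq_nonneg A)) (by positivity)), fun m τ n hτ hn => ?_⟩
  set a₀ : H1 := (-(Complex.I * τ)) • y₀ with ha₀
  set a : Fin m → H1 := fun j => (-(Complex.I * τ * lam j)) • y j with ha
  have hre₀ : ∀ p, (val a₀ p).re = 0 := fun p => by
    rw [ha₀, val_smul]; simp [hy₀im]
  have hre : ∀ j p, (val (a j) p).re = 0 := fun j p => by
    simp only [ha, val_smul]; simp [hyim]
  have hnorm : ∀ j : ℕ, ‖-(Complex.I * τ * lam j)‖ = τ * lam j := fun j => by
    rw [norm_neg, norm_mul, norm_mul, Complex.norm_I, one_mul, Complex.norm_real,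
      Complex.norm_real, Real.norm_of_nonneg hτ.le, Real.norm_of_nonneg (hlam j).le]
  have hβ : ∀ j p, ‖val (a j) p‖ ≤ τ * bSeq v lam j := fun j p => by
    simp only [ha, val_smul, ContinuousMap.smul_apply]
    rw [norm_smul, hnorm, mul_assoc]
    exact mul_le_mul_of_nonneg_left (mul_le_mul_of_nonneg_left (hyb j p) (hlam j).le) hτ.le
  have hβ' : ∀ j, ∀ᵐ p ∂torusMeasure, ‖der (a j) p‖ ≤ τ * bSeq v lam j := fun j => by
    filter_upwards [hyb' j, Lp.coeFn_smul (-(Complex.I * τ * lam j)) (der (y j))] with p h1 h2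
    simp only [ha, der_smul]
    rw [h2, Pi.smul_apply, norm_smul, hnorm, mul_assoc]
    exact mul_le_mul_of_nonneg_left (mul_le_mul_of_nonneg_left h1 (hlam j).le) hτ.le
  have hda₀ : embConst * ‖der a₀‖ = τ * c := by
    rw [ha₀, der_smul, norm_smul, norm_neg, norm_mul, Complex.norm_I, one_mul, Complex.norm_real,
      Real.norm_of_nonneg hτ.le]
    ring
  set ψ := evolution τ x₀ a₀ a n with hψ
  -- the mixed derivatives of the approximations in `H¹`
  have hψb : ∀ (ξ : Fin m → ℝ) u, h1Norm (ψ u ξ) ≤ (∏ j ∈ u, cT T * bSeq v lam j) *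
      (A * (1 + T * ∑ j : Fin m, bSeq v lam j * |ξ j|) * (1 + u.card)) := fun ξ u => by
    obtain ⟨h1, h2⟩ := evolution_bounds hre₀ hre (fun j => mul_nonneg hτ.le (hb0 j)) hβ hβ' τ x₀
      ξ n u
    set B : ℝ := ∑ j : Fin m, bSeq v lam j * |ξ j| with hB
    have hB0 : 0 ≤ B := Finset.sum_nonneg fun j _ => mul_nonneg (hb0 j) (abs_nonneg _)
    have eB : ∑ j : Fin m, τ * bSeq v lam j * |ξ j| = τ * B := by
      rw [hB, Finset.mul_sum]; exact Finset.sum_congr rfl fun j _ => by ring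
    have eP : (n : ℝ) ^ u.card * ∏ j ∈ u, τ * bSeq v lam j
        ≤ ∏ j ∈ u, cT T * bSeq v lam j := by
      rw [← Finset.prod_const, ← Finset.prod_mul_distrib]
      refine Finset.prod_le_prod (fun j _ => mul_nonneg (Nat.cast_nonneg n)
        (mul_nonneg hτ.le (hb0 j))) fun j _ => ?_
      rw [← mul_assoc]
      exact mul_le_mul_of_nonneg_right (hn.trans (le_max_right _ _)) (hb0 j)
    rw [hda₀, eB] at h2
    have hP0 : 0 ≤ ∏ j ∈ u, cT T * bSeq v lam j :=
      Finset.prod_nonneg fun j _ => mul_nonneg (by linarith) (hb0 j)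
    have hexp : Real.exp (n * (τ * c)) ≤ Real.exp (T * c) := by
      rw [← mul_assoc]; exact Real.exp_le_exp.2 (mul_le_mul_of_nonneg_right hn hc0)
    have hTB : n * (τ * B + τ * c) ≤ T * B + T * c := by
      have := mul_le_mul_of_nonneg_right hn (add_nonneg hB0 hc0)
      linarith
    have hq : ‖der x₀‖ + (u.card + n * (τ * B + τ * c)) * normVal x₀
        ≤ (‖der x₀‖ + (1 + T * c) * normVal x₀) * ((1 + T * B) * (1 + u.card)) := by
      have hk : (0 : ℝ) ≤ u.card := Nat.cast_nonneg _
      have hTB0 : 0 ≤ T * B := by positivity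
      have hTc0 : 0 ≤ T * c := by positivity
      have e1 : 1 ≤ (1 + T * B) * (1 + u.card) := by nlinarith
      have e2 : u.card + (T * B + T * c) ≤ (1 + T * c) * ((1 + T * B) * (1 + u.card)) := by
        nlinarith [mul_nonneg hTB0 hk, mul_nonneg hTc0 hk, mul_nonneg hTc0 hTB0,
          mul_nonneg (mul_nonneg hTc0 hTB0) hk]
      have e3 : (u.card + n * (τ * B + τ * c)) * normVal x₀
          ≤ ((1 + T * c) * ((1 + T * B) * (1 + u.card))) * normVal x₀ :=
        mul_le_mul_of_nonneg_right (by linarith) hx₀n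
      have e4 : ‖der x₀‖ ≤ ‖der x₀‖ * ((1 + T * B) * (1 + u.card)) :=
        le_mul_of_one_le_right (norm_nonneg _) e1
      linarith
    have hone : normVal x₀ ≤ normVal x₀ * ((1 + T * B) * (1 + u.card)) := by
      refine le_mul_of_one_le_right hx₀n ?_
      have : 0 ≤ T * B := by positivity
      nlinarith [Nat.cast_nonneg (α := ℝ) u.card]
    calc h1Norm (ψ u ξ)
        ≤ ((n : ℝ) ^ u.card * ∏ j ∈ u, τ * bSeq v lam j) * (normVal x₀ +
          Real.exp (n * (τ * c)) * (‖der x₀‖ + (u.card + n * (τ * B + τ * c)) * normVal x₀)) := by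
          rw [mul_add]; exact add_le_add h1 h2
      _ ≤ (∏ j ∈ u, cT T * bSeq v lam j) * (normVal x₀ * ((1 + T * B) * (1 + u.card)) +
          Real.exp (T * c) * ((‖der x₀‖ + (1 + T * c) * normVal x₀) *
            ((1 + T * B) * (1 + u.card)))) := by
          refine mul_le_mul eP (add_le_add hone (mul_le_mul hexp hq (by positivity)
            (Real.exp_nonneg _))) (by positivity) hP0
      _ = _ := by rw [hA]; ring
  -- the exponent is `-iτV_m(ξ, ·)`
  have hV : ∀ ξ : Fin m → ℝ, val (a₀ + ∑ j, ξ j • a j) =ᵐ[torusMeasure]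
      fun p => -(Complex.I * τ * potential v₀ v lam ξ p) := fun ξ => by
    filter_upwards [hy₀, ae_all_iff.2 hy] with p h1 h2
    rw [val_add, val_sum, ContinuousMap.add_apply, ContinuousMap.sum_apply, ha₀, val_smul,
      ContinuousMap.smul_apply, h1, potential]
    simp only [ha, val_real_smul, val_smul, ContinuousMap.smul_apply, h2, smul_eq_mul]
    push_cast
    rw [mul_add, neg_add, Finset.mul_sum, ← Finset.sum_neg_distrib]
    congr 1
    · ring
    · exact Finset.sum_congr rfl fun j _ => by ring
  have hdens : ∀ ξ : Fin m → ℝ, val (leibniz ψ (fun w ξ => conjH1 (ψ w ξ)) ∅ ξ) =ᵐ[torusMeasure]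
      density (semiDiscrete ψin v₀ v lam τ n ξ) := fun ξ => by
    have h := toL2_val_evolution τ hx₀' ξ (hV ξ) n
    rw [← hψ] at h
    filter_upwards [coeFn_toL2 (val (ψ ∅ ξ))] with p hp
    rw [h] at hp
    rw [leibniz, Finset.powerset_empty, Finset.sum_singleton, Finset.sdiff_self, val_mul,
      ContinuousMap.mul_apply, val_conjH1, density, semiDiscrete]
    change _ * star (val (ψ ∅ ξ) p) = _
    rw [← hp, RCLike.star_def, RCLike.mul_conj]
    push_cast; rfl
  refine ⟨fun ξ => (hL _ _ (hdens ξ)).1, fun u ξ =>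
    L (leibniz ψ (fun w ξ => conjH1 (ψ w ξ)) u ξ), ?_, ?_, fun u ξ => ?_⟩
  · have h1 := isMixedFamily_evolution τ x₀ a₀ a n
    exact (h1.mul (h1.map conjH1)).map (L.restrictScalars ℝ)
  · funext ξ
    rw [quantity, (hL _ _ (hdens ξ)).2]
  · set B : ℝ := ∑ j : Fin m, bSeq v lam j * |ξ j| with hB
    have hB0 : 0 ≤ B := Finset.sum_nonneg fun j _ => mul_nonneg (hb0 j) (abs_nonneg _)
    have hP0 : 0 ≤ ∏ j ∈ u, cT T * bSeq v lam j :=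
      Finset.prod_nonneg fun j _ => mul_nonneg (by linarith) (hb0 j)
    have h1 := h1Norm_leibniz_conj_le (t := fun j : Fin m => cT T * bSeq v lam j)
      (fun j => mul_nonneg (by linarith) (hb0 j)) (A := A * (1 + T * B))
      (mul_nonneg hA0 (add_nonneg zero_le_one (mul_nonneg hT.le hB0))) ξ (hψb ξ) u
    calc ‖L (leibniz ψ (fun w ξ => conjH1 (ψ w ξ)) u ξ)‖
        ≤ K * (2 * embConst * (A * (1 + T * B)) ^ 2 *
          ((∏ j ∈ u, cT T * bSeq v lam j) * (2 ^ u.card * (1 + u.card) ^ 2))) :=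
          (hLK _).trans (mul_le_mul_of_nonneg_left h1 hK)
      _ ≤ K * (2 * embConst * (A ^ 2 * (2 * cT T ^ 2 * Real.exp B)) *
          ((∏ j ∈ u, cT T * bSeq v lam j) * (((u.card + 1).factorial : ℝ) * 4 ^ u.card))) := by
          have e1 := sq_one_add_le hB0 hT.le
          have e2 := two_pow_mul_sq_le u.card
          have e3 := embConst_nonneg
          rw [mul_pow]
          gcongr
      _ = _ := by
          rw [Finset.prod_mul_distrib, Finset.prod_const, mul_pow]; ring

/-! ### The standard normal distribution -/

/-- The standard normal distribution. -/
abbrev stdGauss : Measure ℝ := gaussianReal 0 1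

/-- The standard normal density. -/
abbrev gaussPdf : ℝ → ℝ := gaussianPDFReal 0 1

theorem gaussPdf_eq (t : ℝ) : gaussPdf t = (√(2 * π))⁻¹ * Real.exp (-t ^ 2 / 2) := by
  simp [gaussianPDFReal]

theorem gaussPdf_pos (t : ℝ) : 0 < gaussPdf t := gaussianPDFReal_pos 0 1 t one_ne_zero

theorem continuous_gaussPdf : Continuous gaussPdf := by
  have : gaussPdf = fun t => (√(2 * π))⁻¹ * Real.exp (-t ^ 2 / 2) := funext gaussPdf_eq
  rw [this]; fun_prop

theorem gaussPdf_le (t : ℝ) : gaussPdf t ≤ Real.exp (-t ^ 2 / 2) := by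
  rw [gaussPdf_eq]
  refine mul_le_of_le_one_left (Real.exp_nonneg _) (inv_le_one_of_one_le₀ ?_)
  rw [Real.one_le_sqrt]
  linarith [Real.pi_gt_three]

instance : NullSingletonClass stdGauss := nullSingletonClass_gaussianReal one_ne_zero

theorem gaussCdf_eq_real (t : ℝ) : gaussCdf t = stdGauss.real (Set.Iic t) := cdf_eq_real _ t

theorem gaussCdf_eq_integral (t : ℝ) : gaussCdf t = ∫ x in Set.Iic t, gaussPdf x := by
  rw [gaussCdf_eq_real, Measure.real, gaussianReal_apply_eq_integral 0 one_ne_zero,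
    ENNReal.toReal_ofReal]
  exact setIntegral_nonneg measurableSet_Iic fun x _ => (gaussPdf_pos x).le

theorem gaussCdf_nonneg (t : ℝ) : 0 ≤ gaussCdf t := cdf_nonneg _ t

theorem gaussCdf_le_one (t : ℝ) : gaussCdf t ≤ 1 := cdf_le_one _ t

theorem hasDerivAt_gaussCdf (t : ℝ) : HasDerivAt gaussCdf (gaussPdf t) t := by
  have hint : Integrable gaussPdf := integrable_gaussianPDFReal 0 1
  have h : gaussCdf = fun x => (∫ y in (0 : ℝ)..x, gaussPdf y) + gaussCdf 0 := by
    funext x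
    rw [gaussCdf_eq_integral, gaussCdf_eq_integral,
      ← intervalIntegral.integral_Iic_sub_Iic hint.integrableOn hint.integrableOn,
      sub_add_cancel]
  rw [h]
  exact (intervalIntegral.integral_hasDerivAt_right hint.intervalIntegrable
    continuous_gaussPdf.stronglyMeasurable.stronglyMeasurableAtFilter
    continuous_gaussPdf.continuousAt).add_const _

theorem continuous_gaussCdf : Continuous gaussCdf :=
  continuous_iff_continuousAt.2 fun t => (hasDerivAt_gaussCdf t).continuousAt

theorem strictMono_gaussCdf : StrictMono gaussCdf :=
  strictMono_of_deriv_pos fun t => by rw [(hasDerivAt_gaussCdf t).deriv]; exact gaussPdf_pos t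

theorem gaussCdf_neg (t : ℝ) : gaussCdf (-t) = 1 - gaussCdf t := by
  have h1 : stdGauss.map (fun x => -x) = stdGauss := by
    rw [gaussianReal_map_neg, neg_zero]
  have h2 : stdGauss.real (Set.Iic (-t)) = stdGauss.real (Set.Ici t) := by
    rw [← h1, map_measureReal_apply measurable_neg measurableSet_Iic, h1]
    congr 1; ext x; simp
  have h3 : stdGauss.real (Set.Ici t) = stdGauss.real (Set.Ioi t) :=
    measureReal_congr Ioi_ae_eq_Ici.symm
  rw [gaussCdf_eq_real, h2, h3, gaussCdf_eq_real, ← Set.compl_Iic,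
    probReal_compl_eq_one_sub measurableSet_Iic]

/-- The Chernoff bound. -/
theorem gaussCdf_le_exp {t : ℝ} (ht : t ≤ 0) : gaussCdf t ≤ Real.exp (-t ^ 2 / 2) := by
  rw [gaussCdf_eq_real]
  have h := measure_le_le_exp_mul_mgf (μ := stdGauss) (X := id) t ht (integrable_exp_mul_gaussianReal t)
  refine h.trans ?_
  rw [mgf_id_gaussianReal, ← Real.exp_add]
  simp
  nlinarith

theorem one_sub_gaussCdf_le_exp {t : ℝ} (ht : 0 ≤ t) :
    1 - gaussCdf t ≤ Real.exp (-t ^ 2 / 2) := by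
  rw [← gaussCdf_neg]
  simpa using gaussCdf_le_exp (neg_nonpos.2 ht)

theorem gaussCdf_pos (t : ℝ) : 0 < gaussCdf t :=
  (gaussCdf_nonneg (t - 1)).trans_lt (strictMono_gaussCdf (by linarith))

theorem gaussCdf_lt_one (t : ℝ) : gaussCdf t < 1 :=
  (strictMono_gaussCdf (by linarith : t < t + 1)).trans_le (gaussCdf_le_one _)

theorem gaussInv_lt_iff {y : ℝ} (hy : y ∈ Set.Ioo (0 : ℝ) 1) (t : ℝ) :
    gaussInv y < t ↔ y < gaussCdf t := by
  obtain ⟨x, hx⟩ : ∃ x, gaussCdf x = y := by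
    have h0 := ((tendsto_cdf_atBot stdGauss).eventually (gt_mem_nhds hy.1)).exists
    have h1 := ((tendsto_cdf_atTop stdGauss).eventually (lt_mem_nhds hy.2)).exists
    obtain ⟨a, ha⟩ := h0
    obtain ⟨b, hb⟩ := h1
    exact mem_range_of_exists_le_of_exists_ge continuous_gaussCdf ⟨a, ha.le⟩ ⟨b, hb.le⟩
  have : gaussInv y = x := by
    rw [gaussInv, ← hx]
    have : {z | gaussCdf x ≤ gaussCdf z} = Set.Ici x := by
      ext z; exact strictMono_gaussCdf.le_iff_le
    rw [this, csInf_Ici]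
  rw [this, ← hx, strictMono_gaussCdf.lt_iff_lt]

/-- Outside `(0, 1)` the infimum is over all of `ℝ` or over the empty set, and is `0` in both cases. -/
theorem gaussInv_of_notMem {y : ℝ} (hy : y ∉ Set.Ioo (0 : ℝ) 1) : gaussInv y = 0 := by
  rcases le_or_gt y 0 with h | h
  · have : {x : ℝ | y ≤ gaussCdf x} = Set.univ :=
      Set.eq_univ_of_forall fun x => h.trans (gaussCdf_nonneg x)
    rw [gaussInv, this, Real.sInf_univ]
  · have h1 : 1 ≤ y := not_lt.1 fun h' => hy ⟨h, h'⟩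
    have : {x : ℝ | y ≤ gaussCdf x} = ∅ :=
      Set.eq_empty_of_forall_notMem fun x hx => absurd (hx : y ≤ gaussCdf x)
        (not_le.2 ((gaussCdf_lt_one x).trans_le h1))
    rw [gaussInv, this, Real.sInf_empty]

theorem measurable_gaussInv : Measurable gaussInv := by
  refine measurable_of_Iio fun t => ?_
  have : gaussInv ⁻¹' Set.Iio t = (Set.Ioo 0 1 ∩ Set.Iio (gaussCdf t)) ∪
      ((Set.Ioo (0 : ℝ) 1)ᶜ ∩ {_y | 0 < t}) := by
    ext y
    by_cases hy : y ∈ Set.Ioo (0 : ℝ) 1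
    · simp only [Set.mem_preimage, Set.mem_Iio, gaussInv_lt_iff hy, Set.mem_union, Set.mem_inter_iff,
        hy, true_and, Set.mem_compl_iff, not_true_eq_false, false_and, or_false]
    · simp only [Set.mem_preimage, Set.mem_Iio, gaussInv_of_notMem hy, Set.mem_union,
        Set.mem_inter_iff, hy, false_and, Set.mem_compl_iff, not_false_eq_true, true_and, false_or,
        Set.mem_ofPred_eq]
  rw [this]
  exact (measurableSet_Ioo.inter measurableSet_Iio).union
    (measurableSet_Ioo.compl.inter (.const _))

/-! ### The representation kernel -/

/-- The kernel `Φ(t) - 1_{t > x}` that represents a function through its Gaussian mean and its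
derivative. -/
def repKernel (x t : ℝ) : ℝ := gaussCdf t - if x < t then 1 else 0

theorem measurable_repKernel : Measurable fun q : ℝ × ℝ => repKernel q.1 q.2 :=
  (continuous_gaussCdf.measurable.comp measurable_snd).sub
    (Measurable.ite (measurableSet_lt measurable_fst measurable_snd) measurable_const
      measurable_const)

theorem abs_repKernel_le_one (x t : ℝ) : |repKernel x t| ≤ 1 := by
  have h0 := gaussCdf_nonneg t
  have h1 := gaussCdf_le_one t
  rw [repKernel, abs_le]
  split_ifs <;> constructor <;> linarith

/-- The kernel decays like the tails of the normal distribution in `t`, for fixed `x`. -/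
theorem abs_repKernel_le (x t : ℝ) :
    |repKernel x t| ≤ Real.exp (x ^ 2 / 2) * Real.exp (-t ^ 2 / 2) := by
  have hone : ∀ {z : ℝ}, 0 ≤ z → 1 ≤ Real.exp (z / 2) := fun hz => Real.one_le_exp (by linarith)
  have htriv : t ^ 2 ≤ x ^ 2 → |repKernel x t| ≤ Real.exp (x ^ 2 / 2) * Real.exp (-t ^ 2 / 2) :=
    fun h => by
    rw [← Real.exp_add]
    exact (abs_repKernel_le_one x t).trans (Real.one_le_exp (by linarith))
  have h0 := gaussCdf_nonneg t
  have h1 := gaussCdf_le_one t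
  by_cases hxt : x < t
  · by_cases ht : 0 ≤ t
    · rw [repKernel, if_pos hxt, abs_sub_comm, abs_of_nonneg (by linarith)]
      exact (one_sub_gaussCdf_le_exp ht).trans
        (le_mul_of_one_le_left (Real.exp_nonneg _) (hone (sq_nonneg x)))
    · exact htriv (by nlinarith)
  · by_cases ht : t ≤ 0
    · rw [repKernel, if_neg hxt, sub_zero, abs_of_nonneg h0]
      exact (gaussCdf_le_exp ht).trans
        (le_mul_of_one_le_left (Real.exp_nonneg _) (hone (sq_nonneg x)))
    · exact htriv (by nlinarith)

theorem exp_abs_mul_exp_le (b t : ℝ) : Real.exp (b * |t|) * Real.exp (-t ^ 2 / 2)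
    ≤ Real.exp ((b + 1) ^ 2 / 2) * Real.exp (-|t|) := by
  rw [← Real.exp_add, ← Real.exp_add, Real.exp_le_exp, ← sq_abs t]
  nlinarith [sq_nonneg (|t| - (b + 1))]

theorem tendsto_exp_neg_abs_atTop : Filter.Tendsto (fun t : ℝ => Real.exp (-|t|)) .atTop (nhds 0) :=
  Real.tendsto_exp_neg_atTop_nhds_zero.comp Filter.tendsto_abs_atTop_atTop

theorem tendsto_exp_neg_abs_atBot : Filter.Tendsto (fun t : ℝ => Real.exp (-|t|)) .atBot (nhds 0) :=
  Real.tendsto_exp_neg_atTop_nhds_zero.comp Filter.tendsto_abs_atBot_atTop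

theorem integral_exp_neg_mul_abs {c : ℝ} (hc : 0 < c) :
    ∫ t : ℝ, Real.exp (-(c * |t|)) = 2 / c := by
  have h' := integral_comp_abs (f := fun t => Real.exp (-(c * t)))
  have h := integral_exp_mul_Ioi (a := -c) (by linarith) 0
  rw [h']
  simp only [← neg_mul, h]
  simp; ring

theorem integrable_exp_neg_mul_abs {c : ℝ} (hc : 0 < c) :
    Integrable fun t : ℝ => Real.exp (-(c * |t|)) := by
  refine not_imp_comm.1 integral_undef ?_
  rw [integral_exp_neg_mul_abs hc]
  positivity

theorem integrable_exp_abs_mul_exp (b : ℝ) :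
    Integrable fun t : ℝ => Real.exp (b * |t|) * Real.exp (-t ^ 2 / 2) := by
  have h := (integrable_exp_neg_mul_abs one_pos).const_mul (Real.exp ((b + 1) ^ 2 / 2))
  refine h.mono' (by fun_prop) (.of_forall fun t => ?_)
  rw [Real.norm_of_nonneg (by positivity), one_mul]
  exact exp_abs_mul_exp_le b t

theorem integrable_exp_abs_gauss (b : ℝ) :
    Integrable (fun t : ℝ => Real.exp (b * |t|)) stdGauss := by
  have h := (integrable_exp_mul_gaussianReal (μ := 0) (v := 1) b).add
    (integrable_exp_mul_gaussianReal (μ := 0) (v := 1) (-b))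
  refine h.mono' (by fun_prop) (.of_forall fun t => ?_)
  rw [Real.norm_of_nonneg (Real.exp_nonneg _), Pi.add_apply]
  rcases abs_cases t with ⟨h, -⟩ | ⟨h, -⟩ <;> rw [h]
  · linarith [Real.exp_nonneg (-b * t)]
  · rw [mul_neg, neg_mul]; linarith [Real.exp_nonneg (b * t)]

/-- A function of one Gaussian variable is its mean plus an integral of its derivative. -/
theorem eq_integral_add_integral_repKernel {f f' : ℝ → ℂ} (hf : ∀ t, HasDerivAt f (f' t) t)
    (hf' : Continuous f') {D b : ℝ} (h1 : ∀ t, ‖f t‖ ≤ D * Real.exp (b * |t|))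
    (h2 : ∀ t, ‖f' t‖ ≤ D * Real.exp (b * |t|)) (x : ℝ) :
    f x = (∫ t, f t ∂stdGauss) + ∫ t, f' t * repKernel x t := by
  have hfc : Continuous f := continuous_iff_continuousAt.2 fun t => (hf t).continuousAt
  have hD : 0 ≤ D := by
    have := (norm_nonneg _).trans (h1 0)
    simpa using this
  have hmaj := (integrable_exp_abs_mul_exp b).const_mul D
  have hΦ : ∀ t, HasDerivAt (fun t => (gaussCdf t : ℂ)) (gaussPdf t : ℂ) t := fun t =>
    (hasDerivAt_gaussCdf t).ofReal_comp
  have hΦ1 : ∀ t, HasDerivAt (fun t => (gaussCdf t : ℂ) - 1) (gaussPdf t : ℂ) t := fun t =>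
    (hΦ t).sub_const 1
  have hΦc : Continuous fun t => (gaussCdf t : ℂ) :=
    Complex.continuous_ofReal.comp continuous_gaussCdf
  have hφc : Continuous fun t => (gaussPdf t : ℂ) :=
    Complex.continuous_ofReal.comp continuous_gaussPdf
  have hφf : Integrable fun t => (gaussPdf t : ℂ) * f t := by
    refine hmaj.mono' (hφc.mul hfc).aestronglyMeasurable (.of_forall fun t => ?_)
    rw [norm_mul, Complex.norm_real, Real.norm_of_nonneg (gaussPdf_pos t).le]
    calc gaussPdf t * ‖f t‖ ≤ Real.exp (-t ^ 2 / 2) * (D * Real.exp (b * |t|)) :=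
          mul_le_mul (gaussPdf_le t) (h1 t) (norm_nonneg _) (Real.exp_nonneg _)
      _ = _ := by ring
  have hk : Integrable fun t => f' t * repKernel x t := by
    have hm : Measurable fun t => (repKernel x t : ℂ) :=
      Complex.measurable_ofReal.comp (measurable_repKernel.comp measurable_prodMk_left)
    refine (hmaj.const_mul (Real.exp (x ^ 2 / 2))).mono'
      (hf'.aestronglyMeasurable.mul hm.aestronglyMeasurable) (.of_forall fun t => ?_)
    rw [norm_mul, Complex.norm_real, Real.norm_eq_abs]
    calc ‖f' t‖ * |repKernel x t|
        ≤ (D * Real.exp (b * |t|)) * (Real.exp (x ^ 2 / 2) * Real.exp (-t ^ 2 / 2)) :=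
          mul_le_mul (h2 t) (abs_repKernel_le x t) (abs_nonneg _) (by positivity)
      _ = _ := by ring
  have e1 : ∀ t ∈ Set.Iic x, f' t * repKernel x t = (gaussCdf t : ℂ) * f' t := fun t ht => by
    rw [repKernel, if_neg (not_lt.2 ht), sub_zero, mul_comm]
  have e2 : ∀ t ∈ Set.Ioi x, f' t * repKernel x t = ((gaussCdf t : ℂ) - 1) * f' t := fun t ht => by
    rw [repKernel, if_pos (Set.mem_Ioi.1 ht), mul_comm]; push_cast; rfl
  have lim : ∀ {l : Filter ℝ} {g : ℝ → ℂ}, (∀ᶠ t in l, ‖g t‖ ≤ Real.exp (-t ^ 2 / 2)) →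
      Filter.Tendsto (fun t : ℝ => Real.exp (-|t|)) l (nhds 0) →
      Filter.Tendsto (g * f) l (nhds 0) := fun {l g} hg hl => by
    refine squeeze_zero_norm' ?_ (by
      simpa using hl.const_mul (D * Real.exp ((b + 1) ^ 2 / 2)))
    filter_upwards [hg] with t ht
    rw [Pi.mul_apply, norm_mul]
    calc ‖g t‖ * ‖f t‖ ≤ Real.exp (-t ^ 2 / 2) * (D * Real.exp (b * |t|)) :=
          mul_le_mul ht (h1 t) (norm_nonneg _) (Real.exp_nonneg _)
      _ = D * (Real.exp (b * |t|) * Real.exp (-t ^ 2 / 2)) := by ring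
      _ ≤ D * (Real.exp ((b + 1) ^ 2 / 2) * Real.exp (-|t|)) :=
          mul_le_mul_of_nonneg_left (exp_abs_mul_exp_le b t) hD
      _ = _ := by ring
  -- integration by parts on both sides of `x`, against `Φ` and `Φ - 1`, which vanish at `-∞` and `∞`
  have p1 := integral_Iic_mul_deriv_eq_deriv_mul (a := x) (fun t _ => hΦ t) (fun t _ => hf t)
    (hk.integrableOn.congr_fun e1 measurableSet_Iic) hφf.integrableOn
    ((hΦc.mul hfc).continuousAt.tendsto.mono_left nhdsWithin_le_nhds)
    (lim (by
      filter_upwards [Filter.eventually_le_atBot (0 : ℝ)] with t ht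
      rw [Complex.norm_real, Real.norm_of_nonneg (gaussCdf_nonneg t)]
      exact gaussCdf_le_exp ht) tendsto_exp_neg_abs_atBot)
  have p2 := integral_Ioi_mul_deriv_eq_deriv_mul (a := x) (fun t _ => hΦ1 t) (fun t _ => hf t)
    (hk.integrableOn.congr_fun e2 measurableSet_Ioi) hφf.integrableOn
    (((hΦc.sub continuous_const).mul hfc).continuousAt.tendsto.mono_left nhdsWithin_le_nhds)
    (lim (by
      filter_upwards [Filter.eventually_ge_atTop (0 : ℝ)] with t ht
      have : (gaussCdf t : ℂ) - 1 = ((-(1 - gaussCdf t) : ℝ) : ℂ) := by push_cast; ring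
      rw [this, Complex.norm_real, norm_neg,
        Real.norm_of_nonneg (by linarith [gaussCdf_le_one t])]
      exact one_sub_gaussCdf_le_exp ht) tendsto_exp_neg_abs_atTop)
  rw [← integral_add_compl measurableSet_Iic hk, Set.compl_Iic,
    setIntegral_congr_fun measurableSet_Iic e1, setIntegral_congr_fun measurableSet_Ioi e2, p1, p2,
    integral_gaussianReal_eq_integral_smul one_ne_zero]
  have hsum := integral_add_compl (measurableSet_Iic (a := x)) hφf
  rw [Set.compl_Iic] at hsum
  simp only [Complex.real_smul]
  rw [← hsum]
  simp only [Pi.mul_apply, Pi.sub_apply]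
  ring

/-! ### Representation of functions of several Gaussian variables -/

section Representation

variable {m : ℕ}

/-- A product measure as an iterated measure, with one coordinate split off. The value of that
coordinate in the second factor is discarded, so any probability measure may stand there. -/
theorem measurePreserving_update {μ μ' : Fin m → Measure ℝ} [∀ j, SigmaFinite (μ j)]
    [∀ j, SigmaFinite (μ' j)] (i : Fin m) [IsProbabilityMeasure (μ i)]
    (h : ∀ j ≠ i, μ' j = μ j) :
    MeasurePreserving (fun q : ℝ × (Fin m → ℝ) => Function.update q.2 i q.1)
      ((μ' i).prod (Measure.pi μ)) (Measure.pi μ') := by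
  have hmeas : Measurable fun q : ℝ × (Fin m → ℝ) => Function.update q.2 i q.1 :=
    measurable_update'.comp measurable_swap
  refine ⟨hmeas, (Measure.pi_eq fun s hs => ?_).symm⟩
  have hpre : (fun q : ℝ × (Fin m → ℝ) => Function.update q.2 i q.1) ⁻¹' Set.univ.pi s
      = s i ×ˢ Set.univ.pi (Function.update s i Set.univ) := by
    ext ⟨x, t⟩
    simp only [Set.mem_preimage, Set.mem_pi, Set.mem_univ, true_imp_iff, Set.mem_prod]
    constructor
    · refine fun hq => ⟨by simpa using hq i, fun j => ?_⟩
      by_cases hj : j = i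
      · subst hj; simp
      · simpa [hj] using hq j
    · rintro ⟨hx, ht⟩ j
      by_cases hj : j = i
      · subst hj; simpa using hx
      · simpa [hj] using ht j
  rw [Measure.map_apply hmeas (.univ_pi hs), hpre, Measure.prod_prod, Measure.pi_pi,
    ← Finset.mul_prod_erase Finset.univ (fun j => μ' j (s j)) (Finset.mem_univ i),
    ← Finset.mul_prod_erase Finset.univ _ (Finset.mem_univ i), Function.update_self, measure_univ,
    one_mul]
  congr 1
  refine Finset.prod_congr rfl fun j hj => ?_
  rw [Function.update_of_ne (Finset.ne_of_mem_erase hj), h j (Finset.ne_of_mem_erase hj)]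

open Classical in
/-- Lebesgue measure in the coordinates of `u` and the standard normal distribution in the
others. -/
def coordMeasure (u : Finset (Fin m)) (j : Fin m) : Measure ℝ := if j ∈ u then volume else stdGauss

instance (u : Finset (Fin m)) (j : Fin m) : SigmaFinite (coordMeasure u j) := by
  unfold coordMeasure; split_ifs <;> infer_instance

theorem coordMeasure_of_mem {u : Finset (Fin m)} {j : Fin m} (h : j ∈ u) :
    coordMeasure u j = volume := if_pos h

theorem coordMeasure_of_notMem {u : Finset (Fin m)} {j : Fin m} (h : j ∉ u) :
    coordMeasure u j = stdGauss := if_neg h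

/-- The product of the measures `coordMeasure u`. -/
def mixedMeasure (u : Finset (Fin m)) : Measure (Fin m → ℝ) := Measure.pi (coordMeasure u)

theorem measurable_prod_repKernel (u : Finset (Fin m)) (ξ : Fin m → ℝ) :
    Measurable fun t : Fin m → ℝ => ∏ j ∈ u, repKernel (ξ j) (t j) :=
  Finset.measurable_prod _ fun j _ =>
    measurable_repKernel.comp (measurable_const.prodMk (measurable_pi_apply j))

variable {F : Finset (Fin m) → (Fin m → ℝ) → ℂ} {b : Fin m → ℝ} {D : Finset (Fin m) → ℝ}

/-- The integrand is dominated by a product of functions of one variable. -/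
theorem integrable_mul_prod_repKernel (hF : IsMixedFamily F) (hb : ∀ j, 0 ≤ b j)
    (hD : ∀ u ξ, ‖F u ξ‖ ≤ D u * Real.exp (∑ j, b j * |ξ j|)) (S u : Finset (Fin m))
    (ξ : Fin m → ℝ) :
    Integrable (fun t => F u (S.piecewise t ξ) * (∏ j ∈ u, repKernel (ξ j) (t j) : ℝ))
      (mixedMeasure u) := by
  classical
  have hD0 : 0 ≤ D u := by simpa using (norm_nonneg _).trans (hD u 0)
  set h : Fin m → ℝ → ℝ := fun j t => Real.exp (b j * |ξ j|) *
    (Real.exp (b j * |t|) * if j ∈ u then |repKernel (ξ j) t| else 1) with hh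
  have hint : ∀ j, Integrable (h j) (coordMeasure u j) := fun j => by
    refine Integrable.const_mul ?_ _
    by_cases hj : j ∈ u
    · simp only [if_pos hj, coordMeasure_of_mem hj]
      refine ((integrable_exp_abs_mul_exp (b j)).const_mul (Real.exp (ξ j ^ 2 / 2))).mono' ?_
        (.of_forall fun t => ?_)
      · have : Measurable fun t => repKernel (ξ j) t := measurable_repKernel.comp measurable_prodMk_left
        fun_prop
      · rw [Real.norm_of_nonneg (by positivity)]
        calc Real.exp (b j * |t|) * |repKernel (ξ j) t|
            ≤ Real.exp (b j * |t|) * (Real.exp (ξ j ^ 2 / 2) * Real.exp (-t ^ 2 / 2)) :=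
              mul_le_mul_of_nonneg_left (abs_repKernel_le _ _) (Real.exp_nonneg _)
          _ = _ := by ring
    · simp only [if_neg hj, mul_one, coordMeasure_of_notMem hj]
      exact integrable_exp_abs_gauss _
  have hpi : Integrable (fun t => D u * ∏ j, h j (t j)) (mixedMeasure u) :=
    (Integrable.fintype_prod hint).const_mul _
  have hpw : Measurable fun t : Fin m → ℝ => S.piecewise t ξ :=
    measurable_pi_lambda _ fun j => by
      by_cases hj : j ∈ S
      · simpa [Finset.piecewise, hj] using measurable_pi_apply j
      · simp [Finset.piecewise, hj]
  refine hpi.mono' (((hF.1 u).measurable.comp hpw).mul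
    (Complex.measurable_ofReal.comp (measurable_prod_repKernel u ξ))).aestronglyMeasurable
    (.of_forall fun t => ?_)
  have e : ∏ j, h j (t j) = Real.exp (∑ j, (b j * |ξ j| + b j * |t j|)) *
      ∏ j ∈ u, |repKernel (ξ j) (t j)| := by
    have e' : ∏ j ∈ u, |repKernel (ξ j) (t j)|
        = ∏ j, if j ∈ u then |repKernel (ξ j) (t j)| else 1 := by simp
    rw [Real.exp_sum, e', ← Finset.prod_mul_distrib]
    refine Finset.prod_congr rfl fun j _ => ?_
    simp only [hh]
    rw [Real.exp_add]; ring
  rw [norm_mul, Complex.norm_real, Real.norm_eq_abs, Finset.abs_prod, e, ← mul_assoc]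
  refine mul_le_mul_of_nonneg_right ((hD u _).trans (mul_le_mul_of_nonneg_left
    (Real.exp_le_exp.2 (Finset.sum_le_sum fun j _ => ?_)) hD0))
    (Finset.prod_nonneg fun j _ => abs_nonneg _)
  have h1 : 0 ≤ b j * |ξ j| := mul_nonneg (hb j) (abs_nonneg _)
  have h2 : 0 ≤ b j * |t j| := mul_nonneg (hb j) (abs_nonneg _)
  by_cases hj : j ∈ S
  · simp only [Finset.piecewise, hj, if_true]; linarith
  · simp only [Finset.piecewise, hj, if_false]; linarith

/-- One coordinate of a function of several variables is replaced by its Gaussian mean, at the cost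
of an integral of the derivative in that coordinate. -/
theorem eq_integral_update (hF : IsMixedFamily F)
    (hD : ∀ u ξ, ‖F u ξ‖ ≤ D u * Real.exp (∑ j, b j * |ξ j|)) {u : Finset (Fin m)} {i : Fin m}
    (hi : i ∉ u) (ζ : Fin m → ℝ) :
    F u ζ = (∫ s, F u (Function.update ζ i s) ∂stdGauss)
      + ∫ s, F (insert i u) (Function.update ζ i s) * repKernel (ζ i) s := by
  set E : ℝ := Real.exp (∑ j ∈ Finset.univ.erase i, b j * |ζ j|) with hE
  have hb : ∀ w s, ‖F w (Function.update ζ i s)‖ ≤ D w * E * Real.exp (b i * |s|) := fun w s => by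
    refine (hD w _).trans_eq ?_
    rw [← Finset.add_sum_erase _ _ (Finset.mem_univ i), Function.update_self, Real.exp_add,
      Finset.sum_congr rfl fun j hj => by rw [Function.update_of_ne (Finset.ne_of_mem_erase hj)]]
    ring
  have hD0 : ∀ w, 0 ≤ D w := fun w => by simpa using (norm_nonneg _).trans (hD w 0)
  have h := eq_integral_add_integral_repKernel (f := fun s => F u (Function.update ζ i s))
    (f' := fun s => F (insert i u) (Function.update ζ i s)) (D := (D u + D (insert i u)) * E)
    (b := b i) (fun s => ?_) ((hF.1 _).comp (by fun_prop)) (fun s => ?_) (fun s => ?_) (ζ i)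
  · simpa only [Function.update_eq_self] using h
  · have := hF.2 u i hi (Function.update ζ i s)
    simpa only [Function.update_idem, Function.update_self] using this
  · refine (hb u s).trans ?_
    gcongr
    linarith [hD0 (insert i u)]
  · refine (hb _ s).trans ?_
    gcongr
    linarith [hD0 u]

/-- A function of several Gaussian variables in terms of its mixed first derivatives: the coordinates
of `S` are integrated out one at a time, the others being frozen at `ξ`. -/
theorem eq_sum_integral_repKernel (hF : IsMixedFamily F) (hb : ∀ j, 0 ≤ b j)
    (hD : ∀ u ξ, ‖F u ξ‖ ≤ D u * Real.exp (∑ j, b j * |ξ j|)) (ξ : Fin m → ℝ)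
    (S : Finset (Fin m)) :
    F ∅ ξ = ∑ u ∈ S.powerset, ∫ t, F u (S.piecewise t ξ) * (∏ j ∈ u, repKernel (ξ j) (t j) : ℝ)
      ∂mixedMeasure u := by
  induction S using Finset.induction_on with
  | empty =>
    have : IsProbabilityMeasure (mixedMeasure (∅ : Finset (Fin m))) := by
      have : ∀ j, IsProbabilityMeasure (coordMeasure (∅ : Finset (Fin m)) j) := fun j => by
        rw [coordMeasure_of_notMem (Finset.notMem_empty j)]; infer_instance
      unfold mixedMeasure; infer_instance
    simp
  | insert i S hi ih =>
    rw [ih, Finset.sum_powerset_insert hi, ← Finset.sum_add_distrib]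
    refine Finset.sum_congr rfl fun u hu => ?_
    have hiu : i ∉ u := fun h => hi (Finset.mem_powerset.1 hu h)
    have hpw : ∀ t s, Function.update (S.piecewise t ξ) i s
        = (insert i S).piecewise (Function.update t i s) ξ := fun t s => by
      ext j
      by_cases hj : j = i
      · subst hj; simp
      · simp [Finset.piecewise, hj]
    have : IsProbabilityMeasure (coordMeasure u i) := by
      rw [coordMeasure_of_notMem hiu]; infer_instance
    have mp1 := measurePreserving_update (μ := coordMeasure u) (μ' := coordMeasure u) i
      fun _ _ => rfl
    have mp2 := measurePreserving_update (μ := coordMeasure u) (μ' := coordMeasure (insert i u)) i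
      fun j hj => by simp [coordMeasure, hj]
    rw [coordMeasure_of_notMem hiu] at mp1
    rw [coordMeasure_of_mem (Finset.mem_insert_self i u)] at mp2
    have i1 := integrable_mul_prod_repKernel hF hb hD (insert i S) u ξ
    have i2 := integrable_mul_prod_repKernel hF hb hD (insert i S) (insert i u) ξ
    have k1 : ∀ (t : Fin m → ℝ) (s : ℝ), ∏ j ∈ u, repKernel (ξ j) (Function.update t i s j)
        = ∏ j ∈ u, repKernel (ξ j) (t j) := fun t s =>
      Finset.prod_congr rfl fun j hj => by
        rw [Function.update_of_ne (ne_of_mem_of_not_mem hj hiu)]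
    have j1 := mp1.integrable_comp_of_integrable i1
    have j2 := mp2.integrable_comp_of_integrable i2
    have c1 := integral_map (μ := stdGauss.prod (Measure.pi (coordMeasure u)))
      mp1.measurable.aemeasurable (by rw [mp1.map_eq]; exact i1.aestronglyMeasurable)
    have c2 := integral_map (μ := volume.prod (Measure.pi (coordMeasure u)))
      mp2.measurable.aemeasurable (by rw [mp2.map_eq]; exact i2.aestronglyMeasurable)
    rw [mp1.map_eq] at c1
    rw [mp2.map_eq] at c2
    have r1 := c1.trans (integral_prod_symm _ j1)
    have r2 := c2.trans (integral_prod_symm _ j2)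
    rw [mixedMeasure, mixedMeasure, r1, r2]
    refine Eq.trans ?_ (integral_add j1.integral_prod_right j2.integral_prod_right)
    refine integral_congr_ae (.of_forall fun t => ?_)
    have hζ : S.piecewise t ξ i = ξ i := by simp [Finset.piecewise, hi]
    have h := eq_integral_update hF hD hiu (S.piecewise t ξ)
    simp only [hpw, hζ] at h
    simp only [k1, Finset.prod_insert hiu, Function.update_self]
    rw [h, add_mul, ← integral_mul_const, ← integral_mul_const]
    congr 1
    refine integral_congr_ae (.of_forall fun s => ?_)
    simp only
    push_cast
    ring

end Representation

/-! ### Averages of the representation kernel over a random shift -/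

/-- The integral kernel of the squared weighted `L²` norm of a combination of representation
kernels. -/
def pairKernel (θ x y : ℝ) : ℝ := ∫ t, repKernel x t * repKernel y t / weightFun θ t ^ 2

theorem weightFun_pos (θ t : ℝ) : 0 < weightFun θ t := Real.exp_pos _

theorem continuous_weightFun (θ : ℝ) : Continuous (weightFun θ) := by
  unfold weightFun; fun_prop

theorem inv_weightFun_sq (θ t : ℝ) : (weightFun θ t ^ 2)⁻¹ = Real.exp (2 * θ * |t|) := by
  rw [weightFun, ← Real.exp_nat_mul, ← Real.exp_neg]; push_cast; ring_nf

theorem measurable_repKernel_right (x : ℝ) : Measurable (repKernel x) :=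
  measurable_repKernel.comp measurable_prodMk_left

theorem integrable_pairKernel (θ x y : ℝ) :
    Integrable fun t => repKernel x t * repKernel y t / weightFun θ t ^ 2 := by
  refine ((integrable_exp_abs_mul_exp (2 * θ)).const_mul (Real.exp (x ^ 2 / 2))).mono'
    (((measurable_repKernel_right x).mul (measurable_repKernel_right y)).div
      ((continuous_weightFun θ).measurable.pow_const 2)).aestronglyMeasurable
    (.of_forall fun t => ?_)
  rw [div_eq_mul_inv, inv_weightFun_sq, norm_mul, norm_mul, Real.norm_eq_abs, Real.norm_eq_abs,
    Real.norm_of_nonneg (Real.exp_nonneg _)]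
  calc |repKernel x t| * |repKernel y t| * Real.exp (2 * θ * |t|)
      ≤ (Real.exp (x ^ 2 / 2) * Real.exp (-t ^ 2 / 2)) * 1 * Real.exp (2 * θ * |t|) := by
        gcongr
        · exact abs_repKernel_le x t
        · exact abs_repKernel_le_one y t
    _ = _ := by ring

/-- The periodic function `y ↦ c - 1_{frac y < c}`; for `c = Φ(t)` it is the representation kernel
with its first argument mapped to the unit interval. -/
def sawtooth (c y : ℝ) : ℝ := c - if Int.fract y < c then 1 else 0

theorem measurable_sawtooth (c : ℝ) : Measurable (sawtooth c) :=
  measurable_const.sub (Measurable.ite (measurableSet_lt measurable_fract measurable_const)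
    measurable_const measurable_const)

theorem sawtooth_periodic (c : ℝ) : Function.Periodic (sawtooth c) 1 := fun y => by
  simp [sawtooth]

theorem abs_sawtooth_le {c : ℝ} (h0 : 0 ≤ c) (h1 : c ≤ 1) (y : ℝ) : |sawtooth c y| ≤ 1 := by
  rw [sawtooth, abs_le]
  split_ifs <;> constructor <;> linarith

/-- The autocorrelation of the centred indicator function of `[0, c)` modulo `1`. -/
theorem integral_sawtooth_mul {c : ℝ} (h0 : 0 ≤ c) (h1 : c ≤ 1) {f : ℝ} (hf : f ∈ Set.Ico (0 : ℝ) 1) :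
    ∫ x in (0 : ℝ)..1, sawtooth c (f + x) * sawtooth c x
      = max (c - f) 0 + max (c - 1 + f) 0 - c ^ 2 := by
  have hJ : ∀ (a b : ℝ), (∫ x in Set.Ico (0 : ℝ) 1, (Set.Ico a b).indicator (fun _ => (1 : ℝ)) x)
      = max (min b 1 - max a 0) 0 := fun a b => by
    rw [integral_indicator measurableSet_Ico, Measure.restrict_restrict measurableSet_Ico,
      setIntegral_const, Set.Ico_inter_Ico, smul_eq_mul, mul_one, Real.volume_real_Ico]
  have hI : ∀ (a b : ℝ), Integrable ((Set.Ico a b).indicator fun _ => (1 : ℝ))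
      (volume.restrict (Set.Ico (0 : ℝ) 1)) := fun a b =>
    (integrable_const (1 : ℝ)).indicator measurableSet_Ico
  have hpt : ∀ x ∈ Set.Ico (0 : ℝ) 1, sawtooth c (f + x) * sawtooth c x
      = c ^ 2 - c * (Set.Ico (-f) (c - f)).indicator (fun _ => (1 : ℝ)) x
        - c * (Set.Ico (1 - f) (1 - f + c)).indicator (fun _ => (1 : ℝ)) x
        - c * (Set.Ico 0 c).indicator (fun _ => (1 : ℝ)) x
        + (Set.Ico 0 (c - f)).indicator (fun _ => (1 : ℝ)) x
        + (Set.Ico (1 - f) c).indicator (fun _ => (1 : ℝ)) x := by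
    rintro x ⟨hx0, hx1⟩
    obtain ⟨hf0, hf1⟩ := hf
    have e1 : Int.fract x = x := Int.fract_eq_self.2 ⟨hx0, hx1⟩
    have i3 : x ∈ Set.Ico 0 c ↔ x < c := ⟨fun h => h.2, fun h => ⟨hx0, h⟩⟩
    by_cases hfx : f + x < 1
    · have e2 : Int.fract (f + x) = f + x := Int.fract_eq_self.2 ⟨by linarith, hfx⟩
      have i1 : x ∈ Set.Ico (-f) (c - f) ↔ f + x < c := by
        rw [Set.mem_Ico]; constructor <;> intros <;> (try constructor) <;> linarith
      have i2 : x ∉ Set.Ico (1 - f) (1 - f + c) := fun h => by linarith [h.1]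
      have i4 : x ∈ Set.Ico 0 (c - f) ↔ f + x < c := by
        rw [Set.mem_Ico]; constructor <;> intros <;> (try constructor) <;> linarith
      have i5 : x ∉ Set.Ico (1 - f) c := fun h => by linarith [h.1]
      simp only [sawtooth, e1, e2, Set.indicator_apply, i1, i2, i3, i4, i5, if_false]
      by_cases hc : f + x < c
      · rw [if_pos hc, if_pos (by linarith : x < c)]; ring
      · rw [if_neg hc]; ring
    · have e2 : Int.fract (f + x) = f + x - 1 := by
        rw [← Int.fract_sub_one, Int.fract_eq_self]; constructor <;> linarith
      have i1 : x ∉ Set.Ico (-f) (c - f) := fun h => by linarith [h.2]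
      have i2 : x ∈ Set.Ico (1 - f) (1 - f + c) ↔ f + x - 1 < c := by
        rw [Set.mem_Ico]; constructor <;> intros <;> (try constructor) <;> linarith
      have i4 : x ∉ Set.Ico 0 (c - f) := fun h => by linarith [h.2]
      have i5 : x ∈ Set.Ico (1 - f) c ↔ x < c := by
        rw [Set.mem_Ico]; constructor <;> intros <;> (try constructor) <;> linarith
      simp only [sawtooth, e1, e2, Set.indicator_apply, i1, i2, i3, i4, i5, if_false]
      by_cases hc : x < c
      · rw [if_pos hc, if_pos (by linarith : f + x - 1 < c)]; ring
      · rw [if_neg hc]; ring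
  rw [intervalIntegral.integral_of_le zero_le_one, ← integral_Ico_eq_integral_Ioc,
    setIntegral_congr_fun measurableSet_Ico hpt, integral_add, integral_add, integral_sub,
    integral_sub, integral_sub, integral_const_mul, integral_const_mul, integral_const_mul,
    hJ, hJ, hJ, hJ, hJ]
  · obtain ⟨hf0, hf1⟩ := hf
    have m1 : max (min (c - f) 1 - max (-f) 0) 0 = max (c - f) 0 := by
      rw [max_eq_right (by linarith : -f ≤ 0), min_eq_left (by linarith), sub_zero]
    have m2 : max (min (1 - f + c) 1 - max (1 - f) 0) 0 = min c f := by
      rw [max_eq_left (by linarith : 0 ≤ 1 - f)]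
      rcases le_total c f with h | h
      · rw [min_eq_left (by linarith), min_eq_left h, max_eq_left (by linarith)]; ring
      · rw [min_eq_right (by linarith), min_eq_right h, max_eq_left (by linarith)]; ring
    have m3 : max (min c 1 - max 0 0) 0 = c := by
      rw [max_self, sub_zero, min_eq_left h1, max_eq_left h0]
    have m4 : max (min (c - f) 1 - max 0 0) 0 = max (c - f) 0 := by
      rw [max_self, sub_zero, min_eq_left (by linarith)]
    have m5 : max (min c 1 - max (1 - f) 0) 0 = max (c - 1 + f) 0 := by
      rw [min_eq_left h1, max_eq_left (by linarith : 0 ≤ 1 - f)]; ring_nf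
    have m6 : max (c - f) 0 + min c f = c := by
      rcases le_total c f with h | h
      · rw [max_eq_right (by linarith), min_eq_left h, zero_add]
      · rw [max_eq_left (by linarith), min_eq_right h]; ring
    rw [m1, m2, m3, m4, m5, setIntegral_const]
    simp only [Real.volume_real_Ico, smul_eq_mul, sub_zero, max_eq_left zero_le_one, one_mul]
    linear_combination (-c) * m6
  all_goals fun_prop (disch := assumption)

/-- The average over a shift of the pointwise product of two representation kernels. -/
theorem integral_sawtooth_add {c : ℝ} (h0 : 0 ≤ c) (h1 : c ≤ 1) (a a' : ℝ) :
    ∫ x in Set.Icc (0 : ℝ) 1, sawtooth c (a + x) * sawtooth c (a' + x)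
      = max (c - Int.fract (a - a')) 0 + max (c - 1 + Int.fract (a - a')) 0 - c ^ 2 := by
  rw [← integral_sawtooth_mul h0 h1 ⟨Int.fract_nonneg _, Int.fract_lt_one (a - a')⟩,
    integral_Icc_eq_integral_Ioc, ← intervalIntegral.integral_of_le zero_le_one]
  have hp : ∀ r : ℝ, Function.Periodic (fun x => sawtooth c (r + x) * sawtooth c x) 1 := fun r x => by
    simp only [← add_assoc, sawtooth_periodic c _]
  have h2 := intervalIntegral.integral_comp_add_left
    (fun x => sawtooth c (a - a' + x) * sawtooth c x) (a := 0) (b := 1) a'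
  have h3 := (hp (a - a')).intervalIntegral_add_eq a' 0
  rw [add_zero, h3, zero_add] at h2
  have h4 : ∀ x, sawtooth c (Int.fract (a - a') + x) = sawtooth c (a - a' + x) := fun x => by
    rw [Int.fract, sub_add_eq_add_sub, sawtooth, Int.fract_sub_intCast, ← sawtooth]
  simp only [h4, ← h2]
  congr 1; funext x; congr 2; ring

/-- If `y` is an integer, `gaussInv (Int.fract y)` is a junk value and the identity fails; this is a null
set of shifts. -/
theorem repKernel_gaussInv_fract {y : ℝ} (hy : Int.fract y ≠ 0) (t : ℝ) :
    repKernel (gaussInv (Int.fract y)) t = sawtooth (gaussCdf t) y := by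
  have h : Int.fract y ∈ Set.Ioo (0 : ℝ) 1 :=
    ⟨lt_of_le_of_ne (Int.fract_nonneg y) (Ne.symm hy), Int.fract_lt_one y⟩
  rw [repKernel, sawtooth]
  simp only [gaussInv_lt_iff h]

theorem ae_fract_add_ne_zero (a : ℝ) : ∀ᵐ x : ℝ, Int.fract (a + x) ≠ 0 := by
  have : {x : ℝ | Int.fract (a + x) = 0} ⊆ Set.range fun n : ℤ => (n : ℝ) - a := by
    intro x hx
    refine ⟨⌊a + x⌋, ?_⟩
    have : a + x - ⌊a + x⌋ = 0 := hx
    simp only; linarith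
  have := ((Set.countable_range _).mono this).ae_notMem volume
  simpa using this

theorem gaussCdf_sub_sq_le (t : ℝ) : gaussCdf t - gaussCdf t ^ 2 ≤ Real.exp (-t ^ 2 / 2) := by
  have h0 := gaussCdf_nonneg t
  have h1 := gaussCdf_le_one t
  rcases le_total t 0 with ht | ht
  · nlinarith [gaussCdf_le_exp ht]
  · nlinarith [one_sub_gaussCdf_le_exp ht]

/-- The average of the kernel `pairKernel` over a random shift is the shift-invariant kernel. -/
theorem integral_pairKernel_shift (θ a a' : ℝ) :
    Integrable (fun x => pairKernel θ (gaussInv (Int.fract (a + x))) (gaussInv (Int.fract (a' + x))))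
        (volume.restrict (Set.Icc 0 1)) ∧
      ∫ x in Set.Icc 0 1, pairKernel θ (gaussInv (Int.fract (a + x)))
        (gaussInv (Int.fract (a' + x))) = shiftKernel θ (Int.fract (a - a')) := by
  set ν : Measure ℝ := volume.restrict (Set.Icc 0 1) with hν
  have hm : ∀ a : ℝ, Measurable fun q : ℝ × ℝ => repKernel (gaussInv (Int.fract (a + q.1))) q.2 :=
    fun a => measurable_repKernel.comp (((measurable_gaussInv.comp (measurable_fract.comp
      (measurable_const.add measurable_fst)))).prodMk measurable_snd)
  set g : ℝ × ℝ → ℝ := fun q => repKernel (gaussInv (Int.fract (a + q.1))) q.2 *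
    repKernel (gaussInv (Int.fract (a' + q.1))) q.2 / weightFun θ q.2 ^ 2 with hg
  have hgm : Measurable g := ((hm a).mul (hm a')).div
    (((continuous_weightFun θ).measurable.comp measurable_snd).pow_const 2)
  have hae : ∀ a : ℝ, ∀ t : ℝ, ∀ᵐ x ∂ν,
      repKernel (gaussInv (Int.fract (a + x))) t = sawtooth (gaussCdf t) (a + x) := fun a t => by
    filter_upwards [ae_restrict_of_ae (ae_fract_add_ne_zero a)] with x hx
    exact repKernel_gaussInv_fract hx t
  have hgi : ∀ t, (∫ x, g (x, t) ∂ν) = (max (gaussCdf t - Int.fract (a - a')) 0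
      + max (gaussCdf t - 1 + Int.fract (a - a')) 0 - gaussCdf t ^ 2) / weightFun θ t ^ 2 := fun t => by
    rw [← integral_sawtooth_add (gaussCdf_nonneg t) (gaussCdf_le_one t) a a', ← integral_div]
    refine integral_congr_ae ?_
    filter_upwards [hae a t, hae a' t] with x h1 h2
    simp only [hg, h1, h2]
  have hsq : ∀ a t, ∫ x, sawtooth (gaussCdf t) (a + x) ^ 2 ∂ν = gaussCdf t - gaussCdf t ^ 2 :=
    fun a t => by
    have := integral_sawtooth_add (gaussCdf_nonneg t) (gaussCdf_le_one t) a a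
    simp only [← sq, sub_self, Int.fract_zero, sub_zero, add_zero] at this
    rw [this, max_eq_left (gaussCdf_nonneg t), max_eq_right (by linarith [gaussCdf_le_one t])]
    ring
  have hsi : ∀ a t, Integrable (fun x => sawtooth (gaussCdf t) (a + x) ^ 2) ν := fun a t => by
    refine Integrable.of_bound (((measurable_sawtooth _).comp
      (measurable_const.add measurable_id)).pow_const 2).aestronglyMeasurable 1
      (.of_forall fun x => ?_)
    rw [norm_pow, Real.norm_eq_abs]
    exact pow_le_one₀ (abs_nonneg _) (abs_sawtooth_le (gaussCdf_nonneg t) (gaussCdf_le_one t) _)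
  -- `|k k'| ≤ (k² + k'²) / 2`; the mean of `k²` over the shifts is `Φ(t) - Φ(t)²`, which decays fast
  -- enough for Fubini's theorem
  have hbd : ∀ t, ∀ᵐ x ∂ν, ‖g (x, t)‖ ≤ (sawtooth (gaussCdf t) (a + x) ^ 2
      + sawtooth (gaussCdf t) (a' + x) ^ 2) / 2 * Real.exp (2 * θ * |t|) := fun t => by
    filter_upwards [hae a t, hae a' t] with x h1 h2
    simp only [hg, h1, h2]
    rw [div_eq_mul_inv, inv_weightFun_sq, norm_mul, norm_mul, Real.norm_of_nonneg (Real.exp_nonneg _)]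
    refine mul_le_mul_of_nonneg_right ?_ (Real.exp_nonneg _)
    simp only [Real.norm_eq_abs]
    rw [← sq_abs (sawtooth _ (a + x)), ← sq_abs (sawtooth _ (a' + x))]
    nlinarith [sq_nonneg (|sawtooth (gaussCdf t) (a + x)| - |sawtooth (gaussCdf t) (a' + x)|)]
  have hmaj : ∀ t, Integrable (fun x => (sawtooth (gaussCdf t) (a + x) ^ 2
      + sawtooth (gaussCdf t) (a' + x) ^ 2) / 2 * Real.exp (2 * θ * |t|)) ν := fun t =>
    (((hsi a t).add (hsi a' t)).div_const 2).mul_const _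
  have hsec : ∀ t, Integrable (fun x => g (x, t)) ν := fun t =>
    (hmaj t).mono' (hgm.comp measurable_prodMk_right).aestronglyMeasurable (hbd t)
  have hint : Integrable g (ν.prod volume) := by
    rw [integrable_prod_iff' hgm.aestronglyMeasurable]
    refine ⟨.of_forall hsec, ?_⟩
    refine (integrable_exp_abs_mul_exp (2 * θ)).mono'
      hgm.norm.stronglyMeasurable.integral_prod_left'.aestronglyMeasurable (.of_forall fun t => ?_)
    rw [Real.norm_of_nonneg (integral_nonneg fun x => norm_nonneg _)]
    refine (integral_mono_ae (hsec t).norm (hmaj t) (hbd t)).trans ?_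
    rw [integral_mul_const, integral_div, integral_add (hsi a t) (hsi a' t), hsq, hsq, mul_comm]
    refine mul_le_mul_of_nonneg_left ?_ (Real.exp_nonneg _)
    linarith [gaussCdf_sub_sq_le t]
  refine ⟨hint.integral_prod_left, ?_⟩
  have := integral_integral_swap (f := fun x t => g (x, t)) hint
  simp only [hgi] at this
  exact this

/-! ### The mean square error of a randomly shifted lattice rule -/

/-- The Cauchy-Schwarz inequality. -/
theorem sq_integral_mul_le {α : Type*} {mα : MeasurableSpace α} {μ : Measure α} {f g : α → ℝ}
    (hf : MemLp f 2 μ) (hg : MemLp g 2 μ) (hf0 : ∀ x, 0 ≤ f x) (hg0 : ∀ x, 0 ≤ g x) :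
    (∫ x, f x * g x ∂μ) ^ 2 ≤ (∫ x, f x ^ 2 ∂μ) * ∫ x, g x ^ 2 ∂μ := by
  have h := integral_mul_le_Lp_mul_Lq_of_nonneg (μ := μ) Real.HolderConjugate.two_two
    (.of_forall hf0) (.of_forall hg0) (by simpa using hf) (by simpa using hg)
  simp only [Real.rpow_two, ← Real.sqrt_eq_rpow] at h
  refine (pow_le_pow_left₀ (integral_nonneg fun x => mul_nonneg (hf0 x) (hg0 x)) h 2).trans_eq ?_
  rw [mul_pow, Real.sq_sqrt (integral_nonneg fun x => sq_nonneg _),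
    Real.sq_sqrt (integral_nonneg fun x => sq_nonneg _)]

section ErrorBound

variable {m : ℕ}

open Classical in
/-- A product of functions of one variable factors with respect to the mixed measure. -/
theorem integrable_prod_ite {u : Finset (Fin m)} {f g : Fin m → ℝ → ℝ}
    (hf : ∀ j, Integrable (f j)) (hg : ∀ j, Integrable (g j) stdGauss) :
    Integrable (fun t : Fin m → ℝ => ∏ j, if j ∈ u then f j (t j) else g j (t j))
        (mixedMeasure u) ∧
      ∫ t, (∏ j, if j ∈ u then f j (t j) else g j (t j)) ∂mixedMeasure u
        = ∏ j, if j ∈ u then ∫ t, f j t else ∫ t, g j t ∂stdGauss := by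
  set h : Fin m → ℝ → ℝ := fun j t => if j ∈ u then f j t else g j t with hh
  have hi : ∀ j, Integrable (h j) (coordMeasure u j) ∧
      ∫ t, h j t ∂coordMeasure u j = if j ∈ u then ∫ t, f j t else ∫ t, g j t ∂stdGauss := fun j => by
    by_cases hj : j ∈ u
    · simp only [hh, hj, if_true, coordMeasure_of_mem hj]; exact ⟨hf j, trivial⟩
    · simp only [hh, hj, if_false, coordMeasure_of_notMem hj]; exact ⟨hg j, trivial⟩
  refine ⟨Integrable.fintype_prod fun j => (hi j).1, ?_⟩
  rw [Finset.prod_congr rfl fun j _ => (hi j).2.symm]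
  exact integral_fintype_prod_eq_prod h

theorem integrable_prod_pairKernel (u : Finset (Fin m)) (θ x y : Fin m → ℝ) :
    Integrable (fun t : Fin m → ℝ => ∏ j ∈ u, repKernel (x j) (t j) * repKernel (y j) (t j) /
        weightFun (θ j) (t j) ^ 2) (mixedMeasure u) ∧
      ∫ t, (∏ j ∈ u, repKernel (x j) (t j) * repKernel (y j) (t j) /
        weightFun (θ j) (t j) ^ 2) ∂mixedMeasure u = ∏ j ∈ u, pairKernel (θ j) (x j) (y j) := by
  classical
  have h := integrable_prod_ite (u := u)
    (f := fun j t => repKernel (x j) t * repKernel (y j) t / weightFun (θ j) t ^ 2)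
    (g := fun _ _ => 1) (fun j => integrable_pairKernel _ _ _) (fun j => integrable_const 1)
  simpa [pairKernel] using h

variable {F : Finset (Fin m) → (Fin m → ℝ) → ℂ} {b : Fin m → ℝ} {D : Finset (Fin m) → ℝ}

/-- The Cauchy-Schwarz inequality for one term of the representation of the quadrature error. -/
theorem sq_norm_integral_le
    (hD : ∀ u ξ, ‖F u ξ‖ ≤ D u * Real.exp (∑ j, b j * |ξ j|)) {θ : Fin m → ℝ}
    (hb : ∀ j, 0 ≤ b j) (hθ : ∀ j, b j < θ j) (u : Finset (Fin m)) {ι : Type*} (s : Finset ι) (c : ℝ)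
    (x : ι → Fin m → ℝ) :
    ‖∫ t, F u t * (c * ∑ k ∈ s, ∏ j ∈ u, repKernel (x k j) (t j) : ℝ) ∂mixedMeasure u‖ ^ 2
      ≤ (D u ^ 2 * (∏ j ∈ u, 1 / (θ j - b j)) * ∏ j, ∫ t, Real.exp (2 * b j * |t|) ∂stdGauss) *
        (c ^ 2 * ∑ k ∈ s, ∑ k' ∈ s, ∏ j ∈ u, pairKernel (θ j) (x k j) (x k' j)) := by
  classical
  have hD0 : 0 ≤ D u := by simpa using (norm_nonneg _).trans (hD u 0)
  set w : (Fin m → ℝ) → ℝ := fun t => ∏ j ∈ u, weightFun (θ j) (t j) with hw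
  have hw0 : ∀ t, 0 < w t := fun t => Finset.prod_pos fun j _ => weightFun_pos _ _
  have hwm : Measurable w := Finset.measurable_prod _ fun j _ =>
    (continuous_weightFun _).measurable.comp (measurable_pi_apply j)
  set κ : (Fin m → ℝ) → ℝ := fun t => c * ∑ k ∈ s, ∏ j ∈ u, repKernel (x k j) (t j) with hκ
  have hκm : Measurable κ := measurable_const.mul
    (Finset.measurable_sum _ fun k _ => measurable_prod_repKernel u (x k))
  set f : (Fin m → ℝ) → ℝ := fun t => D u * Real.exp (∑ j, b j * |t j|) * w t with hf
  set g : (Fin m → ℝ) → ℝ := fun t => |κ t| / w t with hg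
  have hfm : Measurable f := by
    refine Measurable.mul ?_ hwm
    fun_prop
  have hgm : Measurable g := (continuous_abs.measurable.comp hκm).div hwm
  have hf2 : ∀ t, f t ^ 2 = D u ^ 2 * ∏ j, if j ∈ u then Real.exp (-(2 * (θ j - b j) * |t j|))
      else Real.exp (2 * b j * |t j|) := fun t => by
    have e : w t = ∏ j, if j ∈ u then weightFun (θ j) (t j) else 1 := by simp [hw]
    simp only [hf]
    rw [e, Real.exp_sum, mul_assoc, ← Finset.prod_mul_distrib, mul_pow, ← Finset.prod_pow]
    congr 1
    refine Finset.prod_congr rfl fun j _ => ?_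
    split_ifs
    · rw [weightFun, ← Real.exp_add, ← Real.exp_nat_mul]; congr 1; push_cast; ring
    · rw [mul_one, ← Real.exp_nat_mul]; congr 1; push_cast; ring
  have hg2 : ∀ t, g t ^ 2 = c ^ 2 * ∑ k ∈ s, ∑ k' ∈ s, ∏ j ∈ u,
      repKernel (x k j) (t j) * repKernel (x k' j) (t j) / weightFun (θ j) (t j) ^ 2 := fun t => by
    simp only [hg, hκ, hw]
    rw [div_pow, sq_abs, mul_pow, sq (∑ k ∈ s, _), Finset.sum_mul_sum, mul_div_assoc,
      Finset.sum_div]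
    simp only [Finset.sum_div, ← Finset.prod_pow, ← Finset.prod_mul_distrib,
      ← Finset.prod_div_distrib]
  have hF2 := integrable_prod_ite (u := u) (f := fun j t => Real.exp (-(2 * (θ j - b j) * |t|)))
    (g := fun j t => Real.exp (2 * b j * |t|))
    (fun j => integrable_exp_neg_mul_abs (by linarith [hθ j]))
    (fun j => integrable_exp_abs_gauss _)
  have hfL : MemLp f 2 (mixedMeasure u) := by
    rw [memLp_two_iff_integrable_sq hfm.aestronglyMeasurable]
    simp only [hf2]
    exact hF2.1.const_mul _
  have hpair := fun k k' => integrable_prod_pairKernel u θ (x k) (x k')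
  have hgL : MemLp g 2 (mixedMeasure u) := by
    rw [memLp_two_iff_integrable_sq hgm.aestronglyMeasurable]
    simp only [hg2]
    exact (integrable_finsetSum _ fun k _ => integrable_finsetSum _ fun k' _ =>
      (hpair k k').1).const_mul _
  have hg2i : ∫ t, g t ^ 2 ∂mixedMeasure u
      = c ^ 2 * ∑ k ∈ s, ∑ k' ∈ s, ∏ j ∈ u, pairKernel (θ j) (x k j) (x k' j) := by
    simp only [hg2]
    rw [integral_const_mul, integral_finsetSum _ fun k _ => integrable_finsetSum _ fun k' _ =>
      (hpair k k').1]
    congr 1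
    refine Finset.sum_congr rfl fun k _ => ?_
    rw [integral_finsetSum _ fun k' _ => (hpair k k').1]
    exact Finset.sum_congr rfl fun k' _ => (hpair k k').2
  have hf2i : ∫ t, f t ^ 2 ∂mixedMeasure u ≤ D u ^ 2 * (∏ j ∈ u, 1 / (θ j - b j)) *
      ∏ j, ∫ t, Real.exp (2 * b j * |t|) ∂stdGauss := by
    simp only [hf2]
    rw [integral_const_mul, hF2.2, mul_assoc]
    refine mul_le_mul_of_nonneg_left ?_ (sq_nonneg _)
    -- the moments over the coordinates outside `u` are enlarged to those over all coordinates
    have e : ∏ j ∈ u, 1 / (θ j - b j) = ∏ j, if j ∈ u then 1 / (θ j - b j) else 1 := by simp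
    rw [e, ← Finset.prod_mul_distrib]
    have hM : ∀ j, 1 ≤ ∫ t, Real.exp (2 * b j * |t|) ∂stdGauss := fun j => by
      have := integral_mono (integrable_const (1 : ℝ)) (integrable_exp_abs_gauss (2 * b j))
        fun t => Real.one_le_exp (mul_nonneg (by linarith [hb j]) (abs_nonneg t))
      simpa using this
    refine Finset.prod_le_prod (fun j _ => ?_) fun j _ => ?_
    · split_ifs
      · exact integral_nonneg fun t => Real.exp_nonneg _
      · exact zero_le_one.trans (hM j)
    · split_ifs
      · rw [integral_exp_neg_mul_abs (by linarith [hθ j])]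
        have h0 : 0 < θ j - b j := by linarith [hθ j]
        refine le_of_eq_of_le ?_ (le_mul_of_one_le_right (by positivity) (hM j))
        field_simp
      · rw [one_mul]
  have hle : ‖∫ t, F u t * (κ t : ℝ) ∂mixedMeasure u‖ ≤ ∫ t, f t * g t ∂mixedMeasure u := by
    refine norm_integral_le_of_norm_le (hfL.integrable_mul hgL) (.of_forall fun t => ?_)
    have : f t * g t = D u * Real.exp (∑ j, b j * |t j|) * |κ t| := by
      simp only [hf, hg]
      have := (hw0 t).ne'
      field_simp
    rw [norm_mul, Complex.norm_real, Real.norm_eq_abs, this]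
    exact mul_le_mul_of_nonneg_right (hD u t) (abs_nonneg _)
  calc ‖∫ t, F u t * (κ t : ℝ) ∂mixedMeasure u‖ ^ 2
      ≤ (∫ t, f t * g t ∂mixedMeasure u) ^ 2 := pow_le_pow_left₀ (norm_nonneg _) hle 2
    _ ≤ (∫ t, f t ^ 2 ∂mixedMeasure u) * ∫ t, g t ^ 2 ∂mixedMeasure u :=
        sq_integral_mul_le hfL hgL
          (fun t => mul_nonneg (mul_nonneg hD0 (Real.exp_nonneg _)) (hw0 t).le)
          (fun t => div_nonneg (abs_nonneg _) (hw0 t).le)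
    _ ≤ _ := by
        have h0 : 0 ≤ ∫ t, g t ^ 2 ∂mixedMeasure u := integral_nonneg fun t => sq_nonneg (g t)
        rw [hg2i] at h0 ⊢
        exact mul_le_mul_of_nonneg_right hf2i h0

end ErrorBound

section MeanSquare

variable {m : ℕ} {F : Finset (Fin m) → (Fin m → ℝ) → ℂ} {b : Fin m → ℝ} {D : Finset (Fin m) → ℝ}

theorem uniformCube_eq_pi (m : ℕ) :
    uniformCube m = Measure.pi fun _ : Fin m => volume.restrict (Set.Icc (0 : ℝ) 1) := by
  rw [uniformCube, ← Set.pi_univ_Icc, volume_pi, Measure.restrict_pi_pi]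
  rfl

theorem mixedMeasure_empty (m : ℕ) : mixedMeasure (∅ : Finset (Fin m)) = gaussMeasure m := by
  rw [mixedMeasure, gaussMeasure]
  congr 1

theorem integrable_of_isMixedFamily (hF : IsMixedFamily F) (hb : ∀ j, 0 ≤ b j)
    (hD : ∀ u ξ, ‖F u ξ‖ ≤ D u * Real.exp (∑ j, b j * |ξ j|)) :
    Integrable (F ∅) (gaussMeasure m) := by
  have h := integrable_mul_prod_repKernel hF hb hD Finset.univ ∅ 0
  simpa [mixedMeasure_empty] using h

theorem measurable_latticePoint (N : ℕ) (z : ℕ → ℕ) (k : ℕ) :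
    Measurable fun Δ : Fin m → ℝ => latticePoint N z Δ k :=
  measurable_pi_lambda _ fun j => measurable_gaussInv.comp
    (measurable_fract.comp (measurable_const.add (measurable_pi_apply j)))

/-- The quadrature error as a sum over the mixed first derivatives. -/
theorem qmcError_eq (hF : IsMixedFamily F) (hb : ∀ j, 0 ≤ b j)
    (hD : ∀ u ξ, ‖F u ξ‖ ≤ D u * Real.exp (∑ j, b j * |ξ j|)) {N : ℕ} (hN : 1 ≤ N) (z : ℕ → ℕ)
    (Δ : Fin m → ℝ) :
    qmcError N z (F ∅) Δ = -∑ u ∈ (Finset.univ : Finset (Finset (Fin m))).erase ∅,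
      ∫ t, F u t * (1 / (N : ℝ) * ∑ k ∈ Finset.Icc 1 N,
        ∏ j ∈ u, repKernel (latticePoint N z Δ k j) (t j) : ℝ) ∂mixedMeasure u := by
  have hint := fun u (ξ : Fin m → ℝ) => by
    simpa using integrable_mul_prod_repKernel hF hb hD Finset.univ u ξ
  have hrep : ∀ ξ, F ∅ ξ = (∫ ξ, F ∅ ξ ∂gaussMeasure m) +
      ∑ u ∈ (Finset.univ : Finset (Finset (Fin m))).erase ∅,
        ∫ t, F u t * (∏ j ∈ u, repKernel (ξ j) (t j) : ℝ) ∂mixedMeasure u := fun ξ => by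
    have h := eq_sum_integral_repKernel hF hb hD ξ Finset.univ
    rw [Finset.powerset_univ, ← Finset.add_sum_erase _ _ (Finset.mem_univ ∅),
      mixedMeasure_empty] at h
    simpa using h
  have hN0 : (N : ℂ) ≠ 0 := by exact_mod_cast (by omega : N ≠ 0)
  have hterm : ∀ u, ∫ t, F u t * (1 / (N : ℝ) * ∑ k ∈ Finset.Icc 1 N,
        ∏ j ∈ u, repKernel (latticePoint N z Δ k j) (t j) : ℝ) ∂mixedMeasure u
      = 1 / (N : ℂ) * ∑ k ∈ Finset.Icc 1 N, ∫ t, F u t *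
        (∏ j ∈ u, repKernel (latticePoint N z Δ k j) (t j) : ℝ) ∂mixedMeasure u := fun u => by
    rw [← integral_finsetSum _ fun k _ => by simpa using hint u (latticePoint N z Δ k),
      ← integral_const_mul]
    refine integral_congr_ae (.of_forall fun t => ?_)
    simp only
    push_cast
    rw [← Finset.mul_sum]
    ring
  simp only [hterm]
  rw [qmcError, qmc, Finset.sum_congr rfl fun k _ => hrep (latticePoint N z Δ k),
    Finset.sum_add_distrib, Finset.sum_const, Nat.card_Icc, ← Finset.mul_sum, Finset.sum_comm,
    nsmul_eq_mul, Nat.add_sub_cancel]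
  field_simp
  ring

/-- The mean square error of a randomly shifted lattice rule is at most the squared weighted norm of
the integrand times the squared shift averaged worst case error. The numbers `R u` bound the
contributions to the squared norm; in this form the weights `γ u` may vanish. -/
theorem rmsError_sq_le (hF : IsMixedFamily F) (hb : ∀ j, 0 ≤ b j)
    (hD : ∀ u ξ, ‖F u ξ‖ ≤ D u * Real.exp (∑ j, b j * |ξ j|)) {N : ℕ} (hN : 1 ≤ N) (z : ℕ → ℕ)
    {θ : Fin m → ℝ} (hθ : ∀ j, b j < θ j) {γ R : Finset (Fin m) → ℝ} (hγ : ∀ u, 0 ≤ γ u)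
    (hR : ∀ u, 0 ≤ R u)
    (hDR : ∀ u, D u ^ 2 * (∏ j ∈ u, 1 / (θ j - b j)) *
      ∏ j, ∫ t, Real.exp (2 * b j * |t|) ∂stdGauss ≤ γ u * R u) :
    MemLp (qmcError N z (F ∅)) 2 (uniformCube m) ∧
      rmsError N z (F ∅) ^ 2 ≤ (∑ u ∈ (Finset.univ : Finset (Finset (Fin m))).erase ∅, R u) *
        ∑ u ∈ (Finset.univ : Finset (Finset (Fin m))).erase ∅, γ u * ((1 / (N : ℝ)) ^ 2 *
          ∑ k ∈ Finset.Icc 1 N, ∑ k' ∈ Finset.Icc 1 N, ∏ j ∈ u, shiftKernel (θ j)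
            (Int.fract ((k : ℝ) * z j / N - (k' : ℝ) * z j / N))) := by
  classical
  set P := (Finset.univ : Finset (Finset (Fin m))).erase ∅ with hP
  set B : Finset (Fin m) → (Fin m → ℝ) → ℝ := fun u Δ => (1 / (N : ℝ)) ^ 2 *
    ∑ k ∈ Finset.Icc 1 N, ∑ k' ∈ Finset.Icc 1 N, ∏ j ∈ u,
      pairKernel (θ j) (latticePoint N z Δ k j) (latticePoint N z Δ k' j) with hB
  have hpair : ∀ u (k k' : ℕ), Integrable (fun Δ : Fin m → ℝ => ∏ j ∈ u,
        pairKernel (θ j) (latticePoint N z Δ k j) (latticePoint N z Δ k' j)) (uniformCube m) ∧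
      ∫ Δ, ∏ j ∈ u, pairKernel (θ j) (latticePoint N z Δ k j) (latticePoint N z Δ k' j)
        ∂uniformCube m = ∏ j ∈ u, shiftKernel (θ j)
          (Int.fract ((k : ℝ) * z j / N - (k' : ℝ) * z j / N)) := fun u k k' => by
    set h : Fin m → ℝ → ℝ := fun j x => if j ∈ u then
      pairKernel (θ j) (gaussInv (Int.fract ((k : ℝ) * z j / N + x)))
        (gaussInv (Int.fract ((k' : ℝ) * z j / N + x))) else 1 with hh
    have e : ∀ Δ : Fin m → ℝ, ∏ j ∈ u,
        pairKernel (θ j) (latticePoint N z Δ k j) (latticePoint N z Δ k' j) = ∏ j, h j (Δ j) :=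
      fun Δ => by simp [hh, latticePoint]
    have hi : ∀ j, Integrable (h j) (volume.restrict (Set.Icc 0 1)) ∧
        ∫ x in Set.Icc 0 1, h j x = if j ∈ u then shiftKernel (θ j)
          (Int.fract ((k : ℝ) * z j / N - (k' : ℝ) * z j / N)) else 1 := fun j => by
      by_cases hj : j ∈ u
      · simp only [hh, hj, if_true]
        exact integral_pairKernel_shift (θ j) _ _
      · simp [hh, hj]
    rw [uniformCube_eq_pi]
    simp only [e]
    refine ⟨Integrable.fintype_prod fun j => (hi j).1, ?_⟩
    rw [integral_fintype_prod_eq_prod]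
    simp only [(hi _).2]
    simp
  have hBi : ∀ u, Integrable (B u) (uniformCube m) := fun u =>
    (integrable_finsetSum _ fun k _ => integrable_finsetSum _ fun k' _ =>
      (hpair u k k').1).const_mul _
  have hBint : ∀ u, ∫ Δ, B u Δ ∂uniformCube m = (1 / (N : ℝ)) ^ 2 *
      ∑ k ∈ Finset.Icc 1 N, ∑ k' ∈ Finset.Icc 1 N, ∏ j ∈ u, shiftKernel (θ j)
        (Int.fract ((k : ℝ) * z j / N - (k' : ℝ) * z j / N)) := fun u => by
    simp only [hB]
    rw [integral_const_mul, integral_finsetSum _ fun k _ => integrable_finsetSum _ fun k' _ =>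
      (hpair u k k').1]
    congr 1
    refine Finset.sum_congr rfl fun k _ => ?_
    rw [integral_finsetSum _ fun k' _ => (hpair u k k').1]
    exact Finset.sum_congr rfl fun k' _ => (hpair u k k').2
  have hterm := fun u Δ => sq_norm_integral_le hD hb hθ u (Finset.Icc 1 N) (1 / (N : ℝ))
    (latticePoint N z Δ)
  -- `B u Δ` is the integral of a square
  have hB0 : ∀ u Δ, 0 ≤ B u Δ := fun u Δ => by
    have h1 := integrable_prod_pairKernel u θ
    set w : (Fin m → ℝ) → ℝ := fun t => ((1 / (N : ℝ)) * ∑ k ∈ Finset.Icc 1 N,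
      ∏ j ∈ u, repKernel (latticePoint N z Δ k j) (t j) / weightFun (θ j) (t j)) ^ 2 with hw
    have : B u Δ = ∫ t, w t ∂mixedMeasure u := by
      have e : ∀ t, w t = (1 / (N : ℝ)) ^ 2 * ∑ k ∈ Finset.Icc 1 N, ∑ k' ∈ Finset.Icc 1 N,
          ∏ j ∈ u, repKernel (latticePoint N z Δ k j) (t j) *
            repKernel (latticePoint N z Δ k' j) (t j) / weightFun (θ j) (t j) ^ 2 := fun t => by
        simp only [hw]
        rw [mul_pow, sq (∑ k ∈ _, _), Finset.sum_mul_sum]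
        simp only [← Finset.prod_mul_distrib, div_mul_div_comm, sq]
      simp only [e, hB]
      rw [integral_const_mul, integral_finsetSum _ fun k _ => integrable_finsetSum _ fun k' _ =>
        (h1 _ _).1]
      congr 1
      refine Finset.sum_congr rfl fun k _ => ?_
      rw [integral_finsetSum _ fun k' _ => (h1 _ _).1]
      exact Finset.sum_congr rfl fun k' _ => (h1 _ _).2.symm
    rw [this]
    exact integral_nonneg fun t => sq_nonneg _
  have hpt : ∀ Δ, ‖qmcError N z (F ∅) Δ‖ ^ 2 ≤ (∑ u ∈ P, R u) * ∑ u ∈ P, γ u * B u Δ := fun Δ => by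
    rw [qmcError_eq hF hb hD hN z Δ, norm_neg]
    refine (pow_le_pow_left₀ (norm_nonneg _) (norm_sum_le _ _) 2).trans ?_
    refine Finset.sum_sq_le_sum_mul_sum_of_sq_le_mul P (fun u _ => hR u)
      (fun u _ => mul_nonneg (hγ u) (hB0 u Δ)) fun u _ => ?_
    refine (hterm u Δ).trans ?_
    calc _ ≤ γ u * R u * B u Δ := mul_le_mul_of_nonneg_right (hDR u) (hB0 u Δ)
      _ = _ := by ring
  have hmaj : Integrable (fun Δ => (∑ u ∈ P, R u) * ∑ u ∈ P, γ u * B u Δ) (uniformCube m) :=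
    (integrable_finsetSum _ fun u _ => (hBi u).const_mul _).const_mul _
  have hmeas : AEStronglyMeasurable (qmcError N z (F ∅)) (uniformCube m) :=
    (measurable_const.sub (measurable_const.mul (Finset.measurable_sum _ fun k _ =>
      (hF.1 ∅).measurable.comp (measurable_latticePoint N z k)))).aestronglyMeasurable
  have hsq : Integrable (fun Δ => ‖qmcError N z (F ∅) Δ‖ ^ 2) (uniformCube m) :=
    hmaj.mono' (hmeas.norm.pow 2) (.of_forall fun Δ => by
      rw [norm_pow, norm_norm]; exact hpt Δ)
  refine ⟨(memLp_two_iff_integrable_sq_norm hmeas).2 hsq, ?_⟩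
  rw [rmsError, Real.sq_sqrt (integral_nonneg fun Δ => by positivity)]
  refine (integral_mono hsq hmaj hpt).trans_eq ?_
  rw [integral_const_mul, integral_finsetSum _ fun u _ => (hBi u).const_mul _]
  congr 1
  refine Finset.sum_congr rfl fun u _ => ?_
  rw [integral_const_mul, hBint]

end MeanSquare

/-! ### The Fourier series of the shift-invariant kernel -/

/-- The character `e^{2πihx}`. -/
def charE (h : ℤ) (x : ℝ) : ℂ := Complex.exp (2 * π * Complex.I * h * x)

theorem norm_charE (h : ℤ) (x : ℝ) : ‖charE h x‖ = 1 := by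
  have : charE h x = Complex.exp ((2 * π * h * x : ℝ) * Complex.I) := by
    rw [charE]; congr 1; push_cast; ring
  rw [this, Complex.norm_exp_ofReal_mul_I]

theorem charE_add (h : ℤ) (x y : ℝ) : charE h (x + y) = charE h x * charE h y := by
  rw [charE, charE, charE, ← Complex.exp_add]; congr 1; push_cast; ring

/-- The Fourier series of the second Bernoulli polynomial. -/
theorem hasSum_charE (x : ℝ) :
    HasSum (fun h : ℤ => 1 / (h : ℂ) ^ 2 * charE h x)
      ((2 * π ^ 2 * (Int.fract x ^ 2 - Int.fract x + 6⁻¹) : ℝ) : ℂ) := by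
  have h := hasSum_one_div_pow_mul_fourier_mul_bernoulliFun le_rfl
    (x := Int.fract x) ⟨Int.fract_nonneg x, (Int.fract_lt_one x).le⟩
  convert! h using 1
  · funext n
    rw [fourier_coe_apply, charE]
    congr 1
    rw [Complex.exp_eq_exp_iff_exists_int]
    refine ⟨n * ⌊x⌋, ?_⟩
    rw [Int.fract]
    push_cast
    ring
  · rw [bernoulliFun_two]
    rw [Nat.factorial_two, mul_pow, mul_pow, Complex.I_sq]
    push_cast
    ring

/-- The Fourier series of the autocorrelation of an indicator function. -/
theorem hasSum_sin_sq {c f : ℝ} (h0 : 0 < c) (h1 : c < 1) (hf : f ∈ Set.Ico (0 : ℝ) 1) :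
    HasSum (fun h : ℤ => ((Real.sin (π * h * c) ^ 2 / (π * h) ^ 2 : ℝ) : ℂ) * charE h f)
      ((max (c - f) 0 + max (c - 1 + f) 0 - c ^ 2 : ℝ) : ℂ) := by
  have hs := (((hasSum_charE f).mul_left 2).sub
    ((hasSum_charE (f + c)).add (hasSum_charE (f - c)))).mul_left (1 / (4 * (π : ℂ) ^ 2))
  convert! hs using 1
  · funext h
    have e : ((Real.sin (π * h * c) ^ 2 : ℝ) : ℂ) = (2 - charE h c - charE h (-c)) / 4 := by
      have e1 : Complex.sin (π * h * c) ^ 2 = (1 - Complex.cos (2 * (π * h * c))) / 2 := by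
        rw [Complex.cos_two_mul, Complex.cos_sq']; ring
      push_cast
      rw [e1, Complex.cos, charE, charE]
      push_cast
      rw [show 2 * ((π : ℂ) * h * c) * Complex.I = 2 * π * Complex.I * h * c by ring,
        show -(2 * ((π : ℂ) * h * c)) * Complex.I = 2 * π * Complex.I * h * -c by ring]
      ring
    rw [Complex.ofReal_div, e, sub_eq_add_neg f c, charE_add, charE_add]
    rcases eq_or_ne h 0 with rfl | hh
    · simp
    · have hh' : (h : ℂ) ≠ 0 := by exact_mod_cast hh
      have hpi : (π : ℂ) ≠ 0 := by exact_mod_cast Real.pi_ne_zero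
      push_cast
      field_simp
      ring
  · have hpi : (π : ℂ) ≠ 0 := by exact_mod_cast Real.pi_ne_zero
    obtain ⟨hf0, hf1⟩ := hf
    have key : max (c - f) 0 + max (c - 1 + f) 0 - c ^ 2 = 1 / 2 * (2 * (f ^ 2 - f + 6⁻¹) -
        ((Int.fract (f + c) ^ 2 - Int.fract (f + c) + 6⁻¹) +
          (Int.fract (f - c) ^ 2 - Int.fract (f - c) + 6⁻¹))) := by
      have a1 : f + c < 1 ∧ Int.fract (f + c) = f + c ∨
          1 ≤ f + c ∧ Int.fract (f + c) = f + c - 1 := by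
        rcases lt_or_ge (f + c) 1 with h | h
        · exact Or.inl ⟨h, Int.fract_eq_self.2 ⟨by linarith, h⟩⟩
        · refine Or.inr ⟨h, ?_⟩
          rw [← Int.fract_sub_one, Int.fract_eq_self]; constructor <;> linarith
      have a2 : c ≤ f ∧ Int.fract (f - c) = f - c ∨
          f < c ∧ Int.fract (f - c) = f - c + 1 := by
        rcases le_or_gt c f with h | h
        · exact Or.inl ⟨h, Int.fract_eq_self.2 ⟨by linarith, by linarith⟩⟩
        · refine Or.inr ⟨h, ?_⟩
          rw [← Int.fract_add_one, Int.fract_eq_self]; constructor <;> linarith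
      rcases a1 with ⟨g1, e1⟩ | ⟨g1, e1⟩ <;> rcases a2 with ⟨g2, e2⟩ | ⟨g2, e2⟩ <;> rw [e1, e2]
      · rw [max_eq_right (by linarith), max_eq_right (by linarith)]; ring
      · rw [max_eq_left (by linarith), max_eq_right (by linarith)]; ring
      · rw [max_eq_right (by linarith), max_eq_left (by linarith)]; ring
      · rw [max_eq_left (by linarith), max_eq_left (by linarith)]; ring
    rw [key, Int.fract_eq_self.2 ⟨hf0, hf1⟩]
    push_cast
    field_simp
    ring

/-- The Fourier coefficients of the shift-invariant kernel. -/
def shiftCoeff (θ : ℝ) (h : ℤ) : ℝ :=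
  ∫ t, Real.sin (π * h * gaussCdf t) ^ 2 / (π * h) ^ 2 * Real.exp (2 * θ * |t|)

theorem shiftCoeff_nonneg (θ : ℝ) (h : ℤ) : 0 ≤ shiftCoeff θ h :=
  integral_nonneg fun t => by positivity

theorem shiftCoeff_zero (θ : ℝ) : shiftCoeff θ 0 = 0 := by simp [shiftCoeff]

theorem integral_exp_quadratic {a : ℝ} (ha : 0 < a) (b : ℝ) :
    Integrable (fun t : ℝ => Real.exp (-a * t ^ 2 + 2 * b * t)) ∧
      ∫ t : ℝ, Real.exp (-a * t ^ 2 + 2 * b * t) = Real.exp (b ^ 2 / a) * √(π / a) := by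
  have e : ∀ t : ℝ, Real.exp (-a * t ^ 2 + 2 * b * t)
      = Real.exp (b ^ 2 / a) * Real.exp (-a * (t - b / a) ^ 2) := fun t => by
    rw [← Real.exp_add]; congr 1; field_simp; ring
  simp only [e]
  refine ⟨((integrable_exp_neg_mul_sq ha).comp_sub_right (b / a)).const_mul _, ?_⟩
  rw [integral_const_mul, integral_sub_right_eq_self (fun t => Real.exp (-a * t ^ 2)),
    integral_gaussian]

/-- For `t ≤ 0` this follows from `|sin y| ≤ |y| ^ η` and the Chernoff bound, for `t ≥ 0` by symmetry. -/
theorem sin_sq_gaussCdf_le {η : ℝ} (h0 : 0 < η) (h1 : η ≤ 1) (h : ℤ) (t : ℝ) :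
    Real.sin (π * h * gaussCdf t) ^ 2 ≤ (π * |(h : ℝ)|) ^ (2 * η) * Real.exp (-η * t ^ 2) := by
  have key : ∀ y : ℝ, 0 ≤ y → y ≤ Real.exp (-t ^ 2 / 2) →
      Real.sin (π * h * y) ^ 2 ≤ (π * |(h : ℝ)|) ^ (2 * η) * Real.exp (-η * t ^ 2) := by
    intro y hy0 hy
    have hs : |Real.sin (π * h * y)| ≤ (π * |(h : ℝ)| * y) ^ η := by
      have hx0 : 0 ≤ π * |(h : ℝ)| * y := by positivity
      rcases le_total (π * |(h : ℝ)| * y) 1 with hx | hx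
      · have h2 : |Real.sin (π * h * y)| ≤ π * |(h : ℝ)| * y := by
          have := Real.abs_sin_le_abs (x := π * h * y)
          rwa [abs_mul, abs_mul, abs_of_pos Real.pi_pos, abs_of_nonneg hy0] at this
        refine h2.trans ?_
        have := Real.rpow_le_rpow_of_exponent_ge' hx0 hx h0.le h1
        rwa [Real.rpow_one] at this
      · exact (Real.abs_sin_le_one _).trans (Real.one_le_rpow hx h0.le)
    have e : (π * |(h : ℝ)|) ^ (2 * η) * Real.exp (-η * t ^ 2)
        = ((π * |(h : ℝ)| * Real.exp (-t ^ 2 / 2)) ^ η) ^ 2 := by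
      rw [Real.mul_rpow (by positivity) (Real.exp_nonneg _), mul_pow, ← Real.exp_mul,
        ← Real.exp_nat_mul, mul_comm 2 η, Real.rpow_mul (by positivity), Real.rpow_two]
      congr 2
      push_cast
      ring
    rw [e, ← sq_abs]
    refine pow_le_pow_left₀ (abs_nonneg _) (hs.trans ?_) 2
    exact Real.rpow_le_rpow (by positivity) (mul_le_mul_of_nonneg_left hy (by positivity)) h0.le
  rcases le_total t 0 with ht | ht
  · exact key _ (gaussCdf_nonneg t) (gaussCdf_le_exp ht)
  · have h2 := key (1 - gaussCdf t) (by linarith [gaussCdf_le_one t]) (one_sub_gaussCdf_le_exp ht)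
    have e : Real.sin (π * h * (1 - gaussCdf t)) ^ 2 = Real.sin (π * h * gaussCdf t) ^ 2 := by
      have : π * h * (1 - gaussCdf t) = h * π - π * h * gaussCdf t := by ring
      rw [this, Real.sin_int_mul_pi_sub, neg_sq, mul_pow, ← zpow_natCast,
        zpow_comm]
      simp
    rwa [e] at h2

/-- The constant in the decay of the Fourier coefficients of the shift-invariant kernel. -/
def decayConst (η θ : ℝ) : ℝ :=
  √(2 * π) * Real.exp (θ ^ 2 / η) / (π ^ (2 - 2 * η) * (1 - η) * η)

/-- The decay of the Fourier coefficients. The constant has the form required by `rho`, at the price of a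
numerical factor: the estimate of the Gaussian integral itself has `2 √(π / η)` in place of
`√(2π) / (η (1 - η))`. -/
theorem shiftCoeff_le {η : ℝ} (h0 : 0 < η) (h1 : η < 1) (θ : ℝ) {h : ℤ} (hh : h ≠ 0) :
    Integrable (fun t => Real.sin (π * h * gaussCdf t) ^ 2 / (π * h) ^ 2 *
        Real.exp (2 * θ * |t|)) ∧
      shiftCoeff θ h ≤ decayConst η θ * |(h : ℝ)| ^ (-(2 - 2 * η)) := by
  have hh' : 0 < |(h : ℝ)| := abs_pos.2 (by exact_mod_cast hh)
  set K : ℝ := (π * |(h : ℝ)|) ^ (2 * η) / (π * h) ^ 2 with hK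
  have hK0 : 0 ≤ K := by positivity
  have i1 := integral_exp_quadratic h0 θ
  have i2 := integral_exp_quadratic h0 (-θ)
  set M : ℝ → ℝ := fun t => K * (Real.exp (-η * t ^ 2 + 2 * θ * t) +
    Real.exp (-η * t ^ 2 + 2 * -θ * t)) with hM
  have hMi : Integrable M := (i1.1.add i2.1).const_mul K
  have hle : ∀ t, Real.sin (π * h * gaussCdf t) ^ 2 / (π * h) ^ 2 * Real.exp (2 * θ * |t|) ≤ M t :=
    fun t => by
    have e1 : Real.exp (-η * t ^ 2) * Real.exp (2 * θ * |t|) ≤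
        Real.exp (-η * t ^ 2 + 2 * θ * t) + Real.exp (-η * t ^ 2 + 2 * -θ * t) := by
      rw [← Real.exp_add]
      rcases abs_cases t with ⟨h, -⟩ | ⟨h, -⟩ <;> rw [h]
      · linarith [Real.exp_nonneg (-η * t ^ 2 + 2 * -θ * t)]
      · rw [show 2 * θ * -t = 2 * -θ * t by ring]
        linarith [Real.exp_nonneg (-η * t ^ 2 + 2 * θ * t)]
    calc _ ≤ (π * |(h : ℝ)|) ^ (2 * η) * Real.exp (-η * t ^ 2) / (π * h) ^ 2 *
          Real.exp (2 * θ * |t|) := by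
          gcongr
          exact sin_sq_gaussCdf_le h0 h1.le h t
      _ = K * (Real.exp (-η * t ^ 2) * Real.exp (2 * θ * |t|)) := by rw [hK]; ring
      _ ≤ _ := mul_le_mul_of_nonneg_left e1 hK0
  have hc := continuous_gaussCdf
  have hint : Integrable (fun t => Real.sin (π * h * gaussCdf t) ^ 2 / (π * h) ^ 2 *
        Real.exp (2 * θ * |t|)) :=
    hMi.mono' (by fun_prop) (.of_forall fun t => by
      rw [Real.norm_of_nonneg (by positivity)]; exact hle t)
  refine ⟨hint, (integral_mono hint hMi hle).trans ?_⟩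
  simp only [hM]
  rw [integral_const_mul, integral_add i1.1 i2.1, i1.2, i2.2, neg_sq]
  have hKe : K = π ^ (-(2 - 2 * η)) * |(h : ℝ)| ^ (-(2 - 2 * η)) := by
    rw [hK, ← Real.mul_rpow Real.pi_pos.le hh'.le, neg_sub, Real.rpow_sub (by positivity),
      Real.rpow_two, mul_pow π |(h : ℝ)|, sq_abs, mul_pow]
  -- `√2 √η (1 - η) ≤ 1`
  have hη : √(π / η) + √(π / η) ≤ √(2 * π) / ((1 - η) * η) := by
    rw [le_div_iff₀ (by nlinarith), ← two_mul]
    refine Real.le_sqrt_of_sq_le ?_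
    rw [mul_pow, mul_pow, Real.sq_sqrt (by positivity)]
    have : 2 ^ 2 * (π / η) * ((1 - η) * η) ^ 2 = 4 * π * (η * (1 - η) ^ 2) := by
      field_simp
      ring
    rw [this]
    have h3 : η * (1 - η) ^ 2 ≤ 1 / 2 := by
      nlinarith [sq_nonneg (η - 1 / 3), sq_nonneg (1 - η), sq_nonneg η,
        mul_nonneg h0.le (sq_nonneg (η - 1 / 3))]
    nlinarith [Real.pi_pos]
  rw [hKe, decayConst, Real.rpow_neg Real.pi_pos.le]
  calc (π ^ (2 - 2 * η))⁻¹ * |(h : ℝ)| ^ (-(2 - 2 * η)) *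
        (Real.exp (θ ^ 2 / η) * √(π / η) + Real.exp (θ ^ 2 / η) * √(π / η))
      = (π ^ (2 - 2 * η))⁻¹ * |(h : ℝ)| ^ (-(2 - 2 * η)) * Real.exp (θ ^ 2 / η) *
        (√(π / η) + √(π / η)) := by ring
    _ ≤ (π ^ (2 - 2 * η))⁻¹ * |(h : ℝ)| ^ (-(2 - 2 * η)) * Real.exp (θ ^ 2 / η) *
        (√(2 * π) / ((1 - η) * η)) := by gcongr
    _ = _ := by
        have : 1 - η ≠ 0 := by linarith
        field_simp

/-- The Fourier series of the shift-invariant kernel. -/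
theorem hasSum_shiftKernel (θ : ℝ) {f : ℝ} (hf : f ∈ Set.Ico (0 : ℝ) 1) :
    Summable (shiftCoeff θ) ∧
      HasSum (fun h : ℤ => (shiftCoeff θ h : ℂ) * charE h f) (shiftKernel θ f : ℂ) := by
  have hsum : Summable (shiftCoeff θ) := by
    have hs := (Real.summable_abs_int_rpow (b := 2 - 2 * (1 / 4)) (by norm_num)).mul_left
      (decayConst (1 / 4) θ)
    refine Summable.of_nonneg_of_le (shiftCoeff_nonneg θ) (fun h => ?_) hs
    rcases eq_or_ne h 0 with rfl | hh
    · rw [shiftCoeff_zero, Int.cast_zero, abs_zero, Real.zero_rpow (by norm_num), mul_zero]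
    · exact (shiftCoeff_le (by norm_num) (by norm_num) θ hh).2
  refine ⟨hsum, ?_⟩
  set G : ℤ → ℝ → ℝ := fun h t => Real.sin (π * h * gaussCdf t) ^ 2 / (π * h) ^ 2 *
    Real.exp (2 * θ * |t|) with hG
  have hGi : ∀ h, Integrable (G h) := fun h => by
    rcases eq_or_ne h 0 with rfl | hh
    · simp [hG]
    · exact (shiftCoeff_le (by norm_num : (0 : ℝ) < 1 / 4) (by norm_num) θ hh).1
  have hGn : ∀ h t, ‖(G h t : ℂ) * charE h f‖ = G h t := fun h t => by
    rw [norm_mul, norm_charE, mul_one, Complex.norm_real, Real.norm_of_nonneg]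
    simp only [hG]; positivity
  have h := hasSum_integral_of_summable_integral_norm (μ := volume)
    (F := fun h t => (G h t : ℂ) * charE h f) (fun h => (hGi h).ofReal.mul_const _)
    (by simp only [hGn]; exact hsum)
  have e1 : ∀ h, ∫ t, (G h t : ℂ) * charE h f = (shiftCoeff θ h : ℂ) * charE h f := fun h => by
    rw [integral_mul_const, integral_complex_ofReal]; rfl
  simp only [e1] at h
  convert! h using 1
  rw [shiftKernel, ← integral_complex_ofReal]
  refine integral_congr_ae (.of_forall fun t => ?_)
  simp only
  rw [div_eq_mul_inv, inv_weightFun_sq]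
  have h2 := (hasSum_sin_sq (gaussCdf_pos t) (gaussCdf_lt_one t) hf).mul_right
    ((Real.exp (2 * θ * |t|) : ℝ) : ℂ)
  rw [Complex.ofReal_mul, ← h2.tsum_eq]
  refine tsum_congr fun n => ?_
  simp only [hG]
  push_cast
  ring

/-! ### Subadditivity of concave powers -/

theorem add_rpow_le_of_le_one {x y l : ℝ} (hx : 0 ≤ x) (hy : 0 ≤ y) (h0 : 0 ≤ l) (h1 : l ≤ 1) :
    (x + y) ^ l ≤ x ^ l + y ^ l := by
  have := NNReal.rpow_add_le_add_rpow ⟨x, hx⟩ ⟨y, hy⟩ h0 h1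
  exact_mod_cast this

theorem add_rpow_le_of_one_le {x y r : ℝ} (hx : 0 ≤ x) (hy : 0 ≤ y) (h1 : 1 ≤ r) :
    x ^ r + y ^ r ≤ (x + y) ^ r := by
  have := NNReal.add_rpow_le_rpow_add ⟨x, hx⟩ ⟨y, hy⟩ h1
  exact_mod_cast this

theorem sum_rpow_le_sum {ι : Type*} (s : Finset ι) {f : ι → ℝ} (hf : ∀ i ∈ s, 0 ≤ f i) {l : ℝ}
    (h0 : 0 < l) (h1 : l ≤ 1) : (∑ i ∈ s, f i) ^ l ≤ ∑ i ∈ s, f i ^ l :=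
  Finset.le_sum_of_subadditive_on_pred (fun x : ℝ => x ^ l) (fun x : ℝ => 0 ≤ x)
    (Real.zero_rpow h0.ne').le (fun _ _ hx hy => add_rpow_le_of_le_one hx hy h0.le h1)
    (fun _ _ hx hy => add_nonneg hx hy) f hf

theorem tsum_rpow_le_tsum {ι : Type*} {f : ι → ℝ} (hf : ∀ i, 0 ≤ f i) {l : ℝ} (h0 : 0 < l)
    (h1 : l ≤ 1) (hs : Summable f) (hsl : Summable fun i => f i ^ l) :
    (∑' i, f i) ^ l ≤ ∑' i, f i ^ l :=
  le_of_tendsto' (hs.hasSum.rpow_const (Or.inr h0.le)) fun s =>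
    (sum_rpow_le_sum s (fun i _ => hf i) h0 h1).trans
      (hsl.sum_le_tsum s fun i _ => Real.rpow_nonneg (hf i) l)

/-! ### Discrete Fourier coefficients of the shift-invariant kernel -/

theorem hasSum_abs_int_rpow {x : ℝ} (hx : 1 < x) :
    HasSum (fun h : ℤ => |(h : ℝ)| ^ (-x)) (2 * (riemannZeta (x : ℂ)).re) := by
  have hx0 : -x ≠ 0 := by linarith
  have hs : Summable fun n : ℕ => ((n : ℝ)) ^ (-x) := Real.summable_nat_rpow.2 (by linarith)
  have hz : (riemannZeta (x : ℂ)).re = ∑' n : ℕ, (n : ℝ) ^ (-x) := by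
    rw [zeta_eq_tsum_one_div_nat_cpow (by simpa using hx)]
    have : ∀ n : ℕ, 1 / (n : ℂ) ^ (x : ℂ) = (((n : ℝ) ^ (-x) : ℝ) : ℂ) := fun n => by
      rw [Real.rpow_neg n.cast_nonneg, Complex.ofReal_inv, Complex.ofReal_cpow n.cast_nonneg,
        one_div, Complex.ofReal_natCast]
    simp only [this, ← Complex.ofReal_tsum, Complex.ofReal_re]
  have h := HasSum.of_nat_of_neg (f := fun h : ℤ => |(h : ℝ)| ^ (-x)) (g := (riemannZeta (x : ℂ)).re)
    (g' := (riemannZeta (x : ℂ)).re) (by simpa [hz] using hs.hasSum) (by simpa [hz] using hs.hasSum)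
  simpa [Real.zero_rpow hx0, two_mul] using h

theorem etaStar_mem {l : ℝ} (h0 : 1 / 2 < l) (h1 : l ≤ 1) : 0 < etaStar l ∧ etaStar l ≤ 1 / 4 := by
  unfold etaStar
  refine ⟨div_pos (by linarith) (by linarith), ?_⟩
  rw [div_le_iff₀ (by linarith)]
  linarith

theorem mul_two_sub_etaStar {l : ℝ} (h0 : 1 / 2 < l) : (2 - 2 * etaStar l) * l = l + 1 / 2 := by
  unfold etaStar
  have : l ≠ 0 := by linarith
  field_simp
  ring

theorem decayConst_pos {η : ℝ} (h0 : 0 < η) (h1 : η < 1) (θ : ℝ) : 0 < decayConst η θ := by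
  have : 0 < 1 - η := by linarith
  unfold decayConst
  positivity

theorem rho_eq (l θ : ℝ) : rho l θ =
    decayConst (etaStar l) θ ^ l * (2 * (riemannZeta ((l + 1 / 2 : ℝ) : ℂ)).re) := by
  rw [rho, decayConst]; ring

theorem shiftCoeff_rpow_le {l : ℝ} (h0 : 1 / 2 < l) (h1 : l ≤ 1) (θ : ℝ) (h : ℤ) :
    shiftCoeff θ h ^ l ≤ decayConst (etaStar l) θ ^ l * |(h : ℝ)| ^ (-(l + 1 / 2)) := by
  obtain ⟨hη0, hη1⟩ := etaStar_mem h0 h1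
  rcases eq_or_ne h 0 with rfl | hh
  · rw [shiftCoeff_zero, Real.zero_rpow (by linarith), Int.cast_zero, abs_zero,
      Real.zero_rpow (by linarith), mul_zero]
  · have h2 := Real.rpow_le_rpow (shiftCoeff_nonneg θ h)
      (shiftCoeff_le hη0 (by linarith) θ hh).2 (by linarith : 0 ≤ l)
    rwa [Real.mul_rpow (decayConst_pos hη0 (by linarith) θ).le (by positivity),
      ← Real.rpow_mul (abs_nonneg _), neg_mul, mul_two_sub_etaStar h0] at h2

section Discrete

variable {N : ℕ}

/-- The discrete Fourier coefficients on `ℤ/N` of the shift-invariant kernel. -/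
def zmodCoeff (N : ℕ) (θ : ℝ) (a : ZMod N) : ℝ :=
  ∑' h : ℤ, if (h : ZMod N) = a then shiftCoeff θ h else 0

theorem summable_shiftCoeff (θ : ℝ) : Summable (shiftCoeff θ) :=
  (hasSum_shiftKernel θ (Set.left_mem_Ico.2 one_pos)).1

theorem zmodCoeff_nonneg (θ : ℝ) (a : ZMod N) : 0 ≤ zmodCoeff N θ a :=
  tsum_nonneg fun h => by split_ifs <;> [exact shiftCoeff_nonneg θ h; exact le_rfl]

/-- Aliasing: the coefficient of a class modulo `N` is the sum over its representatives, and
`x ↦ x ^ l` is subadditive. -/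
theorem zmodCoeff_rpow_le {l : ℝ} (h0 : 1 / 2 < l) (h1 : l ≤ 1) (θ : ℝ) (a : ZMod N) :
    zmodCoeff N θ a ^ l ≤ ∑' h : ℤ, if (h : ZMod N) = a then
      decayConst (etaStar l) θ ^ l * |(h : ℝ)| ^ (-(l + 1 / 2)) else 0 := by
  have hs : Summable fun h : ℤ => decayConst (etaStar l) θ ^ l * |(h : ℝ)| ^ (-(l + 1 / 2)) :=
    (hasSum_abs_int_rpow (by linarith)).summable.mul_left _
  have hle : ∀ h : ℤ, (if (h : ZMod N) = a then shiftCoeff θ h else 0) ^ l ≤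
      if (h : ZMod N) = a then
        decayConst (etaStar l) θ ^ l * |(h : ℝ)| ^ (-(l + 1 / 2)) else 0 := fun h => by
    split_ifs
    · exact shiftCoeff_rpow_le h0 h1 θ h
    · rw [Real.zero_rpow (by linarith)]
  have hn : ∀ h : ℤ, 0 ≤ if (h : ZMod N) = a then shiftCoeff θ h else 0 := fun h => by
    split_ifs <;> [exact shiftCoeff_nonneg θ h; exact le_rfl]
  have hD : 0 ≤ decayConst (etaStar l) θ :=
    (decayConst_pos (etaStar_mem h0 h1).1 (by linarith [(etaStar_mem h0 h1).2]) θ).le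
  have hs2 : Summable fun h : ℤ => if (h : ZMod N) = a then
      decayConst (etaStar l) θ ^ l * |(h : ℝ)| ^ (-(l + 1 / 2)) else 0 :=
    Summable.of_nonneg_of_le (fun h => by split_ifs <;> positivity)
      (fun h => by split_ifs <;> [exact le_rfl; positivity]) hs
  have hs1 := Summable.of_nonneg_of_le (fun h => Real.rpow_nonneg (hn h) l) hle hs2
  refine (tsum_rpow_le_tsum hn (by linarith) h1 ?_ hs1).trans (hs1.tsum_le_tsum hle hs2)
  exact Summable.of_nonneg_of_le hn
    (fun h => by split_ifs <;> [exact le_rfl; exact shiftCoeff_nonneg θ h]) (summable_shiftCoeff θ)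

variable [NeZero N]

/-- `f` has the Fourier expansion `f k = ∑ₐ c a exp(2πi a k / N)` on `ℤ/N`, with nonnegative
coefficients. -/
def HasNonnegCoeff (f c : ZMod N → ℝ) : Prop :=
  (∀ a, 0 ≤ c a) ∧ ∀ k, (f k : ℂ) = ∑ a, (c a : ℂ) * ZMod.stdAddChar (a * k)

theorem hasNonnegCoeff_shiftKernel (θ : ℝ) :
    HasNonnegCoeff (fun k : ZMod N => shiftKernel θ ((k.val : ℝ) / N)) (zmodCoeff N θ) := by
  refine ⟨zmodCoeff_nonneg θ, fun k => ?_⟩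
  have hN : (0 : ℝ) < N := by exact_mod_cast Nat.pos_of_ne_zero (NeZero.ne N)
  have hk : (k.val : ℝ) / N ∈ Set.Ico (0 : ℝ) 1 :=
    ⟨by positivity, by rw [div_lt_one hN]; exact_mod_cast k.val_lt⟩
  obtain ⟨hs, h⟩ := hasSum_shiftKernel θ hk
  have e1 : ∀ h : ℤ, charE h ((k.val : ℝ) / N) = ZMod.stdAddChar ((h : ZMod N) * k) := fun h => by
    have : (h : ZMod N) * k = ((h * k.val : ℤ) : ZMod N) := by
      push_cast; rw [ZMod.natCast_zmod_val]
    rw [this, ZMod.stdAddChar_coe, charE]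
    congr 1
    push_cast
    ring
  simp only [e1] at h
  rw [← h.tsum_eq]
  have e2 : ∀ a : ZMod N, (zmodCoeff N θ a : ℂ) * ZMod.stdAddChar (a * k)
      = ∑' h : ℤ, if (h : ZMod N) = a then
        (shiftCoeff θ h : ℂ) * ZMod.stdAddChar ((h : ZMod N) * k) else 0 := fun a => by
    rw [zmodCoeff, Complex.ofReal_tsum, ← tsum_mul_right]
    refine tsum_congr fun h => ?_
    split_ifs with hh
    · rw [hh]
    · simp
  simp only [e2]
  rw [← Summable.tsum_finsetSum]
  · refine tsum_congr fun h => ?_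
    simp
  · intro a _
    refine Summable.of_norm_bounded hs fun h => ?_
    split_ifs
    · rw [norm_mul, AddChar.norm_apply, mul_one, Complex.norm_real,
        Real.norm_of_nonneg (shiftCoeff_nonneg θ h)]
    · rw [norm_zero]; exact shiftCoeff_nonneg θ h

theorem sum_zmodCoeff_rpow_le {l : ℝ} (h0 : 1 / 2 < l) (h1 : l ≤ 1) (θ : ℝ) :
    ∑ a : ZMod N, zmodCoeff N θ a ^ l ≤ rho l θ := by
  have hs := (hasSum_abs_int_rpow (x := l + 1 / 2) (by linarith)).mul_left
    (decayConst (etaStar l) θ ^ l)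
  have hD : 0 ≤ decayConst (etaStar l) θ :=
    (decayConst_pos (etaStar_mem h0 h1).1 (by linarith [(etaStar_mem h0 h1).2]) θ).le
  refine (Finset.sum_le_sum fun a _ => zmodCoeff_rpow_le h0 h1 θ a).trans ?_
  rw [← Summable.tsum_finsetSum fun a _ => Summable.of_nonneg_of_le
    (fun h => by split_ifs <;> positivity) (fun h => by split_ifs <;> [exact le_rfl; positivity])
    hs.summable, rho_eq, ← hs.tsum_eq]
  simp

/-- The mean of the discrete Fourier coefficients over the multiples of `b` by units. The point is
that the multiples of `b` are the multiples of `g = gcd(b, N)`, each being attained at most `g`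
times. -/
theorem sum_units_zmodCoeff_rpow_le {l : ℝ} (h0 : 1 / 2 < l) (h1 : l ≤ 1) (θ : ℝ) (b : ZMod N) :
    ∑ z : (ZMod N)ˣ, zmodCoeff N θ (b * z) ^ l ≤ rho l θ := by
  classical
  set K := decayConst (etaStar l) θ ^ l with hK
  have hD : 0 ≤ K := Real.rpow_nonneg
    (decayConst_pos (etaStar_mem h0 h1).1 (by linarith [(etaStar_mem h0 h1).2]) θ).le _
  have hs := (hasSum_abs_int_rpow (x := l + 1 / 2) (by linarith)).mul_left K
  set g : ℕ := Nat.gcd b.val N with hg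
  have hg0 : 0 < g := Nat.gcd_pos_of_pos_right _ (Nat.pos_of_ne_zero (NeZero.ne N))
  -- the number of units `z` with `b z = h`
  have hcard : ∀ h : ℤ, (∑ z : (ZMod N)ˣ, if (h : ZMod N) = b * z then (1 : ℝ) else 0)
      ≤ if (g : ℤ) ∣ h then (g : ℝ) else 0 := fun h => by
    split_ifs with hdvd
    · rw [Finset.sum_boole]
      norm_cast
      rcases (Finset.univ.filter fun z : (ZMod N)ˣ => (h : ZMod N) = b * z).eq_empty_or_nonempty
        with he | ⟨z₀, hz₀⟩
      · rw [he]; exact Nat.zero_le _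
      refine le_trans (Finset.card_le_card_of_injOn (fun z : (ZMod N)ˣ => (z : ZMod N) - z₀)
        (t := Finset.univ.filter fun y : ZMod N => g • y = 0) (fun z hz => ?_) (fun z _ z' _ h => ?_))
        (IsAddCyclic.card_nsmul_eq_zero_le hg0)
      · have hz1 := (Finset.mem_filter.1 hz).2
        have hz2 := (Finset.mem_filter.1 hz₀).2
        refine Finset.mem_filter.2 ⟨Finset.mem_univ _, ?_⟩
        have hb0 : b * ((z : ZMod N) - z₀) = 0 := by rw [mul_sub, ← hz1, ← hz2, sub_self]
        have hbez := Nat.gcd_eq_gcd_ab b.val N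
        have : (g : ZMod N) = b * (Nat.gcdA b.val N : ZMod N) := by
          have := congrArg (fun n : ℤ => (n : ZMod N)) hbez
          simpa using this
        rw [nsmul_eq_mul, this, mul_right_comm, hb0, zero_mul]
      · exact Units.ext (sub_left_injective h)
    · refine (Finset.sum_eq_zero fun z _ => if_neg fun hz => hdvd ?_).le
      have hzz : (h : ZMod N) = ((b.val * (z : ZMod N).val : ℕ) : ℤ) := by
        push_cast; rw [ZMod.natCast_zmod_val, ZMod.natCast_zmod_val, hz]
      have h2 := (ZMod.intCast_eq_intCast_iff_dvd_sub _ _ _).1 hzz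
      have h3 : (g : ℤ) ∣ ((b.val * (z : ZMod N).val : ℕ) : ℤ) :=
        Int.natCast_dvd_natCast.2 ((Nat.gcd_dvd_left _ _).mul_right _)
      have h4 : (g : ℤ) ∣ (N : ℤ) := Int.natCast_dvd_natCast.2 (Nat.gcd_dvd_right _ _)
      exact (dvd_sub_right h3).1 (h4.trans h2)
  set f : ℤ → ℝ := fun h => K * |(h : ℝ)| ^ (-(l + 1 / 2)) with hf
  have hf0 : ∀ h, 0 ≤ f h := fun h => by simp only [hf]; positivity
  have hinj : Function.Injective fun h : ℤ => (g : ℤ) * h :=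
    mul_right_injective₀ (by exact_mod_cast hg0.ne')
  calc ∑ z : (ZMod N)ˣ, zmodCoeff N θ (b * z) ^ l
      ≤ ∑ z : (ZMod N)ˣ, ∑' h : ℤ, if (h : ZMod N) = b * z then f h else 0 :=
        Finset.sum_le_sum fun z _ => zmodCoeff_rpow_le h0 h1 θ _
    _ = ∑' h : ℤ, ∑ z : (ZMod N)ˣ, if (h : ZMod N) = b * z then f h else 0 :=
        (Summable.tsum_finsetSum fun a _ => Summable.of_nonneg_of_le
          (fun h => by split_ifs <;> [exact hf0 h; exact le_rfl])
          (fun h => by split_ifs <;> [exact le_rfl; exact hf0 h]) hs.summable).symm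
    _ ≤ ∑' h : ℤ, if (g : ℤ) ∣ h then g * f h else 0 := by
        have hle : ∀ h : ℤ, (∑ z : (ZMod N)ˣ, if (h : ZMod N) = b * z then f h else 0)
            ≤ if (g : ℤ) ∣ h then g * f h else 0 := fun h => by
          have e : (∑ z : (ZMod N)ˣ, if (h : ZMod N) = b * z then f h else 0)
              = (∑ z : (ZMod N)ˣ, if (h : ZMod N) = b * z then (1 : ℝ) else 0) * f h := by
            rw [Finset.sum_mul]; simp only [ite_mul, one_mul, zero_mul]
          rw [e]
          refine (mul_le_mul_of_nonneg_right (hcard h) (hf0 h)).trans_eq ?_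
          rw [ite_mul, zero_mul]
        have hs2 : Summable fun h : ℤ => if (g : ℤ) ∣ h then g * f h else 0 :=
          Summable.of_nonneg_of_le
            (fun h => by split_ifs <;> [exact mul_nonneg g.cast_nonneg (hf0 h); exact le_rfl])
            (fun h => by split_ifs <;> [exact le_rfl; exact mul_nonneg g.cast_nonneg (hf0 h)])
            (hs.summable.mul_left (g : ℝ))
        refine Summable.tsum_le_tsum hle (Summable.of_nonneg_of_le (fun h =>
          Finset.sum_nonneg fun z _ => by split_ifs <;> [exact hf0 h; exact le_rfl]) hle hs2) hs2
    _ = ∑' h : ℤ, g * f (g * h) := by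
        rw [← hinj.tsum_eq]
        · simp
        · intro h hh
          have : (g : ℤ) ∣ h := by
            by_contra hc
            exact hh (if_neg hc)
          obtain ⟨k, rfl⟩ := this
          exact ⟨k, rfl⟩
    _ = (g : ℝ) * (g : ℝ) ^ (-(l + 1 / 2)) * ∑' h : ℤ, f h := by
        rw [← tsum_mul_left]
        refine tsum_congr fun h => ?_
        simp only [hf]
        push_cast
        rw [abs_mul, Nat.abs_cast, Real.mul_rpow g.cast_nonneg (abs_nonneg _)]
        ring
    _ ≤ 1 * rho l θ := by
        rw [rho_eq, hs.tsum_eq]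
        refine mul_le_mul_of_nonneg_right ?_ ?_
        · have hg1 : (1 : ℝ) ≤ g := by exact_mod_cast hg0
          rw [Real.rpow_neg (by positivity), ← div_eq_mul_inv, div_le_one (by positivity)]
          calc (g : ℝ) = (g : ℝ) ^ (1 : ℝ) := (Real.rpow_one _).symm
            _ ≤ _ := Real.rpow_le_rpow_of_exponent_le hg1 (by linarith)
        · rw [← hs.tsum_eq]; exact tsum_nonneg hf0
    _ = rho l θ := one_mul _

end Discrete

/-! ### Products of functions with nonnegative Fourier coefficients -/

section Coeff

variable {N : ℕ} [NeZero N]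

theorem sum_stdAddChar (a : ZMod N) :
    ∑ k : ZMod N, ZMod.stdAddChar (a * k) = if a = 0 then (N : ℂ) else 0 := by
  have h := AddChar.sum_mulShift a (ZMod.isPrimitive_stdAddChar N)
  simp only [mul_comm a]
  rw [h, ZMod.card]
  split_ifs <;> simp

theorem hasNonnegCoeff_one : HasNonnegCoeff (fun _ : ZMod N => 1) (Pi.single 0 1) := by
  classical
  refine ⟨fun a => ?_, fun k => ?_⟩
  · rcases eq_or_ne a 0 with rfl | h
    · simp
    · simp [h]
  · rw [Finset.sum_eq_single 0]
    · simp
    · intro a _ ha; simp [ha]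
    · simp

theorem HasNonnegCoeff.mul {f g c d : ZMod N → ℝ} (hf : HasNonnegCoeff f c)
    (hg : HasNonnegCoeff g d) :
    HasNonnegCoeff (fun k => f k * g k) (fun a => ∑ b, c (a - b) * d b) := by
  refine ⟨fun a => Finset.sum_nonneg fun b _ => mul_nonneg (hf.1 _) (hg.1 _), fun k => ?_⟩
  push_cast
  rw [hf.2, hg.2, Finset.sum_mul_sum, Finset.sum_comm]
  simp only [Finset.sum_mul]
  rw [Finset.sum_comm (s := Finset.univ) (t := Finset.univ) (f := fun a b =>
    (c (a - b) : ℂ) * d b * ZMod.stdAddChar (a * k))]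
  refine Finset.sum_congr rfl fun b _ => ?_
  rw [← Equiv.sum_comp (Equiv.subRight b)]
  refine Finset.sum_congr rfl fun a _ => ?_
  simp only [Equiv.subRight_apply]
  rw [mul_mul_mul_comm, ← AddChar.map_add_eq_mul, ← add_mul, sub_add_cancel]

/-- A change of variables by a unit permutes the coefficients. -/
theorem HasNonnegCoeff.comp_mul_unit {f c : ZMod N → ℝ} (hf : HasNonnegCoeff f c)
    (z : (ZMod N)ˣ) :
    HasNonnegCoeff (fun k : ZMod N => f (k * z)) (fun a : ZMod N => c (a * (z⁻¹ : (ZMod N)ˣ))) := by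
  refine ⟨fun a => hf.1 _, fun k => ?_⟩
  rw [hf.2, ← Equiv.sum_comp (Units.mulRight z⁻¹)]
  refine Finset.sum_congr rfl fun a _ => ?_
  simp only [Units.mulRight_apply]
  rw [mul_mul_mul_comm, mul_comm ((z⁻¹ : (ZMod N)ˣ) : ZMod N), Units.mul_inv, mul_one]

/-- A discrete form of Young's inequality for convolutions, for an exponent at most one. -/
theorem sum_conv_rpow_le {c d : ZMod N → ℝ} (hc : ∀ a, 0 ≤ c a) (hd : ∀ a, 0 ≤ d a) {l : ℝ}
    (h0 : 0 < l) (h1 : l ≤ 1) :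
    ∑ a, (∑ b, c (a - b) * d b) ^ l ≤ (∑ a, c a ^ l) * ∑ b, d b ^ l := by
  calc ∑ a, (∑ b, c (a - b) * d b) ^ l
      ≤ ∑ a, ∑ b, c (a - b) ^ l * d b ^ l := Finset.sum_le_sum fun a _ =>
        (sum_rpow_le_sum _ (fun b _ => mul_nonneg (hc _) (hd _)) h0 h1).trans_eq
          (Finset.sum_congr rfl fun b _ => Real.mul_rpow (hc _) (hd _))
    _ = _ := by
        rw [Finset.sum_comm, Finset.mul_sum]
        refine Finset.sum_congr rfl fun b _ => ?_
        rw [← Finset.sum_mul, ← Equiv.sum_comp (Equiv.subRight b) (fun a => c a ^ l)]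
        rfl

theorem sum_mul_unit (c : ZMod N → ℝ) (z : (ZMod N)ˣ) : ∑ a, c (a * z) = ∑ a, c a :=
  Equiv.sum_comp (Units.mulRight z) c

/-- The mean of a product in terms of the Fourier coefficients. -/
theorem sum_mul_eq_sum_coeff {f g c d : ZMod N → ℝ} (hf : HasNonnegCoeff f c)
    (hg : HasNonnegCoeff g d) (z : (ZMod N)ˣ) :
    1 / (N : ℝ) * ∑ k, f k * g (k * z) = ∑ a, c a * d (-a * (z⁻¹ : (ZMod N)ˣ)) := by
  classical
  have h := (hf.mul (hg.comp_mul_unit z)).2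
  have hN : (N : ℂ) ≠ 0 := by exact_mod_cast NeZero.ne N
  have hN' : (N : ℝ) ≠ 0 := by exact_mod_cast NeZero.ne N
  have h2 : ((∑ k, f k * g (k * z) : ℝ) : ℂ)
      = ((N * ∑ b, c (0 - b) * d (b * (z⁻¹ : (ZMod N)ˣ)) : ℝ) : ℂ) := by
    rw [Complex.ofReal_sum, Finset.sum_congr rfl fun k _ => h k, Finset.sum_comm]
    simp only [← Finset.mul_sum, sum_stdAddChar]
    simp [mul_comm]
  rw [Complex.ofReal_injective h2, ← mul_assoc, one_div_mul_cancel hN', one_mul,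
    ← Equiv.sum_comp (Equiv.neg (ZMod N))]
  simp

/-- The sum of the `l`-th powers of the coefficients `p` of the product over the coordinates that are
already constructed is bounded independently of the generating vector. -/
theorem exists_coeff_prod {θ : ℕ → ℝ} {l : ℝ} (h0 : 1 / 2 < l) (h1 : l ≤ 1)
    (w : ℕ → (ZMod N)ˣ) (u : Finset ℕ) :
    ∃ p : ZMod N → ℝ, HasNonnegCoeff (fun k : ZMod N => ∏ j ∈ u,
        shiftKernel (θ j) (((k * w j).val : ℝ) / N)) p ∧
      ∑ a, p a ^ l ≤ ∏ j ∈ u, rho l (θ j) := by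
  classical
  induction u using Finset.induction_on with
  | empty =>
    refine ⟨_, by simpa using hasNonnegCoeff_one, ?_⟩
    rw [Finset.sum_eq_single 0]
    · simp
    · intro a _ ha
      rw [Pi.single_eq_of_ne ha, Real.zero_rpow (by linarith)]
    · simp
  | insert i u hi ih =>
    obtain ⟨p, hp, hps⟩ := ih
    have hk := (hasNonnegCoeff_shiftKernel (N := N) (θ i)).comp_mul_unit (w i)
    refine ⟨_, by simpa only [Finset.prod_insert hi] using hk.mul hp, ?_⟩
    refine (sum_conv_rpow_le hk.1 hp.1 (by linarith) h1).trans ?_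
    rw [Finset.prod_insert hi, sum_mul_unit (fun a => zmodCoeff N (θ i) a ^ l)]
    have h3 := sum_zmodCoeff_rpow_le (N := N) h0 h1 (θ i)
    have h4 : 0 ≤ ∑ a : ZMod N, zmodCoeff N (θ i) a ^ l :=
      Finset.sum_nonneg fun a _ => Real.rpow_nonneg (zmodCoeff_nonneg _ _) _
    exact mul_le_mul h3 hps (Finset.sum_nonneg fun a _ => Real.rpow_nonneg (hp.1 a) _) (h4.trans h3)

end Coeff

/-! ### The component-by-component construction -/

section CBC

variable {N : ℕ}

theorem IsAdmissible.isUnit {c : ℕ} (h : IsAdmissible N c) : IsUnit (c : ZMod N) :=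
  (ZMod.isUnit_iff_coprime c N).2 h.2.2

variable [NeZero N]

theorem sum_Icc_natCast {M : Type*} [AddCommMonoid M] (f : ZMod N → M) :
    ∑ k ∈ Finset.Icc 1 N, f (k : ZMod N) = ∑ a, f a := by
  have hN : 0 < N := Nat.pos_of_ne_zero (NeZero.ne N)
  refine Finset.sum_bij' (fun k _ => (k : ZMod N)) (fun a _ => if a = 0 then N else a.val)
    (fun _ _ => Finset.mem_univ _) (fun a _ => ?_) (fun k hk => ?_) (fun a _ => ?_) (fun _ _ => rfl)
  · split_ifs with ha
    · exact Finset.mem_Icc.2 ⟨hN, le_rfl⟩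
    · exact Finset.mem_Icc.2 ⟨Nat.pos_of_ne_zero fun h => ha ((ZMod.val_eq_zero a).1 h), a.val_lt.le⟩
  · obtain ⟨hk1, hk2⟩ := Finset.mem_Icc.1 hk
    rcases hk2.eq_or_lt with rfl | hlt
    · simp
    · have : (k : ZMod N) ≠ 0 := fun h => by
        have := (ZMod.natCast_eq_zero_iff k N).1 h
        exact absurd (Nat.le_of_dvd hk1 this) (by omega)
      simp [this, ZMod.val_natCast, Nat.mod_eq_of_lt hlt]
  · split_ifs with ha
    · simp [ha]
    · exact ZMod.natCast_zmod_val a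

theorem fract_intCast_div (n : ℤ) : Int.fract ((n : ℝ) / N) = ((n : ZMod N).val : ℝ) / N := by
  rw [Int.fract_div_intCast_eq_div_intCast_mod, ← ZMod.val_intCast]
  simp

theorem fract_natCast_mul_div (k c : ℕ) :
    Int.fract ((k : ℝ) * c / N) = (((k : ZMod N) * (c : ZMod N)).val : ℝ) / N := by
  have := fract_intCast_div (N := N) (k * c)
  simpa using this

/-- Every unit modulo `N` is represented by an admissible component; for `N = 1` the representative is
`1` and not `0`. -/
theorem exists_isAdmissible (w : (ZMod N)ˣ) : ∃ c, IsAdmissible N c ∧ (c : ZMod N) = w := by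
  have hN : 0 < N := Nat.pos_of_ne_zero (NeZero.ne N)
  by_cases h1 : N = 1
  · subst h1
    exact ⟨1, ⟨le_rfl, le_rfl, rfl⟩, Subsingleton.elim _ _⟩
  · have hv : ((w : ZMod N).val : ZMod N) = w := ZMod.natCast_zmod_val _
    have hc : Nat.Coprime (w : ZMod N).val N := ZMod.val_coe_unit_coprime w
    refine ⟨(w : ZMod N).val, ⟨Nat.pos_of_ne_zero fun h => h1 ?_, (ZMod.val_lt _).le, hc⟩, hv⟩
    rw [h] at hc
    simpa using hc

theorem isAdmissible_one : IsAdmissible N 1 :=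
  ⟨le_rfl, Nat.pos_of_ne_zero (NeZero.ne N), Nat.gcd_one_left N⟩

end CBC

theorem IsCBC.isUnit {N m : ℕ} {γ : Finset ℕ → ℝ} {θ : ℕ → ℝ} {z : ℕ → ℕ}
    (hz : IsCBC γ θ N m z) {j : ℕ} (hj : j < m) :
    IsUnit (z j : ZMod N) := by
  rcases Nat.eq_zero_or_pos j with rfl | h
  · rw [hz.1 hj]; simp
  · exact (hz.2 j h hj).1.isUnit

section CBCError

variable {N : ℕ} [NeZero N] (γ : Finset ℕ → ℝ) (θ : ℕ → ℝ)

/-- The square of the shift averaged worst case error, for a generating vector in `ℤ/N`. -/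
def latSq (w : ℕ → ZMod N) (d : ℕ) : ℝ :=
  ∑ u ∈ (Finset.range d).powerset with u.Nonempty, γ u * (1 / (N : ℝ) *
    ∑ k : ZMod N, ∏ j ∈ u, shiftKernel (θ j) (((k * w j).val : ℝ) / N))

/-- The contribution of the coordinate `d` with component `z` to `latSq`. -/
def latStep (w : ℕ → ZMod N) (d : ℕ) (z : ZMod N) : ℝ :=
  ∑ u ∈ (Finset.range d).powerset, γ (insert d u) * (1 / (N : ℝ) *
    ∑ k : ZMod N, (∏ j ∈ u, shiftKernel (θ j) (((k * w j).val : ℝ) / N)) *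
      shiftKernel (θ d) (((k * z).val : ℝ) / N))

theorem shiftAvgError_eq_sqrt (d : ℕ) (z : ℕ → ℕ) :
    shiftAvgError γ θ N d z = √(latSq γ θ (fun j => (z j : ZMod N)) d) := by
  rw [shiftAvgError, latSq]
  congr 1
  rw [Finset.sum_comm, Finset.mul_sum]
  refine Finset.sum_congr rfl fun u _ => ?_
  simp only [fract_natCast_mul_div]
  rw [sum_Icc_natCast (fun k : ZMod N => γ u * ∏ j ∈ u,
    shiftKernel (θ j) (((k * (z j : ZMod N)).val : ℝ) / N)), ← Finset.mul_sum]
  ring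

variable {γ θ}

theorem latSq_congr {w w' : ℕ → ZMod N} {d : ℕ} (h : ∀ j < d, w j = w' j) :
    latSq γ θ w d = latSq γ θ w' d := by
  refine Finset.sum_congr rfl fun u hu => ?_
  have hu' := Finset.mem_powerset.1 (Finset.mem_filter.1 hu).1
  congr 2
  refine Finset.sum_congr rfl fun k _ => Finset.prod_congr rfl fun j hj => ?_
  rw [h j (Finset.mem_range.1 (hu' hj))]

theorem latStep_congr {w w' : ℕ → ZMod N} {d : ℕ} (h : ∀ j < d, w j = w' j) (z : ZMod N) :
    latStep γ θ w d z = latStep γ θ w' d z := by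
  refine Finset.sum_congr rfl fun u hu => ?_
  have hu' := Finset.mem_powerset.1 hu
  congr 2
  refine Finset.sum_congr rfl fun k _ => ?_
  congr 1
  refine Finset.prod_congr rfl fun j hj => ?_
  rw [h j (Finset.mem_range.1 (hu' hj))]

theorem latSq_zero (w : ℕ → ZMod N) : latSq γ θ w 0 = 0 := by
  rw [latSq, Finset.sum_filter]; simp

theorem sum_nonempty_powerset_range_succ (f : Finset ℕ → ℝ) (d : ℕ) :
    ∑ u ∈ (Finset.range (d + 1)).powerset with u.Nonempty, f u
      = (∑ u ∈ (Finset.range d).powerset with u.Nonempty, f u)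
        + ∑ u ∈ (Finset.range d).powerset, f (insert d u) := by
  rw [Finset.sum_filter, Finset.range_add_one, Finset.sum_powerset_insert Finset.notMem_range_self,
    ← Finset.sum_filter]
  simp

theorem latSq_succ (w : ℕ → ZMod N) (d : ℕ) :
    latSq γ θ w (d + 1) = latSq γ θ w d + latStep γ θ w d (w d) := by
  rw [latSq, sum_nonempty_powerset_range_succ, ← latSq, latStep]
  congr 1
  refine Finset.sum_congr rfl fun u hu => ?_
  have hd : d ∉ u := fun h => absurd (Finset.mem_range.1 (Finset.mem_powerset.1 hu h)) (lt_irrefl d)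
  simp only [Finset.prod_insert hd, mul_comm (shiftKernel (θ d) _)]

/-- The first component may be fixed to be `1`, as all units give the same error in dimension one. -/
theorem latStep_zero (w : ℕ → ZMod N) (z : (ZMod N)ˣ) :
    latStep γ θ w 0 z = latStep γ θ w 0 1 := by
  simp only [latStep, Finset.range_zero, Finset.powerset_empty, Finset.sum_singleton,
    Finset.prod_empty, one_mul, mul_one]
  congr 2
  exact Equiv.sum_comp (Units.mulRight z) (fun k : ZMod N => shiftKernel (θ 0) ((k.val : ℝ) / N))

/-- The mean over the admissible components of the contribution of one coordinate. -/
theorem latStep_bounds (hγ : ∀ u, 0 ≤ γ u) {l : ℝ} (h0 : 1 / 2 < l) (h1 : l ≤ 1)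
    (w : ℕ → (ZMod N)ˣ) (d : ℕ) :
    (∀ z : (ZMod N)ˣ, 0 ≤ latStep γ θ (fun j => (w j : ZMod N)) d z) ∧
      ∑ z : (ZMod N)ˣ, latStep γ θ (fun j => (w j : ZMod N)) d z ^ l
        ≤ ∑ u ∈ (Finset.range d).powerset, γ (insert d u) ^ l * ∏ j ∈ insert d u, rho l (θ j) := by
  choose p hp hps using fun u => exists_coeff_prod (N := N) (θ := θ) h0 h1 w u
  have hc := hasNonnegCoeff_shiftKernel (N := N) (θ d)
  set c := zmodCoeff N (θ d) with hcdef
  have hl : 0 < l := by linarith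
  have e : ∀ z : (ZMod N)ˣ, latStep γ θ (fun j => (w j : ZMod N)) d z = ∑ u ∈ (Finset.range d).powerset,
      γ (insert d u) * ∑ a, p u a * c (-a * (z⁻¹ : (ZMod N)ˣ)) := fun z => by
    refine Finset.sum_congr rfl fun u _ => ?_
    rw [← sum_mul_eq_sum_coeff (hp u) hc z]
  have hs0 : ∀ u (z : (ZMod N)ˣ), 0 ≤ ∑ a, p u a * c (-a * (z⁻¹ : (ZMod N)ˣ)) := fun u z =>
    Finset.sum_nonneg fun a _ => mul_nonneg ((hp u).1 a) (hc.1 _)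
  refine ⟨fun z => ?_, ?_⟩
  · rw [e]
    exact Finset.sum_nonneg fun u _ => mul_nonneg (hγ _) (hs0 u z)
  calc ∑ z : (ZMod N)ˣ, latStep γ θ (fun j => (w j : ZMod N)) d z ^ l
      ≤ ∑ z : (ZMod N)ˣ, ∑ u ∈ (Finset.range d).powerset, γ (insert d u) ^ l *
          ∑ a, p u a ^ l * c (-a * (z⁻¹ : (ZMod N)ˣ)) ^ l := by
        refine Finset.sum_le_sum fun z _ => ?_
        rw [e]
        refine (sum_rpow_le_sum _ (fun u _ => mul_nonneg (hγ _) (hs0 u z)) hl h1).trans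
          (Finset.sum_le_sum fun u _ => ?_)
        rw [Real.mul_rpow (hγ _) (hs0 u z)]
        refine mul_le_mul_of_nonneg_left ?_ (Real.rpow_nonneg (hγ _) _)
        refine (sum_rpow_le_sum _ (fun a _ => mul_nonneg ((hp u).1 a) (hc.1 _)) hl h1).trans_eq
          (Finset.sum_congr rfl fun a _ => Real.mul_rpow ((hp u).1 a) (hc.1 _))
    _ = ∑ u ∈ (Finset.range d).powerset, γ (insert d u) ^ l *
          ∑ a, p u a ^ l * ∑ z : (ZMod N)ˣ, c (-a * z) ^ l := by
        rw [Finset.sum_comm]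
        refine Finset.sum_congr rfl fun u _ => ?_
        rw [← Finset.mul_sum, Finset.sum_comm]
        congr 1
        refine Finset.sum_congr rfl fun a _ => ?_
        rw [← Finset.mul_sum, ← Equiv.sum_comp (Equiv.inv (ZMod N)ˣ)]
        simp
    _ ≤ ∑ u ∈ (Finset.range d).powerset, γ (insert d u) ^ l * ∏ j ∈ insert d u, rho l (θ j) := by
        refine Finset.sum_le_sum fun u hu => ?_
        have hd : d ∉ u := fun h =>
          absurd (Finset.mem_range.1 (Finset.mem_powerset.1 hu h)) (lt_irrefl d)
        refine mul_le_mul_of_nonneg_left ?_ (Real.rpow_nonneg (hγ _) _)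
        rw [Finset.prod_insert hd, mul_comm (rho l (θ d))]
        have hr : 0 ≤ rho l (θ d) := (Finset.sum_nonneg fun a _ =>
          Real.rpow_nonneg (zmodCoeff_nonneg _ _) _).trans (sum_zmodCoeff_rpow_le (N := N) h0 h1 _)
        calc _ ≤ ∑ a, p u a ^ l * rho l (θ d) := Finset.sum_le_sum fun a _ =>
              mul_le_mul_of_nonneg_left (sum_units_zmodCoeff_rpow_le h0 h1 (θ d) (-a))
                (Real.rpow_nonneg ((hp u).1 a) _)
          _ = (∑ a, p u a ^ l) * rho l (θ d) := (Finset.sum_mul _ _ _).symm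
          _ ≤ _ := mul_le_mul_of_nonneg_right (hps u) hr

theorem latSq_nonneg (hγ : ∀ u, 0 ≤ γ u) {l : ℝ} (h0 : 1 / 2 < l) (h1 : l ≤ 1)
    (w : ℕ → (ZMod N)ˣ) (d : ℕ) : 0 ≤ latSq γ θ (fun j => (w j : ZMod N)) d := by
  induction d with
  | zero => rw [latSq_zero]
  | succ d ih => rw [latSq_succ]; exact add_nonneg ih ((latStep_bounds hγ h0 h1 w d).1 _)

theorem rho_nonneg {l : ℝ} (h0 : 1 / 2 < l) (h1 : l ≤ 1) (t : ℝ) : 0 ≤ rho l t :=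
  (Finset.sum_nonneg fun _ _ => Real.rpow_nonneg (zmodCoeff_nonneg _ _) _).trans
    (sum_zmodCoeff_rpow_le (N := 1) h0 h1 t)

/-- A greedy choice of the components gives nearly the optimal rate of convergence. -/
theorem latSq_le (hγ : ∀ u, 0 ≤ γ u) {l : ℝ} (h0 : 1 / 2 < l) (h1 : l ≤ 1) (w : ℕ → (ZMod N)ˣ)
    (d : ℕ) (hmin : ∀ k < d, ∀ z : (ZMod N)ˣ,
      latStep γ θ (fun j => (w j : ZMod N)) k (w k) ≤ latStep γ θ (fun j => (w j : ZMod N)) k z) :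
    latSq γ θ (fun j => (w j : ZMod N)) d ≤ (1 / (N.totient : ℝ) *
      ∑ u ∈ (Finset.range d).powerset with u.Nonempty, γ u ^ l * ∏ j ∈ u, rho l (θ j)) ^ (1 / l) := by
  have hl : 0 < l := by linarith
  have hN : 0 < N := Nat.pos_of_ne_zero (NeZero.ne N)
  have hφ : (0 : ℝ) < N.totient := by exact_mod_cast Nat.totient_pos.2 hN
  have hnn : ∀ u : Finset ℕ, 0 ≤ γ u ^ l * ∏ j ∈ u, rho l (θ j) := fun u =>
    mul_nonneg (Real.rpow_nonneg (hγ _) _) (Finset.prod_nonneg fun j _ => rho_nonneg h0 h1 _)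
  induction d with
  | zero =>
    rw [latSq_zero]
    exact Real.rpow_nonneg (mul_nonneg (by positivity) (Finset.sum_nonneg fun u _ => hnn u)) _
  | succ d ih =>
    have ih1 := ih fun k hk => hmin k (hk.trans d.lt_succ_self)
    obtain ⟨hs0, hs1⟩ := latStep_bounds (θ := θ) hγ h0 h1 w d
    rw [latSq_succ]
    set X := latStep γ θ (fun j => (w j : ZMod N)) d (w d) with hX
    -- the minimum over the units is at most the mean
    have hX1 : X ^ l ≤ 1 / (N.totient : ℝ) * ∑ u ∈ (Finset.range d).powerset,
        γ (insert d u) ^ l * ∏ j ∈ insert d u, rho l (θ j) := by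
      rw [one_div, inv_mul_eq_div, le_div_iff₀ hφ]
      refine le_trans ?_ hs1
      have : ∑ _z : (ZMod N)ˣ, X ^ l = X ^ l * N.totient := by
        rw [Finset.sum_const, Finset.card_univ, ZMod.card_units_eq_totient, nsmul_eq_mul, mul_comm]
      rw [← this]
      exact Finset.sum_le_sum fun z _ => Real.rpow_le_rpow (hs0 _) (hmin d d.lt_succ_self z) hl.le
    have hX2 : X ≤ (1 / (N.totient : ℝ) * ∑ u ∈ (Finset.range d).powerset,
        γ (insert d u) ^ l * ∏ j ∈ insert d u, rho l (θ j)) ^ (1 / l) := by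
      have := Real.rpow_le_rpow (Real.rpow_nonneg (hs0 _) _) hX1 (one_div_pos.2 hl).le
      rwa [← Real.rpow_mul (hs0 _), mul_one_div_cancel hl.ne', Real.rpow_one] at this
    refine (add_le_add ih1 hX2).trans ?_
    rw [sum_nonempty_powerset_range_succ, mul_add]
    exact add_rpow_le_of_one_le
      (mul_nonneg (by positivity) (Finset.sum_nonneg fun u _ => hnn u))
      (mul_nonneg (by positivity) (Finset.sum_nonneg fun u _ => hnn _))
      ((one_le_div hl).2 h1)

/-- The error bound for the component-by-component construction. -/
theorem IsCBC.shiftAvgError_sq_le {m : ℕ} {z : ℕ → ℕ} (hz : IsCBC γ θ N m z) (hγ : ∀ u, 0 ≤ γ u)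
    {l : ℝ} (h0 : 1 / 2 < l) (h1 : l ≤ 1) :
    0 ≤ latSq γ θ (fun j => (z j : ZMod N)) m ∧
    latSq γ θ (fun j => (z j : ZMod N)) m ≤ (1 / (N.totient : ℝ) *
      ∑ u ∈ (Finset.range m).powerset with u.Nonempty, γ u ^ l * ∏ j ∈ u, rho l (θ j)) ^ (1 / l) := by
  classical
  set w : ℕ → (ZMod N)ˣ := fun j => if h : j < m then (hz.isUnit h).unit else 1 with hw
  have hwz : ∀ j < m, (w j : ZMod N) = z j := fun j hj => by simp [hw, hj]
  rw [← latSq_congr (w := fun j => (w j : ZMod N)) hwz]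
  refine ⟨latSq_nonneg hγ h0 h1 w m, latSq_le hγ h0 h1 w m fun k hk x => ?_⟩
  rcases Nat.eq_zero_or_pos k with rfl | hk0
  · rw [latStep_zero, latStep_zero]
  · obtain ⟨c, hc, hcx⟩ := exists_isAdmissible x
    have h2 := (hz.2 k hk0 hk).2 c hc
    rw [shiftAvgError_eq_sqrt, shiftAvgError_eq_sqrt, latSq_succ, latSq_succ] at h2
    have e0 : latSq γ θ (fun j => (Function.update z k c j : ZMod N)) k
        = latSq γ θ (fun j => (w j : ZMod N)) k := latSq_congr fun j hj => by
      rw [Function.update_of_ne hj.ne, hwz j (hj.trans hk)]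
    have e1 : latSq γ θ (fun j => (z j : ZMod N)) k = latSq γ θ (fun j => (w j : ZMod N)) k :=
      latSq_congr fun j hj => (hwz j (hj.trans hk)).symm
    have e2 : latStep γ θ (fun j => (Function.update z k c j : ZMod N)) k
          ((Function.update z k c k : ℕ) : ZMod N)
        = latStep γ θ (fun j => (w j : ZMod N)) k x := by
      rw [Function.update_self, hcx]
      exact latStep_congr (fun j hj => by rw [Function.update_of_ne hj.ne, hwz j (hj.trans hk)]) _
    have e3 : latStep γ θ (fun j => (z j : ZMod N)) k (z k)
        = latStep γ θ (fun j => (w j : ZMod N)) k (w k) := by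
      rw [hwz k hk]
      exact latStep_congr (fun j hj => (hwz j (hj.trans hk)).symm) _
    rw [e0, e1, e2, e3] at h2
    have hpos : 0 ≤ latSq γ θ (fun j => (w j : ZMod N)) k :=
      latSq_nonneg hγ h0 h1 w k
    have h3 := (Real.sqrt_le_sqrt_iff (add_nonneg hpos ((latStep_bounds hγ h0 h1 w k).1 x))).1 h2
    linarith

theorem exists_isCBC (m : ℕ) : ∃ z : ℕ → ℕ, IsCBC γ θ N m z := by
  induction m with
  | zero => exact ⟨fun _ => 1, fun h => absurd h (lt_irrefl _), fun k _ h => absurd h (by omega)⟩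
  | succ m ih =>
    obtain ⟨z, hz⟩ := ih
    rcases Nat.eq_zero_or_pos m with rfl | hm
    · exact ⟨fun _ => 1, fun _ => rfl, fun k hk h => absurd h (by omega)⟩
    have hfin : (Set.Finite {c | IsAdmissible N c}) :=
      (Set.finite_Icc 1 N).subset fun c hc => ⟨hc.1, hc.2.1⟩
    obtain ⟨c, hc, hmin⟩ := Set.exists_min_image _
      (fun c => shiftAvgError γ θ N (m + 1) (Function.update z m c)) hfin
      ⟨1, isAdmissible_one⟩
    refine ⟨Function.update z m c, fun _ => ?_, fun k hk1 hk => ?_⟩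
    · rw [Function.update_of_ne hm.ne]; exact hz.1 hm
    rcases (Nat.lt_succ_iff.1 hk).eq_or_lt with rfl | hkm
    · rw [Function.update_self]
      refine ⟨hc, fun c' hc' => ?_⟩
      rw [Function.update_idem]
      exact hmin c' hc'
    · have h := hz.2 k hk1 hkm
      rw [Function.update_of_ne hkm.ne]
      refine ⟨h.1, fun c' hc' => ?_⟩
      have hcongr : ∀ z' : ℕ → ℕ, shiftAvgError γ θ N (k + 1) (Function.update z' m c)
          = shiftAvgError γ θ N (k + 1) z' := fun z' => by
        rw [shiftAvgError_eq_sqrt, shiftAvgError_eq_sqrt, latSq_congr fun j hj => ?_]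
        rw [Function.update_of_ne (by omega)]
      rw [Function.update_comm hkm.ne', hcongr, hcongr]
      exact h.2 c' hc'

end CBCError

/-! ### Sums over subsets -/

/-- The first two terms of the binomial expansion. -/
theorem pow_succ_add_le {S x : ℝ} (hS : 0 ≤ S) (hx : 0 ≤ x) (n : ℕ) :
    S ^ (n + 1) + (n + 1) * x * S ^ n ≤ (S + x) ^ (n + 1) := by
  induction n with
  | zero => simp
  | succ n ih =>
    calc S ^ (n + 1 + 1) + ((n + 1 : ℕ) + 1) * x * S ^ (n + 1)
        ≤ (S ^ (n + 1) + (n + 1) * x * S ^ n) * (S + x) := by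
          have : 0 ≤ (n + 1) * x * S ^ n * x := by positivity
          push_cast
          ring_nf at this ⊢
          linarith
      _ ≤ (S + x) ^ (n + 1) * (S + x) := by gcongr
      _ = _ := (pow_succ _ _).symm

/-- The elementary symmetric polynomials of nonnegative numbers are at most `S ^ k / k!`, where `S`
is the sum of the numbers. -/
theorem sum_powersetCard_prod_le (s : Finset ℕ) {a : ℕ → ℝ} (ha : ∀ j, 0 ≤ a j) (k : ℕ) :
    ∑ u ∈ s.powersetCard k, ∏ j ∈ u, a j ≤ (∑ j ∈ s, a j) ^ k / (k.factorial : ℝ) := by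
  induction s using Finset.induction_on generalizing k with
  | empty =>
    cases k with
    | zero => simp
    | succ k => rw [Finset.powersetCard_eq_empty.2 (by simp)]; simp
  | insert i s hi ih =>
    cases k with
    | zero => simp
    | succ k =>
      have hS : 0 ≤ ∑ j ∈ s, a j := Finset.sum_nonneg fun j _ => ha j
      have hd : Disjoint (s.powersetCard (k + 1)) ((s.powersetCard k).image (insert i)) := by
        rw [Finset.disjoint_left]
        intro u hu hu'
        obtain ⟨v, -, rfl⟩ := Finset.mem_image.1 hu'
        exact hi ((Finset.mem_powersetCard.1 hu).1 (Finset.mem_insert_self i v))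
      have hni : ∀ v ∈ s.powersetCard k, i ∉ v := fun v hv h => hi ((Finset.mem_powersetCard.1 hv).1 h)
      rw [Finset.powersetCard_succ_insert hi, Finset.sum_union hd, Finset.sum_image, Finset.sum_insert hi]
      · have e : ∑ v ∈ s.powersetCard k, ∏ j ∈ insert i v, a j
            = a i * ∑ v ∈ s.powersetCard k, ∏ j ∈ v, a j := by
          rw [Finset.mul_sum]
          exact Finset.sum_congr rfl fun v hv => Finset.prod_insert (hni v hv)
        rw [e]
        calc _ ≤ (∑ j ∈ s, a j) ^ (k + 1) / ((k + 1).factorial : ℝ)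
              + a i * ((∑ j ∈ s, a j) ^ k / (k.factorial : ℝ)) :=
              add_le_add (ih _) (mul_le_mul_of_nonneg_left (ih _) (ha i))
          _ = ((∑ j ∈ s, a j) ^ (k + 1) + (k + 1) * a i * (∑ j ∈ s, a j) ^ k)
              / ((k + 1).factorial : ℝ) := by
              rw [Nat.factorial_succ]; push_cast; field_simp
          _ ≤ _ := by
              rw [add_comm (a i)]
              gcongr
              exact pow_succ_add_le hS (ha i) k
      · intro v hv w hw h
        rw [← Finset.erase_insert (hni v hv), h, Finset.erase_insert (hni w hw)]

/-- Sums over subsets of products with an order dependent factor, grouped by cardinality. -/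
theorem sum_powerset_prod_le (s : Finset ℕ) {a : ℕ → ℝ} (ha : ∀ j, 0 ≤ a j) {S : ℝ}
    (hS : ∑ j ∈ s, a j ≤ S) {g : ℕ → ℝ} (hg : ∀ k, 0 ≤ g k)
    (hsum : Summable fun k => g k * (S ^ k / (k.factorial : ℝ))) :
    ∑ u ∈ s.powerset, g u.card * ∏ j ∈ u, a j ≤ ∑' k, g k * (S ^ k / (k.factorial : ℝ)) := by
  have h0 : 0 ≤ ∑ j ∈ s, a j := Finset.sum_nonneg fun j _ => ha j
  have hS0 : 0 ≤ S := h0.trans hS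
  rw [Finset.sum_powerset]
  refine le_trans (Finset.sum_le_sum fun k _ => ?_)
    (hsum.sum_le_tsum (Finset.range (s.card + 1)) fun k _ => mul_nonneg (hg k) (by positivity))
  rw [Finset.sum_congr rfl fun u hu => by rw [(Finset.mem_powersetCard.1 hu).2], ← Finset.mul_sum]
  refine mul_le_mul_of_nonneg_left ((sum_powersetCard_prod_le s ha k).trans ?_) (hg k)
  gcongr

/-- The ratio of consecutive terms is of size `S k ^ (p - 1)`. -/
theorem summable_factorial_rpow {p S : ℝ} (hp0 : 0 < p) (hS : 0 ≤ S) (h : p < 1 ∨ p = 1 ∧ S < 1) :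
    Summable fun k : ℕ => ((k + 1).factorial : ℝ) ^ p * (S ^ k / (k.factorial : ℝ)) := by
  rcases h with hp | ⟨rfl, hS1⟩
  · rcases hS.eq_or_lt with rfl | hS
    · exact summable_of_ne_finset_zero (s := {0}) fun k hk => by
        rw [zero_pow (by simpa using hk), zero_div, mul_zero]
    have hlim : Filter.Tendsto (fun k : ℕ => 2 * S * ((k : ℝ) + 1) ^ (-(1 - p))) .atTop (nhds 0) := by
      have h1 : Filter.Tendsto (fun k : ℕ => (k : ℝ) + 1) .atTop .atTop :=
        Filter.tendsto_atTop_add_const_right _ _ tendsto_natCast_atTop_atTop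
      simpa using ((tendsto_rpow_neg_atTop (by linarith : 0 < 1 - p)).comp h1).const_mul (2 * S)
    refine summable_of_ratio_norm_eventually_le (r := 1 / 2) (by norm_num) ?_
    filter_upwards [hlim.eventually (ge_mem_nhds (by norm_num : (0 : ℝ) < 1 / 2))] with k hk
    rw [Real.norm_of_nonneg (by positivity), Real.norm_of_nonneg (by positivity)]
    have e : ((k + 1 + 1).factorial : ℝ) ^ p * (S ^ (k + 1) / ((k + 1).factorial : ℝ))
        = (((k : ℝ) + 2) ^ p * S / ((k : ℝ) + 1)) *
          (((k + 1).factorial : ℝ) ^ p * (S ^ k / (k.factorial : ℝ))) := by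
      rw [Nat.factorial_succ (k + 1), Nat.cast_mul, Real.mul_rpow (by positivity) (by positivity),
        Nat.factorial_succ k]
      push_cast
      rw [show (k : ℝ) + 1 + 1 = k + 2 by ring, pow_succ]
      field_simp
    rw [e]
    refine mul_le_mul_of_nonneg_right (le_trans ?_ hk) (by positivity)
    have h2 : ((k : ℝ) + 2) ^ p ≤ 2 * ((k : ℝ) + 1) ^ p := by
      calc ((k : ℝ) + 2) ^ p ≤ (2 * ((k : ℝ) + 1)) ^ p :=
            Real.rpow_le_rpow (by positivity) (by linarith [k.cast_nonneg (α := ℝ)]) hp0.le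
        _ = 2 ^ p * ((k : ℝ) + 1) ^ p := Real.mul_rpow (by norm_num) (by positivity)
        _ ≤ 2 ^ (1 : ℝ) * ((k : ℝ) + 1) ^ p := by
            gcongr
            norm_num
        _ = _ := by rw [Real.rpow_one]
    rw [neg_sub, Real.rpow_sub (by positivity), Real.rpow_one]
    calc _ ≤ 2 * ((k : ℝ) + 1) ^ p * S / ((k : ℝ) + 1) := by gcongr
      _ = _ := by ring
  -- the terms are `(k + 1) S ^ k`
  · have h1 := (summable_pow_mul_geometric_of_norm_lt_one 1 (r := S)
      (by rwa [Real.norm_of_nonneg hS])).add (summable_geometric_of_lt_one hS hS1)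
    refine h1.congr fun k => ?_
    rw [Real.rpow_one, Nat.factorial_succ]
    push_cast
    field_simp

/-! ### The weights -/

section Weights

variable {p δ : ℝ}

theorem lamStar_mem (hp_le : p ≤ 1) (hδ_pos : 0 < δ) (hδ_le : δ ≤ 1 / 2) :
    1 / 2 < lamStar p δ ∧ lamStar p δ ≤ 1 := by
  unfold lamStar
  split_ifs with h
  · constructor
    · rw [lt_div_iff₀ (by linarith)]; linarith
    · rw [div_le_one (by linarith)]; linarith
  · constructor
    · rw [lt_div_iff₀ (by linarith)]; linarith
    · rw [div_le_one (by linarith)]; linarith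

theorem rate_eq (hp_le : p ≤ 1) (hδ_le : δ ≤ 1 / 2) :
    rate p δ = 1 / (2 * lamStar p δ) := by
  unfold rate lamStar
  split_ifs with h
  · have : 2 - 2 * δ ≠ 0 := by linarith
    field_simp
  · have : 2 - p ≠ 0 := by linarith
    have : p ≠ 0 := by linarith
    field_simp

/-- The exponent `2 λ / (1 + λ)` of `b_j` in the weighted sums is at least `p`. -/
theorem le_two_mul_lamStar_div (hp_pos : 0 < p) (hp_le : p ≤ 1) (hδ_pos : 0 < δ)
    (hδ_le : δ ≤ 1 / 2) : p ≤ 2 * lamStar p δ / (1 + lamStar p δ) := by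
  have hl := lamStar_mem hp_le hδ_pos hδ_le
  by_cases h : p ≤ 2 / 3
  · rw [le_div_iff₀ (by linarith)]
    nlinarith
  · rw [lamStar, if_neg h]
    have : 2 - p ≠ 0 := by linarith
    refine le_of_eq ?_
    field_simp
    ring

variable {b : ℕ → ℝ} {l : ℝ}

theorem rho_pos (h0 : 1 / 2 < l) (h1 : l ≤ 1) (t : ℝ) : 0 < rho l t := by
  obtain ⟨hη0, hη1⟩ := etaStar_mem h0 h1
  have hs := hasSum_abs_int_rpow (x := l + 1 / 2) (by linarith)
  have : 0 < 2 * (riemannZeta ((l + 1 / 2 : ℝ) : ℂ)).re := by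
    have := hs.summable.le_tsum 1 fun h _ => Real.rpow_nonneg (abs_nonneg _) _
    rw [hs.tsum_eq] at this
    simp only [Int.cast_one, abs_one, Real.one_rpow] at this
    linarith
  rw [rho_eq]
  exact mul_pos (Real.rpow_pos_of_pos (decayConst_pos hη0 (by linarith) t) _) this

theorem rho_le_rho (h0 : 1 / 2 < l) (h1 : l ≤ 1) {t t' : ℝ} (ht : 0 ≤ t) (htt : t ≤ t') :
    rho l t ≤ rho l t' := by
  obtain ⟨hη0, hη1⟩ := etaStar_mem h0 h1
  have hη2 : 0 < 1 - etaStar l := by linarith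
  have hz : 0 ≤ 2 * (riemannZeta ((l + 1 / 2 : ℝ) : ℂ)).re := by
    have hs := hasSum_abs_int_rpow (x := l + 1 / 2) (by linarith)
    rw [← hs.tsum_eq]
    exact tsum_nonneg fun h => Real.rpow_nonneg (abs_nonneg _) _
  rw [rho_eq, rho_eq]
  refine mul_le_mul_of_nonneg_right (Real.rpow_le_rpow
    (decayConst_pos hη0 (by linarith) t).le ?_ (by linarith)) hz
  unfold decayConst
  gcongr

theorem thetaSeq_sub_pos (h0 : 1 / 2 < l) (j : ℕ) :
    0 < thetaSeq b l j - b j := by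
  have hc : 1 / (2 * l) < 1 := by rw [div_lt_one (by linarith)]; linarith
  have : b j < √(b j ^ 2 + 1 - 1 / (2 * l)) := Real.lt_sqrt_of_sq_lt (by linarith)
  rw [thetaSeq]
  linarith

/-- Rationalizing the root shows that `θ_j - b_j` is bounded below if `b` is bounded. -/
theorem thetaSeq_sub_ge (h0 : 1 / 2 < l) (hb : ∀ j, 0 ≤ b j) {B : ℝ} (hB : ∀ j, b j ≤ B) :
    ∃ d > 0, ∀ j, d ≤ thetaSeq b l j - b j := by
  have hc : 1 / (2 * l) < 1 := by rw [div_lt_one (by linarith)]; linarith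
  set c := 1 - 1 / (2 * l) with hcdef
  have hc0 : 0 < c := by linarith
  have hB0 : 0 ≤ B := (hb 0).trans (hB 0)
  refine ⟨c / (2 * (√(B ^ 2 + c) + B)), by positivity, fun j => ?_⟩
  have hj := hb j
  have hs : √(b j ^ 2 + c) ^ 2 = b j ^ 2 + c := Real.sq_sqrt (by positivity)
  have e : thetaSeq b l j - b j = c / (2 * (√(b j ^ 2 + c) + b j)) := by
    have : 0 < √(b j ^ 2 + c) := Real.sqrt_pos.2 (by positivity)
    rw [thetaSeq, add_sub_assoc, ← hcdef, eq_div_iff (by positivity)]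
    linear_combination hs
  rw [e]
  have := hB j
  gcongr

theorem thetaSeq_le (h0 : 1 / 2 < l) (hb : ∀ j, 0 ≤ b j) (j : ℕ) :
    0 ≤ thetaSeq b l j ∧ thetaSeq b l j ≤ b j + 1 := by
  have hj := hb j
  have hc : 0 < 1 / (2 * l) := by positivity
  have : √(b j ^ 2 + 1 - 1 / (2 * l)) ≤ b j + 1 := Real.sqrt_le_iff.2 ⟨by linarith, by nlinarith⟩
  have := Real.sqrt_nonneg (b j ^ 2 + 1 - 1 / (2 * l))
  rw [thetaSeq]
  constructor <;> linarith

end Weights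

section PodWeights

variable {b : ℕ → ℝ} {T l p : ℝ}

/-- The factor that the index `j` contributes to `γ_u^λ ∏_{j ∈ u} ϱ_j`. -/
def weightFactor (T : ℝ) (b : ℕ → ℝ) (l : ℝ) (j : ℕ) : ℝ :=
  (4 * cT T) ^ (2 * l / (1 + l)) *
    ((b j ^ 2 / ((thetaSeq b l j - b j) * rho l (thetaSeq b l j))) ^ (l / (1 + l)) *
      rho l (thetaSeq b l j))

theorem one_le_cT (T : ℝ) : 1 ≤ cT T := le_max_left _ _

theorem orderConst_pos (T : ℝ) (k : ℕ) : 0 < orderConst T k := by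
  have := one_le_cT T
  unfold orderConst
  positivity

theorem podBase_nonneg (h0 : 1 / 2 < l) (h1 : l ≤ 1) (j : ℕ) :
    0 ≤ b j ^ 2 / ((thetaSeq b l j - b j) * rho l (thetaSeq b l j)) :=
  div_nonneg (sq_nonneg _) (mul_nonneg (thetaSeq_sub_pos h0 j).le (rho_pos h0 h1 _).le)

theorem podWeight_nonneg (h0 : 1 / 2 < l) (h1 : l ≤ 1) (u : Finset ℕ) : 0 ≤ podWeight T b l u :=
  Real.rpow_nonneg (mul_nonneg (orderConst_pos T _).le
    (Finset.prod_nonneg fun j _ => podBase_nonneg h0 h1 j)) _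

theorem podWeight_rpow (h0 : 1 / 2 < l) (h1 : l ≤ 1) (u : Finset ℕ) (x : ℝ) :
    podWeight T b l u ^ x = (orderConst T u.card *
      ∏ j ∈ u, b j ^ 2 / ((thetaSeq b l j - b j) * rho l (thetaSeq b l j))) ^ (x / (1 + l)) := by
  rw [podWeight, ← Real.rpow_mul (mul_nonneg (orderConst_pos T _).le
    (Finset.prod_nonneg fun j _ => podBase_nonneg h0 h1 j))]
  congr 1
  ring

/-- The weights balance the two factors of the error bound. -/
theorem podWeight_mul (h0 : 1 / 2 < l) (h1 : l ≤ 1) (u : Finset ℕ) :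
    orderConst T u.card * ∏ j ∈ u, b j ^ 2 / (thetaSeq b l j - b j) =
      podWeight T b l u * (podWeight T b l u ^ l * ∏ j ∈ u, rho l (thetaSeq b l j)) := by
  have h2 : podWeight T b l u * podWeight T b l u ^ l = podWeight T b l u ^ (1 + l) := by
    rw [Real.rpow_add_of_nonneg (podWeight_nonneg h0 h1 u) zero_le_one (by linarith),
      Real.rpow_one]
  rw [← mul_assoc, h2, podWeight_rpow h0 h1, div_self (by linarith), Real.rpow_one, mul_assoc,
    ← Finset.prod_mul_distrib]
  congr 1
  refine Finset.prod_congr rfl fun j _ => ?_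
  have := (rho_pos h0 h1 (thetaSeq b l j)).ne'
  have := (thetaSeq_sub_pos (b := b) h0 j).ne'
  field_simp

/-- The order dependent and the product part of `γ_u^λ ∏_{j ∈ u} ϱ_j`. -/
theorem podWeight_rpow_mul_prod (h0 : 1 / 2 < l) (h1 : l ≤ 1) (u : Finset ℕ) :
    podWeight T b l u ^ l * ∏ j ∈ u, rho l (thetaSeq b l j) =
      ((u.card + 1).factorial : ℝ) ^ (2 * l / (1 + l)) * ∏ j ∈ u, weightFactor T b l j := by
  have hcT := one_le_cT T
  have e1 : orderConst T u.card ^ (l / (1 + l)) = ((u.card + 1).factorial : ℝ) ^ (2 * l / (1 + l)) *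
      ((4 * cT T) ^ (2 * l / (1 + l))) ^ u.card := by
    rw [orderConst, mul_comm 2 u.card, pow_mul, Real.mul_rpow (by positivity) (by positivity),
      ← Real.rpow_natCast _ 2, ← Real.rpow_mul (by positivity), ← Real.rpow_natCast _ 2,
      ← Real.rpow_mul (by positivity), ← Real.rpow_natCast (4 * cT T) u.card,
      ← Real.rpow_natCast _ u.card, ← Real.rpow_mul (by positivity),
      ← Real.rpow_mul (by positivity)]
    congr 2 <;> push_cast <;> ring
  unfold weightFactor
  rw [podWeight_rpow h0 h1, Real.mul_rpow (orderConst_pos T _).le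
    (Finset.prod_nonneg fun j _ => podBase_nonneg h0 h1 j), e1, Finset.prod_mul_distrib,
    Finset.prod_mul_distrib, Finset.prod_const,
    Real.finsetProd_rpow _ _ fun j _ => podBase_nonneg h0 h1 j]
  ring

theorem weightFactor_nonneg (h0 : 1 / 2 < l) (h1 : l ≤ 1) (j : ℕ) : 0 ≤ weightFactor T b l j := by
  have := one_le_cT T
  exact mul_nonneg (by positivity) (mul_nonneg (Real.rpow_nonneg (podBase_nonneg h0 h1 j) _)
    (rho_pos h0 h1 _).le)

/-- The factors are of size `b_j ^ (2 λ / (1 + λ))`, the exponent at which `b` enters the sums. -/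
theorem weightFactor_le (h0 : 1 / 2 < l) (h1 : l ≤ 1) (hb : ∀ j, 0 ≤ b j) {d R : ℝ} (hd : 0 < d)
    {j : ℕ} (hdj : d ≤ thetaSeq b l j - b j) (hR : rho l (thetaSeq b l j) ≤ R) :
    weightFactor T b l j ≤ (4 * cT T) ^ (2 * l / (1 + l)) * d ^ (-(l / (1 + l))) *
      R ^ (1 / (1 + l)) * b j ^ (2 * l / (1 + l)) := by
  have hcT := one_le_cT T
  have hρ := rho_pos h0 h1 (thetaSeq b l j)
  have hs := thetaSeq_sub_pos (b := b) h0 j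
  have he : 0 < l / (1 + l) := div_pos (by linarith) (by linarith)
  set e := l / (1 + l) with hedef
  have he1 : 1 / (1 + l) = 1 - e := by
    have : 1 + l ≠ 0 := by linarith
    rw [hedef]; field_simp; ring
  have he2 : 0 < 1 - e := by rw [← he1]; exact one_div_pos.2 (by linarith)
  have he3 : 2 * l / (1 + l) = 2 * e := by rw [hedef]; ring
  have hk : (b j ^ 2 / ((thetaSeq b l j - b j) * rho l (thetaSeq b l j))) ^ e *
      rho l (thetaSeq b l j) = b j ^ (2 * e) * (thetaSeq b l j - b j) ^ (-e) *
        rho l (thetaSeq b l j) ^ (1 - e) := by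
    rw [Real.div_rpow (sq_nonneg _) (by positivity), Real.mul_rpow hs.le hρ.le,
      Real.rpow_sub hρ, Real.rpow_one, Real.rpow_neg hs.le, Real.rpow_mul (hb j), Real.rpow_two]
    field_simp
  rw [weightFactor, hk, he1, he3]
  have h3 : (thetaSeq b l j - b j) ^ (-e) ≤ d ^ (-e) :=
    Real.rpow_le_rpow_of_nonpos hd hdj (by linarith)
  have h4 : rho l (thetaSeq b l j) ^ (1 - e) ≤ R ^ (1 - e) :=
    Real.rpow_le_rpow hρ.le hR he2.le
  have h5 : 0 ≤ b j ^ (2 * e) := Real.rpow_nonneg (hb j) _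
  calc _ ≤ (4 * cT T) ^ (2 * e) * (b j ^ (2 * e) * d ^ (-e) * R ^ (1 - e)) := by gcongr
    _ = _ := by ring

/-- The sums `∑_u γ_u^λ ∏_{j ∈ u} ϱ_j` are bounded in the dimension. Raising the terms to the power
`p / r`, where `r = 2 λ / (1 + λ)`, reduces this to the summability of `b_j^p`. -/
theorem exists_sum_podWeight_le (h0 : 1 / 2 < l) (h1 : l ≤ 1) (hb0 : ∀ j, 0 ≤ b j) (hp : 0 < p)
    (hpr : p ≤ 2 * l / (1 + l)) (hb : Summable fun j => b j ^ p) {c : ℝ} (hc0 : 0 ≤ c)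
    (hc : ∀ j, weightFactor T b l j ≤ c * b j ^ (2 * l / (1 + l)))
    (hcase : p < 1 ∨ p = 1 ∧ c ^ (p / (2 * l / (1 + l))) * ∑' j, b j ^ p < 1) :
    ∃ S : ℝ, 0 < S ∧ ∀ m : ℕ, ∑ u ∈ (Finset.range m).powerset,
      podWeight T b l u ^ l * ∏ j ∈ u, rho l (thetaSeq b l j) ≤ S := by
  set r := 2 * l / (1 + l) with hr
  have hr0 : 0 < r := hp.trans_le hpr
  set q := p / r with hq
  have hq0 : 0 < q := div_pos hp hr0
  have hq1 : q ≤ 1 := (div_le_one hr0).2 hpr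
  have hrq : r * q = p := mul_div_cancel₀ p hr0.ne'
  set S := c ^ q * ∑' j, b j ^ p with hS
  have hS0 : 0 ≤ S := mul_nonneg (Real.rpow_nonneg hc0 _)
    (tsum_nonneg fun j => Real.rpow_nonneg (hb0 j) _)
  have hsum := summable_factorial_rpow hp hS0 hcase
  set A := ∑' k : ℕ, ((k + 1).factorial : ℝ) ^ p * (S ^ k / (k.factorial : ℝ)) with hA
  have hA0 : 0 ≤ A := tsum_nonneg fun k => by positivity
  have hw := fun j => weightFactor_nonneg (T := T) (b := b) h0 h1 j
  refine ⟨A ^ (1 / q) + 1, by positivity, fun m => ?_⟩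
  have hW0 : ∀ u ∈ (Finset.range m).powerset,
      0 ≤ podWeight T b l u ^ l * ∏ j ∈ u, rho l (thetaSeq b l j) := fun u _ =>
    mul_nonneg (Real.rpow_nonneg (podWeight_nonneg h0 h1 u) _)
      (Finset.prod_nonneg fun j _ => (rho_pos h0 h1 _).le)
  have h2 : (∑ u ∈ (Finset.range m).powerset,
      podWeight T b l u ^ l * ∏ j ∈ u, rho l (thetaSeq b l j)) ^ q ≤ A := by
    refine (sum_rpow_le_sum _ hW0 hq0 hq1).trans ?_
    have e : ∀ u : Finset ℕ, (podWeight T b l u ^ l * ∏ j ∈ u, rho l (thetaSeq b l j)) ^ q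
        = ((u.card + 1).factorial : ℝ) ^ p * ∏ j ∈ u, weightFactor T b l j ^ q := fun u => by
      rw [podWeight_rpow_mul_prod h0 h1, Real.mul_rpow (by positivity)
        (Finset.prod_nonneg fun j _ => hw j), ← Real.rpow_mul (by positivity), hrq,
        Real.finsetProd_rpow _ _ fun j _ => hw j]
    simp only [e]
    refine sum_powerset_prod_le (Finset.range m) (fun j => Real.rpow_nonneg (hw j) q) ?_
      (g := fun k => ((k + 1).factorial : ℝ) ^ p) (fun k => by positivity) hsum
    calc ∑ j ∈ Finset.range m, weightFactor T b l j ^ q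
        ≤ ∑ j ∈ Finset.range m, c ^ q * b j ^ p := Finset.sum_le_sum fun j _ => by
          refine (Real.rpow_le_rpow (hw j) (hc j) hq0.le).trans_eq ?_
          rw [Real.mul_rpow hc0 (Real.rpow_nonneg (hb0 j) _), ← Real.rpow_mul (hb0 j), hrq]
      _ = c ^ q * ∑ j ∈ Finset.range m, b j ^ p := (Finset.mul_sum _ _ _).symm
      _ ≤ S := mul_le_mul_of_nonneg_left
          (hb.sum_le_tsum _ fun j _ => Real.rpow_nonneg (hb0 j) _) (Real.rpow_nonneg hc0 _)
  have h3 := Real.rpow_le_rpow (Real.rpow_nonneg (Finset.sum_nonneg hW0) _) h2 (one_div_pos.2 hq0).le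
  rw [← Real.rpow_mul (Finset.sum_nonneg hW0), mul_one_div_cancel hq0.ne', Real.rpow_one] at h3
  linarith

end PodWeights

/-! ### The totient function -/

/-- For numbers `p₁ < p₂ < …` greater than `1`, the `i`-th number is at least `i + 1`. -/
theorem prod_bounds_of_two_le (s : Finset ℕ) (hs : ∀ p ∈ s, 2 ≤ p) :
    (s.card + 1).factorial ≤ ∏ p ∈ s, p ∧ ∏ p ∈ s, p ≤ (s.card + 1) * ∏ p ∈ s, (p - 1) := by
  induction s using Finset.induction_on_max with
  | empty => simp
  | insert a s ha ih =>
    obtain ⟨ih1, ih2⟩ := ih fun p hp => hs p (Finset.mem_insert_of_mem hp)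
    have hns : a ∉ s := fun h => lt_irrefl a (ha a h)
    have hcard : s.card + 2 ≤ a := by
      have h1 : s ⊆ Finset.Ico 2 a := fun p hp =>
        Finset.mem_Ico.2 ⟨hs p (Finset.mem_insert_of_mem hp), ha p hp⟩
      have h2 := Finset.card_le_card h1
      have h3 := hs a (Finset.mem_insert_self a s)
      rw [Nat.card_Ico] at h2
      omega
    rw [Finset.card_insert_of_notMem hns, Finset.prod_insert hns, Finset.prod_insert hns]
    constructor
    · rw [Nat.factorial_succ]
      exact Nat.mul_le_mul (by omega) ih1
    · obtain ⟨c, rfl⟩ : ∃ c, a = c + 1 := ⟨a - 1, by omega⟩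
      rw [Nat.add_sub_cancel]
      have h4 : (c + 1) * (s.card + 1) ≤ (s.card + 1 + 1) * c := by nlinarith
      calc (c + 1) * ∏ p ∈ s, p ≤ (c + 1) * ((s.card + 1) * ∏ p ∈ s, (p - 1)) :=
            Nat.mul_le_mul_left _ ih2
        _ = (c + 1) * (s.card + 1) * ∏ p ∈ s, (p - 1) := by ring
        _ ≤ (s.card + 1 + 1) * c * ∏ p ∈ s, (p - 1) := Nat.mul_le_mul_right _ h4
        _ = _ := by ring

/-- A number up to `10 ^ 30` has at most `27` prime factors, since `29! > 10 ^ 30`. -/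
theorem le_mul_totient {N : ℕ} (hN0 : 1 ≤ N) (hN : N ≤ 10 ^ 30) : N ≤ 28 * N.totient := by
  obtain ⟨h1, h2⟩ := prod_bounds_of_two_le N.primeFactors fun p hp =>
    (Nat.prime_of_mem_primeFactors hp).two_le
  have h3 : ∏ p ∈ N.primeFactors, p ≤ N := Nat.le_of_dvd hN0 (Nat.prod_primeFactors_dvd N)
  have h4 : N.primeFactors.card + 1 ≤ 28 := by
    by_contra hc
    have h5 : (29).factorial ≤ (N.primeFactors.card + 1).factorial :=
      Nat.factorial_le (by omega)
    have h6 : 10 ^ 30 < (29).factorial := by decide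
    omega
  have h7 := Nat.totient_mul_prod_primeFactors N
  have h8 : 0 < ∏ p ∈ N.primeFactors, p :=
    Finset.prod_pos fun p hp => (Nat.prime_of_mem_primeFactors hp).pos
  refine Nat.le_of_mul_le_mul_right ?_ h8
  calc N * ∏ p ∈ N.primeFactors, p
      ≤ N * (28 * ∏ p ∈ N.primeFactors, (p - 1)) :=
        Nat.mul_le_mul_left _ (h2.trans (Nat.mul_le_mul_right _ h4))
    _ = 28 * (N * ∏ p ∈ N.primeFactors, (p - 1)) := by ring
    _ = 28 * (N.totient * ∏ p ∈ N.primeFactors, p) := by rw [h7]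
    _ = _ := by ring

/-! ### The error of the lattice rules of the component-by-component construction -/

/-- The exponential moments are `1 + O(x)`, so that their product over all coordinates converges. -/
theorem integral_exp_abs_le {B x : ℝ} (hx0 : 0 ≤ x) (hx : x ≤ B) :
    ∫ t, Real.exp (2 * x * |t|) ∂stdGauss
      ≤ Real.exp (x * ∫ t, 2 * Real.exp ((2 * B + 1) * |t|) ∂stdGauss) := by
  have hi := (integrable_exp_abs_gauss (2 * B + 1)).const_mul 2
  have h1 : ∀ t : ℝ, Real.exp (2 * x * |t|) ≤ 1 + x * (2 * Real.exp ((2 * B + 1) * |t|)) := fun t => by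
    have ht := abs_nonneg t
    -- `e^y ≤ 1 + y e^y`
    have h2 : Real.exp (2 * x * |t|) ≤ 1 + 2 * x * |t| * Real.exp (2 * x * |t|) := by
      have h3 := Real.add_one_le_exp (-(2 * x * |t|))
      have h4 : Real.exp (2 * x * |t|) * Real.exp (-(2 * x * |t|)) = 1 := by
        rw [← Real.exp_add, add_neg_cancel, Real.exp_zero]
      nlinarith [Real.exp_pos (2 * x * |t|)]
    have h5 : |t| * Real.exp (2 * x * |t|) ≤ Real.exp ((2 * B + 1) * |t|) := by
      rw [add_mul, add_comm, one_mul, Real.exp_add]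
      have h6 : |t| ≤ Real.exp |t| := by linarith [Real.add_one_le_exp |t|]
      have h7 : Real.exp (2 * x * |t|) ≤ Real.exp (2 * B * |t|) := by
        rw [Real.exp_le_exp]; gcongr
      gcongr
    nlinarith
  refine (integral_mono (integrable_exp_abs_gauss _) ((integrable_const 1).add (hi.const_mul x))
    h1).trans ?_
  rw [integral_add' (integrable_const 1) (hi.const_mul x), integral_const_mul, integral_const,
    probReal_univ, one_smul]
  linarith [Real.add_one_le_exp (x * ∫ t, 2 * Real.exp ((2 * B + 1) * |t|) ∂stdGauss)]

/-- Sums over nonempty sets of indices in `Fin m` and in `{0, …, m - 1}`. -/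
theorem sum_erase_empty_map {m : ℕ} (f : Finset ℕ → ℝ) :
    ∑ u ∈ (Finset.univ : Finset (Finset (Fin m))).erase ∅, f (u.map Fin.valEmbedding)
      = ∑ u ∈ (Finset.range m).powerset with u.Nonempty, f u := by
  classical
  refine Finset.sum_nbij (fun u => u.map Fin.valEmbedding) (fun u hu => ?_)
    ((Finset.map_injective _).injOn) (fun v hv => ?_) fun _ _ => rfl
  · refine Finset.mem_filter.2 ⟨Finset.mem_powerset.2 fun j hj => ?_, ?_⟩
    · obtain ⟨i, -, rfl⟩ := Finset.mem_map.1 hj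
      exact Finset.mem_range.2 i.2
    · rw [Finset.map_nonempty]
      exact Finset.nonempty_iff_ne_empty.2 (Finset.ne_of_mem_erase hu)
  · obtain ⟨hv1, hv2⟩ := Finset.mem_filter.1 (Finset.mem_coe.1 hv)
    have hv3 := Finset.mem_powerset.1 hv1
    have e : (Finset.univ.filter fun j : Fin m => (j : ℕ) ∈ v).map Fin.valEmbedding = v := by
      ext j
      simp only [Finset.mem_map, Finset.mem_filter, Finset.mem_univ, true_and,
        Fin.valEmbedding_apply]
      exact ⟨fun ⟨i, hi, hij⟩ => hij ▸ hi, fun hj => ⟨⟨j, Finset.mem_range.1 (hv3 hj)⟩, hj, rfl⟩⟩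
    refine ⟨_, Finset.mem_coe.2 (Finset.mem_erase.2 ⟨fun h => ?_, Finset.mem_univ _⟩), e⟩
    rw [h, Finset.map_empty] at e
    exact hv2.ne_empty e.symm

/-- The differences of two lattice points are lattice points, each one occurring `N` times. -/
theorem sum_sum_shiftKernel {N : ℕ} [NeZero N] {m : ℕ} (θ : ℕ → ℝ) (z : ℕ → ℕ)
    (u : Finset (Fin m)) :
    (1 / (N : ℝ)) ^ 2 * ∑ k ∈ Finset.Icc 1 N, ∑ k' ∈ Finset.Icc 1 N, ∏ j ∈ u, shiftKernel (θ j)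
        (Int.fract ((k : ℝ) * z j / N - (k' : ℝ) * z j / N))
      = 1 / (N : ℝ) * ∑ a : ZMod N, ∏ j ∈ u.map Fin.valEmbedding,
        shiftKernel (θ j) (((a * (z j : ZMod N)).val : ℝ) / N) := by
  set f : ZMod N → ℝ := fun a => ∏ j ∈ u.map Fin.valEmbedding,
    shiftKernel (θ j) (((a * (z j : ZMod N)).val : ℝ) / N) with hf
  have e : ∀ k k' : ℕ, ∏ j ∈ u, shiftKernel (θ j)
      (Int.fract ((k : ℝ) * z j / N - (k' : ℝ) * z j / N)) = f ((k : ZMod N) - (k' : ZMod N)) :=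
    fun k k' => by
    simp only [hf, Finset.prod_map, Fin.valEmbedding_apply]
    refine Finset.prod_congr rfl fun j _ => ?_
    have := fract_intCast_div (N := N) (((k : ℤ) - k') * z j)
    push_cast at this
    rw [← this]
    congr 2
    ring
  have hN : (N : ℝ) ≠ 0 := by exact_mod_cast NeZero.ne N
  simp only [e]
  have e2 : ∀ k : ℕ, ∑ k' ∈ Finset.Icc 1 N, f ((k : ZMod N) - (k' : ZMod N)) = ∑ a, f a := fun k => by
    rw [sum_Icc_natCast (fun a => f ((k : ZMod N) - a))]
    exact Equiv.sum_comp (Equiv.subLeft (k : ZMod N)) f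
  simp only [e2]
  rw [Finset.sum_const, Nat.card_Icc, Nat.add_sub_cancel, nsmul_eq_mul]
  field_simp

/-- The mean square error of a lattice rule from the component-by-component construction, for
functions whose mixed first derivatives obey bounds of product and order dependent form. -/
theorem rmsError_sq_le_of_isCBC {m N : ℕ} [NeZero N] {F : Finset (Fin m) → (Fin m → ℝ) → ℂ}
    (hF : IsMixedFamily F) {b : ℕ → ℝ} (hb : ∀ j, 0 ≤ b j) {T K l : ℝ}
    (hD : ∀ u ξ, ‖F u ξ‖ ≤ K * (((u.card + 1).factorial : ℝ) * (4 * cT T) ^ u.card *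
      ∏ j ∈ u, b j) * Real.exp (∑ j : Fin m, b j * |ξ j|))
    (h0 : 1 / 2 < l) (h1 : l ≤ 1) {M S : ℝ}
    (hM : ∏ j : Fin m, ∫ t, Real.exp (2 * b j * |t|) ∂stdGauss ≤ M)
    (hS : ∑ u ∈ (Finset.range m).powerset,
      podWeight T b l u ^ l * ∏ j ∈ u, rho l (thetaSeq b l j) ≤ S) {z : ℕ → ℕ}
    (hz : IsCBC (podWeight T b l) (thetaSeq b l) N m z) :
    MemLp (qmcError N z (F ∅)) 2 (uniformCube m) ∧
      rmsError N z (F ∅) ^ 2 ≤ K ^ 2 * M * S * (1 / (N.totient : ℝ) * S) ^ (1 / l) := by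
  have hN : 1 ≤ N := Nat.pos_of_ne_zero (NeZero.ne N)
  set γ := podWeight T b l with hγdef
  set θ := thetaSeq b l with hθdef
  have hγ : ∀ u, 0 ≤ γ u := podWeight_nonneg h0 h1
  have hM0 : 0 ≤ M := (Finset.prod_nonneg fun j _ =>
    integral_nonneg fun t => Real.exp_nonneg _).trans hM
  set W : Finset ℕ → ℝ := fun u => γ u ^ l * ∏ j ∈ u, rho l (θ j) with hW
  have hW0 : ∀ u, 0 ≤ W u := fun u => mul_nonneg (Real.rpow_nonneg (hγ u) _)
    (Finset.prod_nonneg fun j _ => (rho_pos h0 h1 _).le)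
  have hSW : ∑ u ∈ (Finset.range m).powerset with u.Nonempty, W u ≤ S :=
    (Finset.sum_le_sum_of_subset_of_nonneg (Finset.filter_subset _ _) fun u _ _ => hW0 u).trans hS
  have hSW0 : 0 ≤ ∑ u ∈ (Finset.range m).powerset with u.Nonempty, W u :=
    Finset.sum_nonneg fun u _ => hW0 u
  have h := rmsError_sq_le hF (b := fun j : Fin m => b j)
    (D := fun u => K * (((u.card + 1).factorial : ℝ) * (4 * cT T) ^ u.card * ∏ j ∈ u, b j))
    (fun j => hb j) hD hN z (θ := fun j : Fin m => θ j)
    (fun j => by linarith [thetaSeq_sub_pos (b := b) h0 j])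
    (γ := fun u => γ (u.map Fin.valEmbedding))
    (R := fun u => K ^ 2 * M * W (u.map Fin.valEmbedding)) (fun u => hγ _)
    (fun u => mul_nonneg (mul_nonneg (sq_nonneg K) hM0) (hW0 _)) fun u => by
    have hbal := podWeight_mul (T := T) (b := b) h0 h1 (u.map Fin.valEmbedding)
    rw [← hγdef, ← hθdef, Finset.card_map, Finset.prod_map] at hbal
    simp only [Fin.valEmbedding_apply] at hbal
    have e : (K * (((u.card + 1).factorial : ℝ) * (4 * cT T) ^ u.card * ∏ j ∈ u, b j)) ^ 2 *
        (∏ j ∈ u, 1 / (θ j - b j)) = K ^ 2 * (orderConst T u.card * ∏ j ∈ u, b j ^ 2 / (θ j - b j)) := by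
      rw [orderConst]
      simp only [div_eq_mul_inv, one_mul, Finset.prod_mul_distrib, Finset.prod_pow]
      ring
    rw [e, hbal]
    calc _ ≤ K ^ 2 * (γ (u.map Fin.valEmbedding) * W (u.map Fin.valEmbedding)) * M :=
          mul_le_mul_of_nonneg_left hM
            (mul_nonneg (sq_nonneg K) (mul_nonneg (hγ _) (hW0 _)))
      _ = _ := by ring
  refine ⟨h.1, h.2.trans ?_⟩
  rw [← Finset.mul_sum, sum_erase_empty_map W]
  have e3 : ∑ u ∈ (Finset.univ : Finset (Finset (Fin m))).erase ∅, γ (u.map Fin.valEmbedding) *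
      ((1 / (N : ℝ)) ^ 2 * ∑ k ∈ Finset.Icc 1 N, ∑ k' ∈ Finset.Icc 1 N, ∏ j ∈ u,
        shiftKernel (θ j) (Int.fract ((k : ℝ) * z j / N - (k' : ℝ) * z j / N)))
      = latSq γ θ (fun j => (z j : ZMod N)) m := by
    simp only [sum_sum_shiftKernel]
    rw [sum_erase_empty_map fun v => γ v * (1 / (N : ℝ) * ∑ a : ZMod N, ∏ j ∈ v,
      shiftKernel (θ j) (((a * (z j : ZMod N)).val : ℝ) / N)), latSq]
  rw [e3]
  obtain ⟨hl0, hl1⟩ := hz.shiftAvgError_sq_le hγ h0 h1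
  have hl : 0 < l := by linarith
  have h5 : latSq γ θ (fun j => (z j : ZMod N)) m ≤ (1 / (N.totient : ℝ) * S) ^ (1 / l) := by
    refine hl1.trans (Real.rpow_le_rpow (mul_nonneg (by positivity) hSW0) ?_ (by positivity))
    exact mul_le_mul_of_nonneg_left hSW (by positivity)
  exact mul_le_mul (mul_le_mul_of_nonneg_left hSW (mul_nonneg (sq_nonneg K) hM0)) h5 hl0
    (mul_nonneg (mul_nonneg (sq_nonneg K) hM0) (hSW0.trans hSW))

theorem bSeq_nonneg {v : ℕ → Torus → ℝ} {lam : ℕ → ℝ} (hlam : ∀ j, 0 < lam j) (j : ℕ) :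
    0 ≤ bSeq v lam j := mul_nonneg (hlam j).le ENNReal.toReal_nonneg

/-- The product of the Gaussian exponential moments is bounded in the dimension. -/
theorem exists_prod_integral_le {b : ℕ → ℝ} (hb0 : ∀ j, 0 ≤ b j) {p : ℝ} (hp : 0 < p)
    (hp1 : p ≤ 1) (hb : Summable fun j => b j ^ p) {B : ℝ} (hB : ∀ j, b j ≤ B) :
    ∃ M : ℝ, 0 < M ∧ ∀ m : ℕ, ∏ j : Fin m, ∫ t, Real.exp (2 * b j * |t|) ∂stdGauss ≤ M := by
  set c := ∫ t, 2 * Real.exp ((2 * B + 1) * |t|) ∂stdGauss with hc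
  have hc0 : 0 ≤ c := integral_nonneg fun t => by positivity
  set A := ∑' j, b j ^ p with hA
  refine ⟨Real.exp (A ^ (1 / p) * c), Real.exp_pos _, fun m => ?_⟩
  -- `ℓ^p` embeds into `ℓ^1`
  have h1 : ∑ j ∈ Finset.range m, b j ≤ A ^ (1 / p) := by
    have h0 : 0 ≤ ∑ j ∈ Finset.range m, b j := Finset.sum_nonneg fun j _ => hb0 j
    have h2 : (∑ j ∈ Finset.range m, b j) ^ p ≤ A :=
      (sum_rpow_le_sum _ (fun j _ => hb0 j) hp hp1).trans
        (hb.sum_le_tsum _ fun j _ => Real.rpow_nonneg (hb0 j) p)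
    have h3 := Real.rpow_le_rpow (Real.rpow_nonneg h0 _) h2 (one_div_pos.2 hp).le
    rwa [← Real.rpow_mul h0, mul_one_div_cancel hp.ne', Real.rpow_one] at h3
  rw [Fin.prod_univ_eq_prod_range fun j => ∫ t, Real.exp (2 * b j * |t|) ∂stdGauss]
  calc _ ≤ ∏ j ∈ Finset.range m, Real.exp (b j * c) :=
        Finset.prod_le_prod (fun j _ => integral_nonneg fun t => Real.exp_nonneg _)
          fun j _ => integral_exp_abs_le (hb0 j) (hB j)
    _ = Real.exp ((∑ j ∈ Finset.range m, b j) * c) := by rw [← Real.exp_sum, Finset.sum_mul]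
    _ ≤ _ := Real.exp_le_exp.2 (mul_le_mul_of_nonneg_right h1 hc0)

theorem exists_le_of_summable_rpow {b : ℕ → ℝ} (hb0 : ∀ j, 0 ≤ b j) {p : ℝ} (hp : 0 < p)
    (hb : Summable fun j => b j ^ p) : ∃ B, 0 ≤ B ∧ ∀ j, b j ≤ B := by
  refine ⟨(∑' j, b j ^ p) ^ (1 / p), Real.rpow_nonneg
    (tsum_nonneg fun j => Real.rpow_nonneg (hb0 j) p) _, fun j => ?_⟩
  have h := Real.rpow_le_rpow (Real.rpow_nonneg (hb0 j) p)
    (hb.le_tsum j fun i _ => Real.rpow_nonneg (hb0 i) p) (one_div_pos.2 hp).le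
  rwa [← Real.rpow_mul (hb0 j), mul_one_div_cancel hp.ne', Real.rpow_one] at h

/-- The sums of the weights that enter the error bound are bounded in the dimension. If `p = 1`,
the smallness assumption makes the series geometric. -/
theorem exists_sum_podWeight_lamStar_le {b : ℕ → ℝ} (hb0 : ∀ j, 0 ≤ b j) {p δ T : ℝ} (hp : 0 < p)
    (hp1 : p ≤ 1) (hb : Summable fun j => b j ^ p) (hδ_pos : 0 < δ) (hδ_le : δ ≤ 1 / 2)
    (hadd : p = 1 → ∃ θmax : ℝ, (∀ j, thetaSeq b (lamStar p δ) j < θmax) ∧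
      ∑' j, b j < √(⨅ j, (thetaSeq b (lamStar p δ) j - b j)) / (4 * cT T * √(rho 1 θmax))) :
    ∃ S : ℝ, 0 < S ∧ ∀ m : ℕ, ∑ u ∈ (Finset.range m).powerset,
      podWeight T b (lamStar p δ) u ^ lamStar p δ *
        ∏ j ∈ u, rho (lamStar p δ) (thetaSeq b (lamStar p δ) j) ≤ S := by
  obtain ⟨h0, h1⟩ := lamStar_mem hp1 hδ_pos hδ_le
  have hpr := le_two_mul_lamStar_div hp hp1 hδ_pos hδ_le
  have hcT := one_le_cT T
  rcases hp1.lt_or_eq with hlt | rfl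
  · obtain ⟨B, hB0, hB⟩ := exists_le_of_summable_rpow hb0 hp hb
    obtain ⟨d, hd, hdj⟩ := thetaSeq_sub_ge h0 hb0 hB
    have hR := rho_pos h0 h1 (B + 1)
    refine exists_sum_podWeight_le h0 h1 hb0 hp hpr hb ?_ (fun j => weightFactor_le h0 h1 hb0 hd
      (hdj j) (R := rho (lamStar p δ) (B + 1)) ?_) (Or.inl hlt)
    · positivity
    · exact rho_le_rho h0 h1 (thetaSeq_le h0 hb0 j).1
        ((thetaSeq_le h0 hb0 j).2.trans (by linarith [hB j]))
  · have hl : lamStar 1 δ = 1 := by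
      rw [lamStar, if_neg (by norm_num)]; norm_num
    rw [hl] at h0 h1 hpr hadd ⊢
    obtain ⟨θmax, hθ, hsum⟩ := hadd rfl
    set d := ⨅ j, (thetaSeq b 1 j - b j) with hd
    have hbdd : BddBelow (Set.range fun j => thetaSeq b 1 j - b j) :=
      ⟨0, by rintro _ ⟨j, rfl⟩; exact (thetaSeq_sub_pos h0 j).le⟩
    have htsum0 : 0 ≤ ∑' j, b j := tsum_nonneg hb0
    -- otherwise the right-hand side of the smallness assumption is zero
    have hd0 : 0 < d := by
      by_contra hc
      rw [Real.sqrt_eq_zero_of_nonpos (not_lt.1 hc), zero_div] at hsum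
      linarith
    have hR := rho_pos h0 h1 θmax
    refine exists_sum_podWeight_le h0 h1 hb0 hp hpr hb ?_ (fun j => weightFactor_le h0 h1 hb0 hd0
      (ciInf_le hbdd j) (rho_le_rho h0 h1 (thetaSeq_le h0 hb0 j).1 (hθ j).le)) (Or.inr ⟨rfl, ?_⟩)
    · positivity
    · rw [show (2 : ℝ) * 1 / (1 + 1) = 1 by norm_num, div_one, Real.rpow_one, Real.rpow_one,
        show (1 : ℝ) / (1 + 1) = 1 / 2 by norm_num, Real.rpow_neg hd0.le, ← Real.sqrt_eq_rpow,
        ← Real.sqrt_eq_rpow]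
      simp only [Real.rpow_one]
      have hsd := Real.sqrt_pos.2 hd0
      have hsR := Real.sqrt_pos.2 hR
      rw [lt_div_iff₀ (by positivity)] at hsum
      calc 4 * cT T * (√d)⁻¹ * √(rho 1 θmax) * ∑' j, b j
          = ((∑' j, b j) * (4 * cT T * √(rho 1 θmax))) / √d := by field_simp
        _ < 1 := by rwa [div_lt_one hsd]

end QMCTS

end

theorem mainTheorem2
    (s : ℝ) (hs : 1 ≤ s)
    (ψin : QMCTS.L2T) (hψin : QMCTS.MemSobolev s ψin)
    (v₀ : QMCTS.Torus → ℝ) (hv₀ : QMCTS.MemSobolev s (fun x => (v₀ x : ℂ)))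
    (v : ℕ → QMCTS.Torus → ℝ) (hvs : ∀ j, QMCTS.MemSobolev s (fun x => (v j x : ℂ)))
    (hvw : ∀ j, QMCTS.MemW1inf (v j))
    (lam : ℕ → ℝ) (hlam : Antitone lam) (hlam_pos : ∀ j, 0 < lam j)
    (G : QMCTS.sobolev 1 →ₗ[ℂ] ℂ)
    (hG : ∃ K : ℝ, ∀ f : QMCTS.sobolev 1,
      ‖G f‖ ≤ K * QMCTS.sobolevNorm 1 ((f : QMCTS.L2T) : QMCTS.Torus → ℂ))
    (ha : Summable fun j => lam j * QMCTS.sobolevNorm s (fun x => (v j x : ℂ)))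
    (p : ℝ) (hp_pos : 0 < p) (hp_le : p ≤ 1)
    (b : ℕ → ℝ) (hb_def : b = QMCTS.bSeq v lam) (hb : Summable fun j => b j ^ p)
    (T : ℝ) (hT : 0 < T)
    (δ : ℝ) (hδ_pos : 0 < δ) (hδ_le : δ ≤ 1 / 2)
    (θ : ℕ → ℝ) (hθ : θ = QMCTS.thetaSeq b (QMCTS.lamStar p δ))
    (γ : Finset ℕ → ℝ) (hγ : γ = QMCTS.podWeight T b (QMCTS.lamStar p δ))
    (hadd : p = 1 → ∃ θmax : ℝ, (∀ j, θ j < θmax) ∧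
      ∑' j, b j < √(⨅ j, (θ j - b j)) / (4 * QMCTS.cT T * √(QMCTS.rho 1 θmax))) :
    ∃ C : ℝ, 0 < C ∧ ∀ m N : ℕ, 1 ≤ m → 1 ≤ N →
      (∃ z : ℕ → ℕ, QMCTS.IsCBC γ θ N m z) ∧
      ∀ z : ℕ → ℕ, QMCTS.IsCBC γ θ N m z →
        ∀ (τ : ℝ) (n : ℕ), 0 < τ → n * τ ≤ T →
          (∀ ξ : Fin m → ℝ, QMCTS.MemSobolev 1
            (QMCTS.density (QMCTS.semiDiscrete ψin v₀ v lam τ n ξ))) ∧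
          MeasureTheory.Integrable (QMCTS.quantity G ψin v₀ v lam τ n m)
            (QMCTS.gaussMeasure m) ∧
          MeasureTheory.MemLp (QMCTS.qmcError N z (QMCTS.quantity G ψin v₀ v lam τ n m)) 2
            (QMCTS.uniformCube m) ∧
          QMCTS.rmsError N z (QMCTS.quantity G ψin v₀ v lam τ n m)
            ≤ C * (Nat.totient N : ℝ) ^ (-QMCTS.rate p δ) ∧
          (N ≤ 10 ^ 30 →
            QMCTS.rmsError N z (QMCTS.quantity G ψin v₀ v lam τ n m)
              ≤ C * (N : ℝ) ^ (-QMCTS.rate p δ)) := by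
  subst hb_def hθ hγ
  have hb0 : ∀ j, 0 ≤ QMCTS.bSeq v lam j := QMCTS.bSeq_nonneg hlam_pos
  obtain ⟨h0, h1⟩ := QMCTS.lamStar_mem hp_le hδ_pos hδ_le
  have hrate := QMCTS.rate_eq (δ := δ) hp_le hδ_le
  set l := QMCTS.lamStar p δ with hl
  have hl0 : 0 < l := by linarith
  obtain ⟨K, -, hquantity⟩ := QMCTS.exists_quantity_family hs hψin hv₀ hvs hvw hlam_pos hG hT
  obtain ⟨B, -, hB⟩ := QMCTS.exists_le_of_summable_rpow hb0 hp_pos hb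
  obtain ⟨M, hM0, hM⟩ := QMCTS.exists_prod_integral_le hb0 hp_pos hp_le hb hB
  obtain ⟨S, hS0, hS⟩ := QMCTS.exists_sum_podWeight_lamStar_le (T := T) hb0 hp_pos hp_le hb hδ_pos
    hδ_le hadd
  set A : ℝ := √(K ^ 2 * M * S * S ^ (1 / l)) with hA
  have hA0 : 0 ≤ A := Real.sqrt_nonneg _
  have hA2 : A ^ 2 = K ^ 2 * M * S * S ^ (1 / l) := Real.sq_sqrt (by positivity)
  have hκ0 : 0 ≤ QMCTS.rate p δ := by rw [hrate]; positivity
  have hκ1 : QMCTS.rate p δ ≤ 1 := by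
    rw [hrate, div_le_one (by positivity)]; linarith
  -- `28` comes from `N ≤ 28 φ(N)`, and `1` makes the constant positive
  refine ⟨28 * A + 1, by positivity, fun m N _ hN => ?_⟩
  have : NeZero N := ⟨by omega⟩
  refine ⟨QMCTS.exists_isCBC m, fun z hz τ n hτ hn => ?_⟩
  obtain ⟨hmem, F, hF, hF0, hFD⟩ := hquantity m τ n hτ hn
  have hφ : (0 : ℝ) < N.totient := by exact_mod_cast Nat.totient_pos.2 hN
  obtain ⟨hLp, herr⟩ := QMCTS.rmsError_sq_le_of_isCBC hF hb0 hFD h0 h1 (hM m) (hS m) hz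
  have hint := QMCTS.integrable_of_isMixedFamily hF (fun j => hb0 j) hFD
  rw [hF0] at hLp herr hint
  have hmain : QMCTS.rmsError N z (QMCTS.quantity G ψin v₀ v lam τ n m)
      ≤ A * (N.totient : ℝ) ^ (-QMCTS.rate p δ) := by
    refine le_of_abs_le (abs_le_of_sq_le_sq (herr.trans_eq ?_) (by positivity))
    have e : ((N.totient : ℝ) ^ (-QMCTS.rate p δ)) ^ 2 = (N.totient : ℝ) ^ (-(1 / l)) := by
      rw [← Real.rpow_mul_natCast hφ.le, hrate]
      congr 1
      push_cast
      field_simp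
    rw [mul_pow, hA2, e, Real.mul_rpow (by positivity) hS0.le, one_div (N.totient : ℝ),
      Real.inv_rpow hφ.le, ← Real.rpow_neg hφ.le]
    ring
  refine ⟨hmem, hint, hLp, hmain.trans (mul_le_mul_of_nonneg_right (by linarith) (by positivity)),
    fun hN30 => hmain.trans ?_⟩
  have hN0 : (0 : ℝ) < N := by exact_mod_cast hN
  have htot : (N : ℝ) ≤ 28 * N.totient := by exact_mod_cast QMCTS.le_mul_totient hN hN30
  have h2 : (N.totient : ℝ) ^ (-QMCTS.rate p δ) ≤ 28 * (N : ℝ) ^ (-QMCTS.rate p δ) := by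
    rw [Real.rpow_neg hφ.le, Real.rpow_neg hN0.le, ← div_eq_mul_inv, inv_eq_one_div,
      div_le_div_iff₀ (by positivity) (by positivity), one_mul]
    calc (N : ℝ) ^ QMCTS.rate p δ ≤ (28 * N.totient) ^ QMCTS.rate p δ :=
          Real.rpow_le_rpow hN0.le htot hκ0
      _ = 28 ^ QMCTS.rate p δ * (N.totient : ℝ) ^ QMCTS.rate p δ :=
          Real.mul_rpow (by norm_num) hφ.le
      _ ≤ 28 ^ (1 : ℝ) * (N.totient : ℝ) ^ QMCTS.rate p δ := by
          gcongr
          norm_num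
      _ = _ := by rw [Real.rpow_one]
  have h3 : 0 ≤ (N : ℝ) ^ (-QMCTS.rate p δ) := by positivity
  calc A * (N.totient : ℝ) ^ (-QMCTS.rate p δ)
      ≤ A * (28 * (N : ℝ) ^ (-QMCTS.rate p δ)) := mul_le_mul_of_nonneg_left h2 hA0
    _ ≤ (28 * A + 1) * (N : ℝ) ^ (-QMCTS.rate p δ) := by linarith
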